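/- Let $\alpha : G \to \operatorname{Aut} A$ be an action of a discrete group $G$ on a $C^*$-algebra $A$ (not assumed unital or separable), let $A \rtimes_\alpha G$ be the full crossed product, and let $\mathcal K$ denote the compact operators on $\ell^2(\mathbb N)$. Conventions. A $C^*$-algebra is *AF* if it is the closure of the union of an upward directed family of finite-dimensional $C^*$-subalgebras (in the separable case: of an increasing sequence), and $B$ is *AF-embeddable* if there is an injective $*$-homomorphism from $B$ into an AF algebra. $B$ is *quasidiagonal* if it has a faithful representation $\pi : B \to B(\mathcal H)$ such that for every finite $\omega \subset \pi(B)$, every finite $\chi \subset \mathcal H$ and every $\varepsilon > 0$ there is a finite-rank projection $P$ with $\|TP - PT\| < \varepsilon$ for $T \in \omega$ and $\|Px - x\| < \varepsilon$ for $x \in \chi$. A projection is *infinite* if it is Murray–von Neumann equivalent to a proper subprojection of itself, and *finite* otherwise. $B$ is *finite* if it has an approximate unit of projections and all projections in $B$ are finite; $B$ is *stably finite* if $B \otimes \mathcal K$ is finite. $K_0(A)^+$ is the set of classes in $K_0(A)$ of projections in matrix algebras over $A$, and *$K_0(A)$ has cancellation* if any two projections in matrix algebras over $A$ with the same class in $K_0(A)$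 are Murray–von Neumann equivalent. $H_\alpha$ is the subgroup of $K_0(A)$ generated by $\{(\operatorname{id} - K_0(\alpha_g))K_0(A) : g \in G\}$. Then: 1. If $A \rtimes_\alpha G$ is AF-embeddable, then it is quasidiagonal. 2. If $A \rtimes_\alpha G$ is quasidiagonal, then all projections in $(A \rtimes_\alpha G) \otimes \mathcal K$ are finite; if moreover $A \otimes \mathcal K$ has an approximate unit of projections (for instance, if $A$ has one), then $A \rtimes_\alpha G$ is stably finite. 3. If $K_0(A)$ has cancellation and $A \rtimes_\alpha G$ is stably finite, then $H_\alpha \cap K_0(A)^+ = \{0\}$. -/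

import Mathlib

/-- A C⋆-seminorm on a complex ⋆-algebra. -/
structure CStarSeminorm (E : Type*) [NonUnitalRing E] [StarRing E] [Module ℂ E]
    extends Seminorm ℂ E where
  mul_le' : ∀ x y : E, toFun (x * y) ≤ toFun x * toFun y
  star_mul_self' : ∀ x : E, toFun (star x * x) = toFun x * toFun x

namespace CStarSeminorm

section Basic

variable {E : Type*} [NonUnitalRing E] [StarRing E] [Module ℂ E]

theorem mul_le (γ : CStarSeminorm E) (x y : E) :
    γ.toSeminorm (x * y) ≤ γ.toSeminorm x * γ.toSeminorm y := γ.mul_le' x y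

theorem star_mul_self (γ : CStarSeminorm E) (x : E) :
    γ.toSeminorm (star x * x) = γ.toSeminorm x * γ.toSeminorm x := γ.star_mul_self' x

theorem le_star (γ : CStarSeminorm E) (x : E) :
    γ.toSeminorm x ≤ γ.toSeminorm (star x) := by
  have h := γ.mul_le (star x) x
  rw [γ.star_mul_self] at h
  have h0 : 0 ≤ γ.toSeminorm x := apply_nonneg _ _
  have h1 : 0 ≤ γ.toSeminorm (star x) := apply_nonneg _ _
  by_contra! hc
  nlinarith

theorem star_eq (γ : CStarSeminorm E) (x : E) :
    γ.toSeminorm (star x) = γ.toSeminorm x :=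
  le_antisymm (by simpa using γ.le_star (star x)) (γ.le_star x)

/-- The ⋆-algebra `E`, regarded as a seminormed ring by means of the C⋆-seminorm `γ`. -/
def Pre (_γ : CStarSeminorm E) : Type _ := E

variable (γ : CStarSeminorm E)

instance : NonUnitalRing γ.Pre := inferInstanceAs (NonUnitalRing E)
instance : StarRing γ.Pre := inferInstanceAs (StarRing E)
instance : Module ℂ γ.Pre := inferInstanceAs (Module ℂ E)
instance [IsScalarTower ℂ E E] : IsScalarTower ℂ γ.Pre γ.Pre :=
  inferInstanceAs (IsScalarTower ℂ E E)
instance [SMulCommClass ℂ E E] : SMulCommClass ℂ γ.Pre γ.Pre :=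
  inferInstanceAs (SMulCommClass ℂ E E)
instance [StarModule ℂ E] : StarModule ℂ γ.Pre := inferInstanceAs (StarModule ℂ E)

/-- The C⋆-seminorm `γ`, as a seminorm on `γ.Pre`. -/
noncomputable def preSeminorm : Seminorm ℂ γ.Pre where
  toFun := γ.toSeminorm
  map_zero' := map_zero γ.toSeminorm
  add_le' := map_add_le_add γ.toSeminorm
  neg' := map_neg_eq_map γ.toSeminorm
  smul' := map_smul_eq_mul γ.toSeminorm

noncomputable instance : SeminormedAddCommGroup γ.Pre :=
  γ.preSeminorm.toAddGroupSeminorm.toSeminormedAddCommGroup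

theorem norm_def (x : γ.Pre) : ‖x‖ = γ.toSeminorm (show E from x) := rfl

noncomputable instance : NonUnitalSeminormedRing γ.Pre where
  __ := (inferInstance : SeminormedAddCommGroup γ.Pre)
  __ := (inferInstance : NonUnitalRing γ.Pre)
  norm_mul_le := γ.mul_le

noncomputable instance : NormedSpace ℂ γ.Pre where
  __ := (inferInstance : Module ℂ γ.Pre)
  norm_smul_le c x := (map_smul_eq_mul γ.toSeminorm c (show E from x)).le

theorem isometry_star : Isometry (star : γ.Pre → γ.Pre) := by
  refine Isometry.of_dist_eq fun x y => ?_
  rw [dist_eq_norm, dist_eq_norm, ← (star_sub x y)]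
  exact γ.star_eq _

/-- The Hausdorff completion of `E` for the C⋆-seminorm `γ`. -/
abbrev Completion : Type _ := UniformSpace.Completion γ.Pre

/-- The canonical map from `E` to its completion. -/
noncomputable def of (x : E) : γ.Completion := ((show γ.Pre from x : γ.Pre) : UniformSpace.Completion γ.Pre)

theorem of_add (x y : E) : γ.of (x + y) = γ.of x + γ.of y :=
  UniformSpace.Completion.coe_add (α := γ.Pre) x y

theorem of_zero : γ.of 0 = 0 := UniformSpace.Completion.coe_zero (α := γ.Pre)

theorem of_smul (c : ℂ) (x : E) : γ.of (c • x) = c • γ.of x :=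
  UniformSpace.Completion.coe_smul (X := γ.Pre) c x

theorem norm_of (x : E) : ‖γ.of x‖ = γ.toSeminorm x :=
  UniformSpace.Completion.norm_coe (E := γ.Pre) x

theorem denseRange_of : DenseRange γ.of :=
  UniformSpace.Completion.denseRange_coe (α := γ.Pre)

/-- The product of the completion: the continuous extension of the product of `E`. -/
noncomputable instance : Mul γ.Completion :=
  ⟨Function.curry <|
    ((UniformSpace.Completion.isDenseInducing_coe (α := γ.Pre)).prodMap
      (UniformSpace.Completion.isDenseInducing_coe (α := γ.Pre))).extend
      (fun p : γ.Pre × γ.Pre => γ.of (p.1 * p.2))⟩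

/-- The involution of the completion: the continuous extension of the involution of `E`. -/
noncomputable instance : Star γ.Completion :=
  ⟨UniformSpace.Completion.map (star : γ.Pre → γ.Pre)⟩

theorem of_mul (x y : E) : γ.of (x * y) = γ.of x * γ.of y :=
  (((UniformSpace.Completion.isDenseInducing_coe (α := γ.Pre)).prodMap
      (UniformSpace.Completion.isDenseInducing_coe (α := γ.Pre))).extend_eq
      (f := fun p : γ.Pre × γ.Pre => γ.of (p.1 * p.2))
      ((UniformSpace.Completion.continuous_coe γ.Pre).comp continuous_mul)
      ((show γ.Pre from x), (show γ.Pre from y))).symm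

theorem of_star (x : E) : γ.of (star x) = star (γ.of x) :=
  (UniformSpace.Completion.map_coe γ.isometry_star.uniformContinuous (show γ.Pre from x)).symm

instance : ContinuousMul γ.Completion where
  continuous_mul := by
    let m : γ.Pre →+ γ.Pre →+ UniformSpace.Completion γ.Pre :=
      (AddMonoidHom.mul : γ.Pre →+ γ.Pre →+ γ.Pre).compr₂ UniformSpace.Completion.toCompl
    have : Continuous fun p : γ.Pre × γ.Pre => m p.1 p.2 :=
      (UniformSpace.Completion.continuous_coe γ.Pre).comp continuous_mul
    have di : IsDenseInducing (UniformSpace.Completion.toCompl :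
      γ.Pre → UniformSpace.Completion γ.Pre) := UniformSpace.Completion.isDenseInducing_coe
    exact (di.extend_Z_bilin di this :)

instance : ContinuousStar γ.Completion where
  continuous_star := UniformSpace.Completion.continuous_map

variable {γ} in
@[elab_as_elim]
theorem induction_on {p : γ.Completion → Prop} (a : γ.Completion)
    (hp : IsClosed {a | p a}) (h : ∀ x : E, p (γ.of x)) : p a :=
  UniformSpace.Completion.induction_on (α := γ.Pre) a hp h

variable {γ} in
theorem induction_on₂ {p : γ.Completion → γ.Completion → Prop} (a b : γ.Completion)
    (hp : IsClosed {z : γ.Completion × γ.Completion | p z.1 z.2})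
    (h : ∀ x y : E, p (γ.of x) (γ.of y)) : p a b :=
  UniformSpace.Completion.induction_on₂ (α := γ.Pre) (β := γ.Pre) a b hp h

variable {γ} in
theorem induction_on₃ {p : γ.Completion → γ.Completion → γ.Completion → Prop}
    (a b c : γ.Completion)
    (hp : IsClosed {z : γ.Completion × γ.Completion × γ.Completion | p z.1 z.2.1 z.2.2})
    (h : ∀ x y z : E, p (γ.of x) (γ.of y) (γ.of z)) : p a b c :=
  UniformSpace.Completion.induction_on₃ (α := γ.Pre) (β := γ.Pre) (γ := γ.Pre) a b c hp h

noncomputable instance : NonUnitalRing γ.Completion where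
  __ := (inferInstance : AddCommGroup γ.Completion)
  __ := (inferInstance : Mul γ.Completion)
  zero_mul a := by
    refine induction_on a (isClosed_eq (by fun_prop) continuous_const) fun x => ?_
    rw [← γ.of_zero, ← γ.of_mul, zero_mul]
  mul_zero a := by
    refine induction_on a (isClosed_eq (by fun_prop) continuous_const) fun x => ?_
    rw [← γ.of_zero, ← γ.of_mul, mul_zero]
  mul_assoc a b c := by
    induction a, b, c using induction_on₃ with
    | hp => exact isClosed_eq (by fun_prop) (by fun_prop)
    | h x y z =>
      simp only [← γ.of_mul, mul_assoc]
  left_distrib a b c := by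
    induction a, b, c using induction_on₃ with
    | hp => exact isClosed_eq (by fun_prop) (by fun_prop)
    | h x y z =>
      simp only [← γ.of_mul, ← γ.of_add, mul_add]
  right_distrib a b c := by
    induction a, b, c using induction_on₃ with
    | hp => exact isClosed_eq (by fun_prop) (by fun_prop)
    | h x y z =>
      simp only [← γ.of_mul, ← γ.of_add, add_mul]

noncomputable instance : NonUnitalNormedRing γ.Completion where
  __ := (inferInstance : NormedAddCommGroup γ.Completion)
  __ := (inferInstance : NonUnitalRing γ.Completion)
  norm_mul_le a b := by
    induction a, b using induction_on₂ with
    | hp => exact isClosed_le (by fun_prop) (by fun_prop)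
    | h x y =>
      rw [← γ.of_mul, γ.norm_of, γ.norm_of, γ.norm_of]
      exact γ.mul_le x y

noncomputable instance : StarRing γ.Completion where
  star_involutive a := by
    induction a using induction_on with
    | hp => exact isClosed_eq (by fun_prop) (by fun_prop)
    | h x =>
      rw [← γ.of_star, ← γ.of_star, star_star]
  star_mul a b := by
    induction a, b using induction_on₂ with
    | hp => exact isClosed_eq (by fun_prop) (by fun_prop)
    | h x y =>
      simp only [← γ.of_mul, ← γ.of_star, star_mul]
  star_add a b := by
    induction a, b using induction_on₂ with
    | hp => exact isClosed_eq (by fun_prop) (by fun_prop)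
    | h x y =>
      simp only [← γ.of_add, ← γ.of_star, star_add]

end Basic

section CStar

variable {E : Type*} [NonUnitalRing E] [StarRing E] [Module ℂ E] [IsScalarTower ℂ E E]
  [SMulCommClass ℂ E E] [StarModule ℂ E] (γ : CStarSeminorm E)

instance : CStarRing γ.Completion where
  norm_mul_self_le a := by
    induction a using induction_on with
    | hp => exact isClosed_le (by fun_prop) (by fun_prop)
    | h x => rw [← γ.of_star, ← γ.of_mul, γ.norm_of, γ.norm_of, γ.star_mul_self]

instance : IsScalarTower ℂ γ.Completion γ.Completion where
  smul_assoc c a b := by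
    change (c • a) * b = c • (a * b)
    induction a, b using induction_on₂ with
    | hp =>
      exact isClosed_eq ((continuous_fst.const_smul c).mul continuous_snd)
        ((continuous_fst.mul continuous_snd).const_smul c)
    | h x y => simp only [← γ.of_smul, ← γ.of_mul, smul_mul_assoc]

instance : SMulCommClass ℂ γ.Completion γ.Completion where
  smul_comm c a b := by
    change c • (a * b) = a * (c • b)
    induction a, b using induction_on₂ with
    | hp =>
      exact isClosed_eq ((continuous_fst.mul continuous_snd).const_smul c)
        (continuous_fst.mul (continuous_snd.const_smul c))
    | h x y => simp only [← γ.of_smul, ← γ.of_mul, mul_smul_comm]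

instance : StarModule ℂ γ.Completion where
  star_smul c a := by
    induction a using induction_on with
    | hp =>
      have h1 : Continuous fun a : γ.Completion => star (c • a) :=
        (continuous_id.const_smul c).star
      have h2 : Continuous fun a : γ.Completion => star c • star a :=
        continuous_star.const_smul (star c)
      exact isClosed_eq h1 h2
    | h x => simp only [← γ.of_smul, ← γ.of_star, star_smul]

/-- The completion of a ⋆-algebra for a C⋆-seminorm is a C⋆-algebra. -/
noncomputable instance : NonUnitalCStarAlgebra γ.Completion where

/-- The canonical map from `E` to its completion, as a ⋆-homomorphism. -/
noncomputable def ofHom : E →⋆ₙₐ[ℂ] γ.Completion where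
  toFun := γ.of
  map_smul' c x := γ.of_smul c x
  map_zero' := γ.of_zero
  map_add' := γ.of_add
  map_mul' := γ.of_mul
  map_star' := γ.of_star

end CStar

/-- The pull-back of a C⋆-seminorm along a ⋆-homomorphism. -/
noncomputable def comap {E F : Type*} [NonUnitalRing E] [StarRing E] [Module ℂ E] [NonUnitalRing F]
    [StarRing F] [Module ℂ F] (γ : CStarSeminorm F) (φ : E →⋆ₙₐ[ℂ] F) : CStarSeminorm E where
  toFun x := γ.toSeminorm (φ x)
  map_zero' := by simp
  add_le' x y := by simpa using map_add_le_add γ.toSeminorm (φ x) (φ y)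
  neg' x := by
    rw [← map_neg_eq_map γ.toSeminorm (φ x)]
    congr 1
    exact map_neg φ x
  smul' c x := by rw [map_smul, map_smul_eq_mul]
  mul_le' x y := by simpa using γ.mul_le (φ x) (φ y)
  star_mul_self' x := by simpa [map_star] using γ.star_mul_self (φ x)

/-- A C⋆-seminorm on a C⋆-algebra is dominated by the norm. -/
theorem le_norm {A : Type*} [NonUnitalCStarAlgebra A] (γ : CStarSeminorm A) (a : A) :
    γ.toSeminorm a ≤ ‖a‖ := by
  rw [← γ.norm_of]
  exact NonUnitalStarAlgHom.norm_apply_le γ.ofHom a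

end CStarSeminorm

/-- The complex ⋆-algebras for which the supremum of all C⋆-seminorms is finite. -/
class HasCStarEnvelope (E : Type*) [NonUnitalRing E] [StarRing E] [Module ℂ E] : Prop where
  bddAbove : ∀ x : E, BddAbove (Set.range fun γ : CStarSeminorm E => γ.toSeminorm x)

section Envelope

variable (E : Type*) [NonUnitalRing E] [StarRing E] [Module ℂ E] 

instance : Nonempty (CStarSeminorm E) :=
  ⟨{ (0 : Seminorm ℂ E) with
      mul_le' := fun x y => by
        change (0 : ℝ) ≤ 0 * 0
        simp
      star_mul_self' := fun x => by
        change (0 : ℝ) = 0 * 0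
        simp }⟩

/-- The largest C⋆-seminorm: the pointwise supremum of all C⋆-seminorms. -/
noncomputable def universalCStarSeminorm [HasCStarEnvelope E] : CStarSeminorm E where
  toFun x := ⨆ γ : CStarSeminorm E, γ.toSeminorm x
  map_zero' := by simp
  add_le' x y := ciSup_le fun γ => (map_add_le_add γ.toSeminorm x y).trans
    (add_le_add (le_ciSup (HasCStarEnvelope.bddAbove x) γ)
      (le_ciSup (HasCStarEnvelope.bddAbove y) γ))
  neg' x := by simp
  smul' c x := by
    simp only [map_smul_eq_mul]
    exact (Real.mul_iSup_of_nonneg (norm_nonneg c) _).symm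
  mul_le' x y := ciSup_le fun γ => (γ.mul_le x y).trans
    (mul_le_mul (le_ciSup (HasCStarEnvelope.bddAbove x) γ)
      (le_ciSup (HasCStarEnvelope.bddAbove y) γ) (apply_nonneg _ _)
      ((apply_nonneg γ.toSeminorm x).trans (le_ciSup (HasCStarEnvelope.bddAbove x) γ)))
  star_mul_self' x := by
    simp only [CStarSeminorm.star_mul_self]
    have h0 : 0 ≤ ⨆ γ : CStarSeminorm E, γ.toSeminorm x :=
      Real.iSup_nonneg fun γ => apply_nonneg _ _
    have hb : BddAbove (Set.range fun γ : CStarSeminorm E =>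
        γ.toSeminorm x * γ.toSeminorm x) := by
      simpa only [CStarSeminorm.star_mul_self] using
        HasCStarEnvelope.bddAbove (star x * x)
    apply le_antisymm
    · exact ciSup_le fun γ => mul_self_le_mul_self (apply_nonneg _ _)
        (le_ciSup (HasCStarEnvelope.bddAbove x) γ)
    · rw [← sq, ← Real.le_sqrt h0 (Real.iSup_nonneg fun γ => mul_self_nonneg _)]
      refine ciSup_le fun γ => Real.le_sqrt_of_sq_le ?_
      rw [sq]
      exact le_ciSup hb γ

/-- The enveloping C⋆-algebra of a ⋆-algebra: its Hausdorff completion for the largest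
C⋆-seminorm. -/
abbrev CStarEnvelope [HasCStarEnvelope E] : Type _ := (universalCStarSeminorm E).Completion

end Envelope

/-- The algebraic crossed product `A[G]` of an action `α` of a discrete group `G` on `A`: the
finitely supported functions `G → A`, where `Finsupp.single s a` stands for `a u_s`. -/
def AlgCrossedProduct {A G : Type*} [NonUnitalCStarAlgebra A] [Group G]
    (_α : G →* (A ≃⋆ₐ[ℂ] A)) : Type _ := G →₀ A

namespace AlgCrossedProduct

open Finsupp

variable {A G : Type*} [NonUnitalCStarAlgebra A] [Group G] (α : G →* (A ≃⋆ₐ[ℂ] A))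

noncomputable instance : AddCommGroup (AlgCrossedProduct α) := inferInstanceAs (AddCommGroup (G →₀ A))
noncomputable instance : Module ℂ (AlgCrossedProduct α) := inferInstanceAs (Module ℂ (G →₀ A))

/-- The element `a u_s` of the algebraic crossed product. -/
noncomputable def single (s : G) : A →+ AlgCrossedProduct α := Finsupp.singleAddHom s

theorem smul_single (c : ℂ) (s : G) (a : A) : c • single α s a = single α s (c • a) :=
  Finsupp.smul_single c s a

variable {α} in
@[elab_as_elim]
theorem induction_linear {p : AlgCrossedProduct α → Prop} (f : AlgCrossedProduct α) (h0 : p 0)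
    (hadd : ∀ f g, p f → p g → p (f + g)) (hs : ∀ s a, p (single α s a)) : p f :=
  Finsupp.induction_linear f h0 hadd hs

/-- The product as a biadditive map, determined by `(a u_s) (b u_t) = a α_s(b) u_{st}`. -/
noncomputable def mulHom :
    AlgCrossedProduct α →+ AlgCrossedProduct α →+ AlgCrossedProduct α :=
  Finsupp.liftAddHom fun s => AddMonoidHom.flip <| Finsupp.liftAddHom fun t =>
    { toFun := fun b => (single α (s * t)).comp (AddMonoidHom.mulRight (α s b))
      map_zero' := by ext; simp
      map_add' := fun b c => by ext; simp [mul_add] }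

/-- The involution as an additive map, determined by `(a u_s)⋆ = α_{s⁻¹}(a⋆) u_{s⁻¹}`. -/
noncomputable def starHom : AlgCrossedProduct α →+ AlgCrossedProduct α :=
  Finsupp.liftAddHom fun s =>
    { toFun := fun a => single α s⁻¹ (α s⁻¹ (star a))
      map_zero' := by simp
      map_add' := fun a b => by simp }

noncomputable instance : Mul (AlgCrossedProduct α) := ⟨fun f g => mulHom α f g⟩

noncomputable instance : Star (AlgCrossedProduct α) := ⟨fun f => starHom α f⟩

theorem single_mul_single (s t : G) (a b : A) :
    single α s a * single α t b = single α (s * t) (a * α s b) := by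
  refine (DFunLike.congr_fun
    (Finsupp.liftAddHom_apply_single (N := AlgCrossedProduct α →+ AlgCrossedProduct α) _ s a)
    (Finsupp.single t b)).trans ?_
  exact DFunLike.congr_fun (Finsupp.liftAddHom_apply_single (N := A →+ AlgCrossedProduct α) _ t b) a

theorem star_single (s : G) (a : A) :
    star (single α s a) = single α s⁻¹ (α s⁻¹ (star a)) :=
  Finsupp.liftAddHom_apply_single _ s a

noncomputable instance : NonUnitalNonAssocRing (AlgCrossedProduct α) where
  zero_mul f := by change mulHom α 0 f = 0; simp
  mul_zero f := map_zero (mulHom α f)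
  left_distrib f g h := map_add (mulHom α f) g h
  right_distrib f g h := by change mulHom α (f + g) h = mulHom α f h + mulHom α g h; simp

noncomputable instance : NonUnitalRing (AlgCrossedProduct α) where
  mul_assoc f g h := by
    induction f using induction_linear with
    | h0 => simp
    | hadd f f' hf hf' => simp only [add_mul, hf, hf']
    | hs s a =>
      induction g using induction_linear with
      | h0 => simp
      | hadd g g' hg hg' => simp only [add_mul, mul_add, hg, hg']
      | hs t b =>
        induction h using induction_linear with
        | h0 => simp
        | hadd h h' hh hh' => simp only [mul_add, hh, hh']
        | hs u c => simp [single_mul_single, mul_assoc]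

noncomputable instance : StarRing (AlgCrossedProduct α) where
  star_add f g := map_add (starHom α) f g
  star_involutive f := by
    have hadd : ∀ x y : AlgCrossedProduct α, star (x + y) = star x + star y :=
      map_add (starHom α)
    induction f using induction_linear with
    | h0 => change starHom α (starHom α 0) = 0; simp
    | hadd f g hf hg => rw [hadd, hadd, hf, hg]
    | hs s a => simp [star_single, ← StarAlgEquiv.mul_apply, ← map_star]
  star_mul f g := by
    have hadd : ∀ x y : AlgCrossedProduct α, star (x + y) = star x + star y :=
      map_add (starHom α)
    have h0 : star (0 : AlgCrossedProduct α) = 0 := map_zero (starHom α)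
    induction f using induction_linear with
    | h0 => simp [h0]
    | hadd f f' hf hf' => simp only [add_mul, mul_add, hadd, hf, hf']
    | hs s a =>
      induction g using induction_linear with
      | h0 => simp [h0]
      | hadd g g' hg hg' => simp only [add_mul, mul_add, hadd, hg, hg']
      | hs t b =>
        simp only [star_single, single_mul_single, star_mul, map_mul, mul_inv_rev,
          ← map_star, ← StarAlgEquiv.mul_apply]
        simp

instance : IsScalarTower ℂ (AlgCrossedProduct α) (AlgCrossedProduct α) where
  smul_assoc c f g := by
    change (c • f) * g = c • (f * g)
    induction f using induction_linear with
    | h0 => simp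
    | hadd f f' hf hf' => simp only [add_mul, smul_add, hf, hf']
    | hs s a =>
      induction g using induction_linear with
      | h0 => simp
      | hadd g g' hg hg' => simp only [mul_add, smul_add, hg, hg']
      | hs t b => simp [smul_single, single_mul_single, smul_mul_assoc]

instance : SMulCommClass ℂ (AlgCrossedProduct α) (AlgCrossedProduct α) where
  smul_comm c f g := by
    change c • (f * g) = f * (c • g)
    induction f using induction_linear with
    | h0 => simp
    | hadd f f' hf hf' => simp only [add_mul, smul_add, hf, hf']
    | hs s a =>
      induction g using induction_linear with
      | h0 => simp
      | hadd g g' hg hg' => simp only [mul_add, smul_add, hg, hg']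
      | hs t b => simp [smul_single, single_mul_single, mul_smul_comm]

instance : StarModule ℂ (AlgCrossedProduct α) where
  star_smul c f := by
    induction f using induction_linear with
    | h0 => simp
    | hadd f g hf hg => simp only [smul_add, star_add, hf, hg]
    | hs s a => simp [smul_single, star_single]

/-- The inclusion of `A` in the algebraic crossed product. -/
noncomputable def inclHom : A →⋆ₙₐ[ℂ] AlgCrossedProduct α where
  toFun := single α 1
  map_smul' c a := (smul_single α c 1 a).symm
  map_zero' := map_zero _
  map_add' := map_add _
  map_mul' a b := by simp [single_mul_single]
  map_star' a := by simp [star_single]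

instance : HasCStarEnvelope (AlgCrossedProduct α) where
  bddAbove f := by
    induction f using induction_linear with
    | h0 => exact ⟨0, by rintro _ ⟨γ, rfl⟩; simp⟩
    | hadd f g hf hg =>
      obtain ⟨B, hB⟩ := hf
      obtain ⟨C, hC⟩ := hg
      refine ⟨B + C, ?_⟩
      rintro _ ⟨γ, rfl⟩
      exact (map_add_le_add γ.toSeminorm f g).trans (add_le_add (hB ⟨γ, rfl⟩) (hC ⟨γ, rfl⟩))
    | hs s a =>
      refine ⟨‖a‖, ?_⟩
      rintro _ ⟨γ, rfl⟩
      have h1 := (γ.comap (inclHom α)).le_norm (a * star a)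
      have h2 : single α 1 (a * star a) = star (star (single α s a)) * star (single α s a) := by
        simp [star_single, single_mul_single, ← StarAlgEquiv.mul_apply, ← map_star]
      change γ.toSeminorm (single α 1 (a * star a)) ≤ _ at h1
      rw [h2, γ.star_mul_self, γ.star_eq, CStarRing.norm_self_mul_star] at h1
      exact abs_le_of_sq_le_sq' (by simpa only [sq] using h1) (norm_nonneg _) |>.2

end AlgCrossedProduct

/-- The full crossed product of a C⋆-algebra by an action of a discrete group: the enveloping
C⋆-algebra of the algebraic crossed product `A[G]`. Every C⋆-seminorm on `A[G]` comes from a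
representation of `A[G]`, that is, from a covariant representation of `(A, G, α)`. -/
abbrev CrossedProduct {A G : Type*} [NonUnitalCStarAlgebra A] [Group G]
    (α : G →* (A ≃⋆ₐ[ℂ] A)) : Type _ := CStarEnvelope (AlgCrossedProduct α)

/-- The ⋆-algebra `M_∞(A) = ⋃ M_n(A)` of matrices over `A`, indexed by `ℕ × ℕ`, that have only
finitely many nonzero entries. -/
def FinMatrix (A : Type*) [NonUnitalCStarAlgebra A] : Type _ := ℕ × ℕ →₀ A

namespace FinMatrix

variable (A : Type*) [NonUnitalCStarAlgebra A]

noncomputable instance : AddCommGroup (FinMatrix A) := inferInstanceAs (AddCommGroup (ℕ × ℕ →₀ A))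
noncomputable instance : Module ℂ (FinMatrix A) := inferInstanceAs (Module ℂ (ℕ × ℕ →₀ A))

variable {A}

/-- The matrix with entry `a` at `(i, j)` and zeros elsewhere. -/
noncomputable def single (i j : ℕ) : A →+ FinMatrix A := Finsupp.singleAddHom (i, j)

theorem smul_single (c : ℂ) (i j : ℕ) (a : A) : c • single i j a = single i j (c • a) :=
  Finsupp.smul_single c (i, j) a

@[elab_as_elim]
theorem induction_linear {p : FinMatrix A → Prop} (f : FinMatrix A) (h0 : p 0)
    (hadd : ∀ f g, p f → p g → p (f + g)) (hs : ∀ i j a, p (single i j a)) : p f :=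
  Finsupp.induction_linear f h0 hadd fun s a => hs s.1 s.2 a

variable (A) in
/-- The matrix product as a biadditive map. -/
noncomputable def mulHom : FinMatrix A →+ FinMatrix A →+ FinMatrix A :=
  Finsupp.liftAddHom fun s => AddMonoidHom.flip <| Finsupp.liftAddHom fun t =>
    { toFun := fun b =>
        if s.2 = t.1 then (single s.1 t.2).comp (AddMonoidHom.mulRight b) else 0
      map_zero' := by split_ifs <;> ext <;> simp
      map_add' := fun b c => by split_ifs <;> ext <;> simp [mul_add] }

variable (A) in
/-- The conjugate transpose as an additive map. -/
noncomputable def starHom : FinMatrix A →+ FinMatrix A :=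
  Finsupp.liftAddHom fun s =>
    { toFun := fun a => single s.2 s.1 (star a)
      map_zero' := by simp
      map_add' := fun a b => by simp }

noncomputable instance : Mul (FinMatrix A) := ⟨fun f g => mulHom A f g⟩

noncomputable instance : Star (FinMatrix A) := ⟨fun f => starHom A f⟩

theorem single_mul_single (i j k l : ℕ) (a b : A) :
    single i j a * single k l b = if j = k then single i l (a * b) else 0 := by
  refine (DFunLike.congr_fun
    (Finsupp.liftAddHom_apply_single (N := FinMatrix A →+ FinMatrix A) _ (i, j) a)
    (Finsupp.single (k, l) b)).trans ?_
  refine (DFunLike.congr_fun (Finsupp.liftAddHom_apply_single (N := A →+ FinMatrix A) _ (k, l) b) a).trans ?_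
  change (if j = k then (single i l).comp (AddMonoidHom.mulRight b) else 0) a = _
  split_ifs <;> simp

theorem star_single (i j : ℕ) (a : A) : star (single i j a) = single j i (star a) :=
  Finsupp.liftAddHom_apply_single _ (i, j) a

noncomputable instance : NonUnitalNonAssocRing (FinMatrix A) where
  zero_mul f := by change mulHom A 0 f = 0; simp
  mul_zero f := map_zero (mulHom A f)
  left_distrib f g h := map_add (mulHom A f) g h
  right_distrib f g h := by change mulHom A (f + g) h = mulHom A f h + mulHom A g h; simp

noncomputable instance : NonUnitalRing (FinMatrix A) where
  mul_assoc f g h := by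
    induction f using induction_linear with
    | h0 => simp
    | hadd f f' hf hf' => simp only [add_mul, hf, hf']
    | hs i j a =>
      induction g using induction_linear with
      | h0 => simp
      | hadd g g' hg hg' => simp only [add_mul, mul_add, hg, hg']
      | hs k l b =>
        induction h using induction_linear with
        | h0 => simp
        | hadd h h' hh hh' => simp only [mul_add, hh, hh']
        | hs m n c =>
          simp only [single_mul_single]
          split_ifs <;> simp [single_mul_single, mul_assoc, *]

noncomputable instance : StarRing (FinMatrix A) where
  star_add f g := map_add (starHom A) f g
  star_involutive f := by
    have hadd : ∀ x y : FinMatrix A, star (x + y) = star x + star y := map_add (starHom A)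
    induction f using induction_linear with
    | h0 => change starHom A (starHom A 0) = 0; simp
    | hadd f g hf hg => rw [hadd, hadd, hf, hg]
    | hs i j a => simp [star_single]
  star_mul f g := by
    have hadd : ∀ x y : FinMatrix A, star (x + y) = star x + star y := map_add (starHom A)
    have h0 : star (0 : FinMatrix A) = 0 := map_zero (starHom A)
    induction f using induction_linear with
    | h0 => simp [h0]
    | hadd f f' hf hf' => simp only [add_mul, mul_add, hadd, hf, hf']
    | hs i j a =>
      induction g using induction_linear with
      | h0 => simp [h0]
      | hadd g g' hg hg' => simp only [add_mul, mul_add, hadd, hg, hg']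
      | hs k l b =>
        simp only [star_single, single_mul_single]
        by_cases h : j = k
        · simp [h, star_single]
        · simp [h, Ne.symm h, h0]

instance : IsScalarTower ℂ (FinMatrix A) (FinMatrix A) where
  smul_assoc c f g := by
    change (c • f) * g = c • (f * g)
    induction f using induction_linear with
    | h0 => simp
    | hadd f f' hf hf' => simp only [add_mul, smul_add, hf, hf']
    | hs i j a =>
      induction g using induction_linear with
      | h0 => simp
      | hadd g g' hg hg' => simp only [mul_add, smul_add, hg, hg']
      | hs k l b =>
        rw [smul_single, single_mul_single, single_mul_single]
        split_ifs <;> simp [smul_single, smul_mul_assoc]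

instance : SMulCommClass ℂ (FinMatrix A) (FinMatrix A) where
  smul_comm c f g := by
    change c • (f * g) = f * (c • g)
    induction f using induction_linear with
    | h0 => simp
    | hadd f f' hf hf' => simp only [add_mul, smul_add, hf, hf']
    | hs i j a =>
      induction g using induction_linear with
      | h0 => simp
      | hadd g g' hg hg' => simp only [mul_add, smul_add, hg, hg']
      | hs k l b =>
        rw [smul_single, single_mul_single, single_mul_single]
        split_ifs <;> simp [smul_single, mul_smul_comm]

instance : StarModule ℂ (FinMatrix A) where
  star_smul c f := by
    induction f using induction_linear with
    | h0 => simp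
    | hadd f g hf hg => simp only [smul_add, star_add, hf, hg]
    | hs i j a => simp [smul_single, star_single]

/-- The inclusion of `A` in `M_∞(A)` as the `i`-th diagonal entry. -/
noncomputable def diagHom (i : ℕ) : A →⋆ₙₐ[ℂ] FinMatrix A where
  toFun := single i i
  map_smul' c a := (smul_single c i i a).symm
  map_zero' := map_zero _
  map_add' := map_add _
  map_mul' a b := by simp [single_mul_single]
  map_star' a := by simp [star_single]

instance : HasCStarEnvelope (FinMatrix A) where
  bddAbove f := by
    induction f using induction_linear with
    | h0 => exact ⟨0, by rintro _ ⟨γ, rfl⟩; simp⟩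
    | hadd f g hf hg =>
      obtain ⟨B, hB⟩ := hf
      obtain ⟨C, hC⟩ := hg
      refine ⟨B + C, ?_⟩
      rintro _ ⟨γ, rfl⟩
      exact (map_add_le_add γ.toSeminorm f g).trans (add_le_add (hB ⟨γ, rfl⟩) (hC ⟨γ, rfl⟩))
    | hs i j a =>
      refine ⟨‖a‖, ?_⟩
      rintro _ ⟨γ, rfl⟩
      have h1 := (γ.comap (diagHom j)).le_norm (star a * a)
      have h2 : single j j (star a * a) = star (single i j a) * single i j a := by
        simp [star_single, single_mul_single]
      change γ.toSeminorm (single j j (star a * a)) ≤ _ at h1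
      rw [h2, γ.star_mul_self, CStarRing.norm_star_mul_self] at h1
      exact abs_le_of_sq_le_sq' (by simpa only [sq] using h1) (norm_nonneg _) |>.2

end FinMatrix

/-- The stabilisation `A ⊗ 𝒦` of a C⋆-algebra, `𝒦` being the compact operators on `ℓ²(ℕ)`: the
completion of `M_∞(A)` for its (unique) C⋆-norm that restricts to a C⋆-norm on each `M_n(A)`. -/
abbrev Stabilization (A : Type*) [NonUnitalCStarAlgebra A] : Type _ :=
  CStarEnvelope (FinMatrix A)

section Finiteness

/-- A projection is infinite if it is Murray--von Neumann equivalent to a proper subprojection of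
itself. -/
def IsInfiniteProjection {B : Type*} [Mul B] [Star B] (p : B) : Prop :=
  IsStarProjection p ∧
    ∃ q : B, IsStarProjection q ∧ p * q = q ∧ q ≠ p ∧ ∃ v : B, star v * v = p ∧ v * star v = q

/-- `B` has an approximate unit consisting of projections. -/
def HasProjectionApproxUnit (B : Type*) [NonUnitalCStarAlgebra B] : Prop :=
  ∃ l : Filter B, l.IsApproximateUnit ∧ ∀ᶠ p in l, IsStarProjection p

/-- All projections of `B` are finite. -/
def AllProjectionsFinite (B : Type*) [NonUnitalCStarAlgebra B] : Prop :=
  ∀ p : B, IsStarProjection p → ¬ IsInfiniteProjection p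

/-- `B` is finite: it has an approximate unit of projections, and all projections of `B` are
finite. -/
def IsFiniteCStar (B : Type*) [NonUnitalCStarAlgebra B] : Prop :=
  HasProjectionApproxUnit B ∧ AllProjectionsFinite B

/-- `B` is stably finite: its stabilisation `B ⊗ 𝒦` is finite. -/
def IsStablyFiniteCStar (B : Type*) [NonUnitalCStarAlgebra B] : Prop :=
  IsFiniteCStar (Stabilization B)

/-- A C⋆-algebra is AF if it is the closure of the union of an upward directed family of
finite-dimensional C⋆-subalgebras (for a separable algebra: of an increasing sequence). -/
def IsAF (D : Type*) [NonUnitalCStarAlgebra D] : Prop :=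
  ∃ F : Set (NonUnitalStarSubalgebra ℂ D), F.Nonempty ∧ DirectedOn (· ≤ ·) F ∧
    (∀ S ∈ F, FiniteDimensional ℂ S) ∧ Dense (⋃ S ∈ F, (S : Set D))

/-- `B` is AF-embeddable: there is an injective ⋆-homomorphism from `B` into an AF algebra. -/
def IsAFEmbeddable.{u} (B : Type u) [NonUnitalCStarAlgebra B] : Prop :=
  ∃ (D : Type u) (_ : NonUnitalCStarAlgebra D), IsAF D ∧
    ∃ φ : B →⋆ₙₐ[ℂ] D, Function.Injective φ

/-- A set `Ω` of operators on a Hilbert space is quasidiagonal if for every finite `ω ⊆ Ω`, every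
finite set `χ` of vectors and every `ε > 0` there is a finite-rank projection `P` with
`‖T P - P T‖ < ε` for all `T ∈ ω` and `‖P x - x‖ < ε` for all `x ∈ χ`. -/
def IsQuasidiagonalSet {H : Type*} [NormedAddCommGroup H] [InnerProductSpace ℂ H]
    [CompleteSpace H] (Ω : Set (H →L[ℂ] H)) : Prop :=
  ∀ ω : Finset (H →L[ℂ] H), (ω : Set (H →L[ℂ] H)) ⊆ Ω → ∀ χ : Finset H, ∀ ε : ℝ, 0 < ε →
    ∃ P : H →L[ℂ] H, IsStarProjection P ∧
      FiniteDimensional ℂ (LinearMap.range (P : H →ₗ[ℂ] H)) ∧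
      (∀ T ∈ ω, ‖T * P - P * T‖ < ε) ∧ ∀ x ∈ χ, ‖P x - x‖ < ε

/-- A C⋆-algebra is quasidiagonal if it has a faithful representation on a Hilbert space whose
range is a quasidiagonal set of operators. -/
def IsQuasidiagonal.{u} (B : Type u) [NonUnitalCStarAlgebra B] : Prop :=
  ∃ (H : Type u) (_ : NormedAddCommGroup H) (_ : InnerProductSpace ℂ H) (_ : CompleteSpace H)
    (π : B →⋆ₙₐ[ℂ] (H →L[ℂ] H)), Function.Injective π ∧ IsQuasidiagonalSet (Set.range π)

end Finiteness

section KTheory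

open Matrix

/-- Murray--von Neumann equivalence of square matrices, possibly of different sizes. -/
def MvNEquiv {R ι κ : Type*} [NonUnitalRing R] [StarRing R] [Fintype ι] [Fintype κ]
    (p : Matrix ι ι R) (q : Matrix κ κ R) : Prop :=
  ∃ v : Matrix κ ι R, vᴴ * v = p ∧ v * vᴴ = q

/-- A projection in some matrix algebra `M_n(R)`. -/
structure MatrixProjection (R : Type*) [NonUnitalRing R] [StarRing R] where
  size : ℕ
  val : Matrix (Fin size) (Fin size) R
  isStarProjection : IsStarProjection val

namespace MvNEquiv

variable {R ι κ μ ν : Type*} [NonUnitalRing R] [StarRing R] [Fintype ι] [Fintype κ] [Fintype μ]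
  [Fintype ν]

theorem refl {p : Matrix ι ι R} (hp : IsStarProjection p) : MvNEquiv p p := by
  have h1 : pᴴ = p := hp.isSelfAdjoint
  have h2 : p * p = p := hp.isIdempotentElem
  exact ⟨p, by rw [h1, h2], by rw [h1, h2]⟩

theorem symm {p : Matrix ι ι R} {q : Matrix κ κ R} (h : MvNEquiv p q) : MvNEquiv q p := by
  obtain ⟨v, hv, hv'⟩ := h
  exact ⟨vᴴ, by rwa [conjTranspose_conjTranspose], by rwa [conjTranspose_conjTranspose]⟩

theorem trans {p : Matrix ι ι R} {q : Matrix κ κ R} {r : Matrix μ μ R}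
    (hp : IsStarProjection p) (hr : IsStarProjection r)
    (h : MvNEquiv p q) (h' : MvNEquiv q r) : MvNEquiv p r := by
  obtain ⟨v, hv, hv'⟩ := h
  obtain ⟨w, hw, hw'⟩ := h'
  refine ⟨w * v, ?_, ?_⟩
  · rw [conjTranspose_mul, Matrix.mul_assoc, ← Matrix.mul_assoc wᴴ, hw, ← hv',
      Matrix.mul_assoc v, hv, ← Matrix.mul_assoc, hv]
    exact hp.isIdempotentElem
  · rw [conjTranspose_mul, Matrix.mul_assoc, ← Matrix.mul_assoc v, hv', ← hw,
      Matrix.mul_assoc wᴴ, hw', ← Matrix.mul_assoc, hw']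
    exact hr.isIdempotentElem

theorem fromBlocks {p : Matrix ι ι R} {q : Matrix κ κ R} {p' : Matrix μ μ R} {q' : Matrix ν ν R}
    (h : MvNEquiv p q) (h' : MvNEquiv p' q') :
    MvNEquiv (Matrix.fromBlocks p 0 0 p') (Matrix.fromBlocks q 0 0 q') := by
  obtain ⟨v, hv, hv'⟩ := h
  obtain ⟨w, hw, hw'⟩ := h'
  exact ⟨Matrix.fromBlocks v 0 0 w,
    by simp [fromBlocks_conjTranspose, fromBlocks_multiply, hv, hw],
    by simp [fromBlocks_conjTranspose, fromBlocks_multiply, hv', hw']⟩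

theorem reindex {p : Matrix ι ι R} (hp : IsStarProjection p) (e : ι ≃ κ) :
    MvNEquiv p (Matrix.reindex e e p) := by
  have h1 : pᴴ = p := hp.isSelfAdjoint
  have h2 : p * p = p := hp.isIdempotentElem
  refine ⟨p.submatrix e.symm id, ?_, ?_⟩
  · rw [conjTranspose_submatrix, submatrix_mul_equiv, h1, h2, submatrix_id_id]
  · rw [conjTranspose_submatrix, h1, Matrix.reindex_apply,
      ← Matrix.submatrix_mul _ _ _ id _ Function.bijective_id, h2]

end MvNEquiv

theorem IsStarProjection.fromBlocks {R ι κ : Type*} [NonUnitalRing R] [StarRing R] [Fintype ι]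
    [Fintype κ] {p : Matrix ι ι R} {q : Matrix κ κ R} (hp : IsStarProjection p)
    (hq : IsStarProjection q) : IsStarProjection (Matrix.fromBlocks p 0 0 q) where
  isIdempotentElem := by
    have h1 : p * p = p := hp.isIdempotentElem
    have h2 : q * q = q := hq.isIdempotentElem
    simp [IsIdempotentElem, fromBlocks_multiply, h1, h2]
  isSelfAdjoint := by
    have h1 : pᴴ = p := hp.isSelfAdjoint
    have h2 : qᴴ = q := hq.isSelfAdjoint
    simp [IsSelfAdjoint, star_eq_conjTranspose, fromBlocks_conjTranspose, h1, h2]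

theorem IsStarProjection.reindex {R ι κ : Type*} [NonUnitalRing R] [StarRing R] [Fintype ι]
    [Fintype κ] {p : Matrix ι ι R} (hp : IsStarProjection p) (e : ι ≃ κ) :
    IsStarProjection (Matrix.reindex e e p) where
  isIdempotentElem := by
    have h2 : p * p = p := hp.isIdempotentElem
    rw [IsIdempotentElem, reindex_apply, submatrix_mul_equiv, h2]
  isSelfAdjoint := by
    have h1 : pᴴ = p := hp.isSelfAdjoint
    rw [IsSelfAdjoint, star_eq_conjTranspose, reindex_apply, conjTranspose_submatrix, h1]

namespace MatrixProjection

variable {R S T : Type*} [NonUnitalRing R] [StarRing R] [NonUnitalRing S] [StarRing S]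
  [NonUnitalRing T] [StarRing T]

instance : Setoid (MatrixProjection R) where
  r p q := MvNEquiv p.val q.val
  iseqv :=
    { refl := fun p => MvNEquiv.refl p.isStarProjection
      symm := fun h => h.symm
      trans := fun {p _ r} h h' => h.trans p.isStarProjection r.isStarProjection h' }

/-- The block sum `diag(p, q)` of two projections. -/
def add (p q : MatrixProjection R) : MatrixProjection R where
  size := p.size + q.size
  val := Matrix.reindex finSumFinEquiv finSumFinEquiv (Matrix.fromBlocks p.val 0 0 q.val)
  isStarProjection := (p.isStarProjection.fromBlocks q.isStarProjection).reindex _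

theorem add_equiv (p q : MatrixProjection R) :
    MvNEquiv (add p q).val (Matrix.fromBlocks p.val 0 0 q.val) :=
  (MvNEquiv.reindex (p.isStarProjection.fromBlocks q.isStarProjection) _).symm

variable (R) in
/-- The zero projection, of size `0`. -/
def zero : MatrixProjection R where
  size := 0
  val := 0
  isStarProjection := ⟨Subsingleton.elim _ _, Subsingleton.elim _ _⟩

/-- The entrywise image of a projection under a ⋆-homomorphism. -/
def map [Module ℂ R] [Module ℂ S] (φ : R →⋆ₙₐ[ℂ] S) (p : MatrixProjection R) :
    MatrixProjection S where
  size := p.size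
  val := p.val.map φ
  isStarProjection :=
    { isIdempotentElem := by
        have h2 : p.val * p.val = p.val := p.isStarProjection.isIdempotentElem
        rw [IsIdempotentElem, ← Matrix.map_mul, h2]
      isSelfAdjoint := by
        have h1 : p.valᴴ = p.val := p.isStarProjection.isSelfAdjoint
        rw [IsSelfAdjoint, star_eq_conjTranspose, ← conjTranspose_map φ (fun x => map_star φ x), h1] }

end MatrixProjection

/-- The set `V(R)` of Murray--von Neumann classes of projections in matrix algebras over `R`. -/
def VMonoid (R : Type*) [NonUnitalRing R] [StarRing R] : Type _ :=
  Quotient (inferInstance : Setoid (MatrixProjection R))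

namespace VMonoid

variable {R S T : Type*} [NonUnitalRing R] [StarRing R] [NonUnitalRing S] [StarRing S]
  [NonUnitalRing T] [StarRing T]

/-- The class of a projection. -/
def mk (p : MatrixProjection R) : VMonoid R := Quotient.mk _ p

theorem mk_eq_mk {p q : MatrixProjection R} : mk p = mk q ↔ MvNEquiv p.val q.val :=
  Quotient.eq

theorem ind {P : VMonoid R → Prop} (h : ∀ p, P (mk p)) (x : VMonoid R) : P x :=
  Quotient.ind h x

instance : Zero (VMonoid R) := ⟨mk (MatrixProjection.zero R)⟩

/-- The sum of classes is the class of the block sum. -/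
instance : Add (VMonoid R) :=
  ⟨Quotient.map₂ MatrixProjection.add fun p p' hp q q' hq =>
    ((MatrixProjection.add_equiv p q).trans (p.add q).isStarProjection
      (p'.isStarProjection.fromBlocks q'.isStarProjection) (hp.fromBlocks hq)).trans
      (p.add q).isStarProjection (p'.add q').isStarProjection
      (MatrixProjection.add_equiv p' q').symm⟩

theorem mk_add_mk (p q : MatrixProjection R) : mk p + mk q = mk (p.add q) := rfl

theorem mk_eq_mk_of_equiv {ι : Type*} [Fintype ι] {p q : MatrixProjection R} {r : Matrix ι ι R}
    (hp : MvNEquiv p.val r) (hq : MvNEquiv q.val r) : mk p = mk q :=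
  mk_eq_mk.2 (hp.trans p.isStarProjection q.isStarProjection hq.symm)

instance : AddCommMonoid (VMonoid R) where
  add_assoc x y z := by
    induction x using ind with | h p => ?_
    induction y using ind with | h q => ?_
    induction z using ind with | h r => ?_
    have hpq := p.isStarProjection.fromBlocks q.isStarProjection
    have hqr := q.isStarProjection.fromBlocks r.isStarProjection
    have h1 := hpq.fromBlocks r.isStarProjection
    have h2 := p.isStarProjection.fromBlocks hqr
    have e1 : MvNEquiv ((p.add q).add r).val
        (Matrix.fromBlocks (Matrix.fromBlocks p.val 0 0 q.val) 0 0 r.val) :=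
      (MatrixProjection.add_equiv _ _).trans (MatrixProjection.isStarProjection _) h1
        ((MatrixProjection.add_equiv p q).fromBlocks (MvNEquiv.refl r.isStarProjection))
    have e2 : MvNEquiv (p.add (q.add r)).val
        (Matrix.fromBlocks p.val 0 0 (Matrix.fromBlocks q.val 0 0 r.val)) :=
      (MatrixProjection.add_equiv _ _).trans (MatrixProjection.isStarProjection _) h2
        ((MvNEquiv.refl p.isStarProjection).fromBlocks (MatrixProjection.add_equiv q r))
    have e3 := MvNEquiv.reindex h1 (Equiv.sumAssoc _ _ _)
    have e4 : Matrix.reindex (Equiv.sumAssoc (Fin p.size) (Fin q.size) (Fin r.size))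
        (Equiv.sumAssoc _ _ _)
        (Matrix.fromBlocks (Matrix.fromBlocks p.val 0 0 q.val) 0 0 r.val) =
        Matrix.fromBlocks p.val 0 0 (Matrix.fromBlocks q.val 0 0 r.val) := by
      ext (i | i | i) (j | j | j) <;> rfl
    rw [e4] at e3
    exact mk_eq_mk_of_equiv (e1.trans (MatrixProjection.isStarProjection _) h2 e3) e2
  add_comm x y := by
    induction x using ind with | h p => ?_
    induction y using ind with | h q => ?_
    have h1 := p.isStarProjection.fromBlocks q.isStarProjection
    have h2 := q.isStarProjection.fromBlocks p.isStarProjection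
    have e3 := MvNEquiv.reindex h1 (Equiv.sumComm _ _)
    have e4 : Matrix.reindex (Equiv.sumComm (Fin p.size) (Fin q.size)) (Equiv.sumComm _ _)
        (Matrix.fromBlocks p.val 0 0 q.val) = Matrix.fromBlocks q.val 0 0 p.val := by
      ext (i | i) (j | j) <;> rfl
    rw [e4] at e3
    exact mk_eq_mk_of_equiv ((MatrixProjection.add_equiv p q).trans
      (MatrixProjection.isStarProjection _) h2 e3) (MatrixProjection.add_equiv q p)
  zero_add x := by
    induction x using ind with | h p => ?_
    have : IsEmpty (Fin (MatrixProjection.zero R).size) := Fin.isEmpty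
    have hz := (MatrixProjection.zero R).isStarProjection.fromBlocks p.isStarProjection
    have e3 := MvNEquiv.reindex hz (Equiv.emptySum (Fin (MatrixProjection.zero R).size) (Fin p.size))
    have e4 : Matrix.reindex (Equiv.emptySum (Fin (MatrixProjection.zero R).size) (Fin p.size)) (Equiv.emptySum _ _)
        (Matrix.fromBlocks (MatrixProjection.zero R).val 0 0 p.val) = p.val := by
      ext i j; rfl
    exact mk_eq_mk_of_equiv (MatrixProjection.add_equiv _ p)
      (by rw [e4] at e3; exact e3.symm)
  add_zero x := by
    induction x using ind with | h p => ?_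
    have : IsEmpty (Fin (MatrixProjection.zero R).size) := Fin.isEmpty
    have hz := p.isStarProjection.fromBlocks (MatrixProjection.zero R).isStarProjection
    have e3 := MvNEquiv.reindex hz (Equiv.sumEmpty (Fin p.size) (Fin (MatrixProjection.zero R).size))
    have e4 : Matrix.reindex (Equiv.sumEmpty (Fin p.size) (Fin (MatrixProjection.zero R).size)) (Equiv.sumEmpty _ _)
        (Matrix.fromBlocks p.val 0 0 (MatrixProjection.zero R).val) = p.val := by
      ext i j; rfl
    exact mk_eq_mk_of_equiv (MatrixProjection.add_equiv p _)
      (by rw [e4] at e3; exact e3.symm)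
  nsmul := nsmulRec

variable [Module ℂ R] [Module ℂ S] [Module ℂ T]

/-- The map `V(R) → V(S)` induced by a ⋆-homomorphism. -/
def map (φ : R →⋆ₙₐ[ℂ] S) : VMonoid R →+ VMonoid S where
  toFun := Quotient.map (MatrixProjection.map φ) fun p q ⟨v, hv, hv'⟩ => by
    refine ⟨v.map φ, ?_, ?_⟩
    · change (v.map φ)ᴴ * v.map φ = p.val.map φ
      rw [← conjTranspose_map φ (fun x => map_star φ x), ← Matrix.map_mul, hv]
    · change v.map φ * (v.map φ)ᴴ = q.val.map φ
      rw [← conjTranspose_map φ (fun x => map_star φ x), ← Matrix.map_mul, hv']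
  map_zero' := by
    refine mk_eq_mk.2 ⟨0, ?_, ?_⟩ <;> ext i <;> exact Fin.elim0 i
  map_add' x y := by
    induction x using ind with | h p => ?_
    induction y using ind with | h q => ?_
    change mk ((p.add q).map φ) = mk ((p.map φ).add (q.map φ))
    have h : (Matrix.reindex finSumFinEquiv finSumFinEquiv
        (Matrix.fromBlocks p.val 0 0 q.val)).map φ =
        Matrix.reindex finSumFinEquiv finSumFinEquiv
          (Matrix.fromBlocks (p.val.map φ) 0 0 (q.val.map φ)) := by
      rw [reindex_apply, reindex_apply, ← submatrix_map, Matrix.fromBlocks_map]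
      simp [Matrix.map_zero]
    refine mk_eq_mk.2 ?_
    change MvNEquiv ((Matrix.reindex finSumFinEquiv finSumFinEquiv
        (Matrix.fromBlocks p.val 0 0 q.val)).map φ) _
    rw [h]
    exact MvNEquiv.refl ((p.map φ).add (q.map φ)).isStarProjection

theorem map_mk (φ : R →⋆ₙₐ[ℂ] S) (p : MatrixProjection R) : map φ (mk p) = mk (p.map φ) := rfl

theorem map_comp (ψ : S →⋆ₙₐ[ℂ] T) (φ : R →⋆ₙₐ[ℂ] S) (x : VMonoid R) :
    map (ψ.comp φ) x = map ψ (map φ x) := by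
  induction x using ind with | h p => rfl

theorem map_zero_hom (φ : R →⋆ₙₐ[ℂ] S) (hφ : ∀ a, φ a = 0) (x : VMonoid R) : map φ x = 0 := by
  induction x using ind with | h p => ?_
  have h0 : p.val.map φ = 0 := by ext i j; exact hφ _
  refine mk_eq_mk.2 ⟨0, ?_, by ext i; exact Fin.elim0 i⟩
  change _ = p.val.map φ
  rw [h0]
  exact Matrix.mul_zero _

end VMonoid

/-- The Grothendieck group of `V(R)`; for a unital C⋆-algebra `R` this is `K₀(R)`. -/
abbrev K00 (R : Type*) [NonUnitalRing R] [StarRing R] : Type _ :=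
  Algebra.GrothendieckAddGroup (VMonoid R)

/-- The homomorphism `K00 R → K00 S` induced by a ⋆-homomorphism. -/
noncomputable def K00.map {R S : Type*} [NonUnitalRing R] [StarRing R] [NonUnitalRing S]
    [StarRing S] [Module ℂ R] [Module ℂ S] (φ : R →⋆ₙₐ[ℂ] S) : K00 R →+ K00 S :=
  Algebra.GrothendieckAddGroup.lift
    ((Algebra.GrothendieckAddGroup.of (M := VMonoid S)).comp (VMonoid.map φ))

theorem K00.map_of {R S : Type*} [NonUnitalRing R] [StarRing R] [NonUnitalRing S]
    [StarRing S] [Module ℂ R] [Module ℂ S] (φ : R →⋆ₙₐ[ℂ] S) (x : VMonoid R) :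
    K00.map φ (Algebra.GrothendieckAddGroup.of x) =
      Algebra.GrothendieckAddGroup.of (VMonoid.map φ x) :=
  DFunLike.congr_fun (Algebra.GrothendieckAddGroup.lift.symm_apply_apply
    ((Algebra.GrothendieckAddGroup.of (M := VMonoid S)).comp (VMonoid.map φ))) x

theorem K00.map_comp {R S T : Type*} [NonUnitalRing R] [StarRing R] [NonUnitalRing S]
    [StarRing S] [NonUnitalRing T] [StarRing T] [Module ℂ R] [Module ℂ S] [Module ℂ T]
    (ψ : S →⋆ₙₐ[ℂ] T) (φ : R →⋆ₙₐ[ℂ] S) : K00.map (ψ.comp φ) = (K00.map ψ).comp (K00.map φ) := by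
  apply Algebra.GrothendieckAddGroup.lift.symm.injective
  ext x
  change K00.map (ψ.comp φ) (Algebra.GrothendieckAddGroup.of x) =
    K00.map ψ (K00.map φ (Algebra.GrothendieckAddGroup.of x))
  rw [K00.map_of, K00.map_of, K00.map_of, VMonoid.map_comp]

/-- The canonical surjection `Ã → ℂ` of the (forced) unitisation `Ã = A ⊕ ℂ`. -/
def unitizationFst (A : Type*) [NonUnitalCStarAlgebra A] : Unitization ℂ A →⋆ₙₐ[ℂ] ℂ where
  toFun x := x.fst
  map_smul' _ _ := rfl
  map_zero' := rfl
  map_add' _ _ := rfl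
  map_mul' _ _ := rfl
  map_star' _ := rfl

/-- The group `K₀(A)` of a C⋆-algebra: the kernel of `K00(Ã) → K00(ℂ)`. -/
noncomputable def K0 (A : Type*) [NonUnitalCStarAlgebra A] : AddSubgroup (K00 (Unitization ℂ A)) :=
  (K00.map (unitizationFst A)).ker

namespace K0

variable {A B : Type*} [NonUnitalCStarAlgebra A] [NonUnitalCStarAlgebra B]

/-- The homomorphism `K₀(φ) : K₀(A) → K₀(B)` induced by a ⋆-homomorphism. -/
noncomputable def map (φ : A →⋆ₙₐ[ℂ] B) : K0 A →+ K0 B :=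
  ((K00.map (Unitization.starMap φ : Unitization ℂ A →⋆ₙₐ[ℂ] Unitization ℂ B)).comp
    (K0 A).subtype).codRestrict (K0 B) fun x => by
      have h : (unitizationFst B).comp
          (Unitization.starMap φ : Unitization ℂ A →⋆ₙₐ[ℂ] Unitization ℂ B) =
          unitizationFst A := by
        ext y
        induction y using Unitization.ind with
        | inl_add_inr c a =>
          change (Unitization.starMap φ (Unitization.inl c + (a : Unitization ℂ A))).fst =
            (Unitization.inl c + (a : Unitization ℂ A)).fst
          simp [Unitization.algebraMap_eq_inl]
      change K00.map (unitizationFst B) (K00.map _ (x : K00 (Unitization ℂ A))) = 0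
      rw [← AddMonoidHom.comp_apply, ← K00.map_comp, h]
      exact x.2

variable (A) in
/-- The canonical map `V(A) → K₀(A)`, which sends a projection `p` in `M_n(A)` to `[p]`. -/
noncomputable def ofV : VMonoid A →+ K0 A :=
  ((Algebra.GrothendieckAddGroup.of (M := VMonoid (Unitization ℂ A))).comp
    (VMonoid.map (Unitization.inrNonUnitalStarAlgHom ℂ A))).codRestrict (K0 A) fun x => by
      change K00.map (unitizationFst A) (Algebra.GrothendieckAddGroup.of
        (VMonoid.map (Unitization.inrNonUnitalStarAlgHom ℂ A) x)) = 0
      rw [K00.map_of, ← VMonoid.map_comp, VMonoid.map_zero_hom _ (fun a => rfl), map_zero]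

variable (A) in
/-- The positive cone `K₀(A)⁺`: the classes of projections in matrix algebras over `A`. -/
def positiveCone : Set (K0 A) := Set.range (ofV A)

variable (A) in
/-- `K₀(A)` has cancellation: projections in matrix algebras over `A` that have the same class in
`K₀(A)` are Murray--von Neumann equivalent. -/
def HasCancellation : Prop :=
  ∀ p q : MatrixProjection A, ofV A (VMonoid.mk p) = ofV A (VMonoid.mk q) → MvNEquiv p.val q.val

/-- The subgroup `H_α` of `K₀(A)` generated by the ranges of the maps `id - K₀(α_g)`. -/
noncomputable def actionSubgroup {G : Type*} [Group G] (α : G →* (A ≃⋆ₐ[ℂ] A)) : AddSubgroup (K0 A) :=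
  AddSubgroup.closure {y | ∃ (g : G) (x : K0 A), y = x - map (α g : A →⋆ₙₐ[ℂ] A) x}

end K0

end KTheory

/-!
Write `B` for the crossed product `A ⋊ G` and `𝒦` for the compact operators.

*AF-embeddable implies quasidiagonal.* By the Gelfand--Naimark theorem (`exists_faithful_rep`, from
positive functionals and the GNS construction) an AF algebra `D` that contains `B` has a faithful
representation. If `S` is a finite-dimensional subalgebra of `D` and `χ` a finite set of vectors, the
projection onto `span (χ ∪ S χ)` has finite rank, commutes with `S` and fixes `χ`
(`IsAF.isQuasidiagonalSet_range`). Quasidiagonality passes to subalgebras.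

*Quasidiagonal implies finite projections.* If `π` is a faithful representation of `B` with
quasidiagonal range, then `π ⊗ id` is a faithful representation of `B ⊗ 𝒦`, and the block diagonal
operators `diag(P, …, P, 0, …)` form a net of finite-rank projections that converges strongly to `1`
and asymptotically commutes with its range. A partial isometry `v` from a projection `p` to a proper
subprojection gives a nonunitary isometry `v + 1 - p` that asymptotically commutes with this net.
This is impossible, because an almost isometric endomorphism of a finite-dimensional space is
onto (`eq_zero_of_isometry_of_tendsto`, `IsQuasidiagonal.allProjectionsFinite_stabilization`). An
approximate unit of projections of `A ⊗ 𝒦` is mapped to one of `B ⊗ 𝒦`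
(`HasProjectionApproxUnit.crossedProduct`).

*Stably finite implies that `H_α` meets the positive cone trivially.* For `e` in an approximate unit
of `A` let `u_g e` be the corresponding element of `B`; it plays the role of the unitary `u_g`, which
need not lie in `B̃`. Over `B̃` there is the unitary matrix
`Z = [[u_g e, -α_g(1 - e²)^{1/2}], [(1 - e²)^{1/2}, (u_g e)⋆]]` (with scalar blocks), and as `e` tends
to the unit, `Z diag(P, q) Z⋆` tends to `diag(α_g(P), q)` for each projection `P` over `Ã` with scalar
part `q` (`mvnEquiv_of_tendsto_rotation`, `mvnEquiv_fromBlocks_scalarPart`). Projections that are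
close to each other are equivalent, so `K₀(A) → K₀(B)` kills `H_α` (`K0.map_ι_eq_zero`).

If `[p]` lies in `H_α`, the image of `p` thus has the class zero in `K₀(B)`, that is, `diag(p, r)` is
equivalent to `diag(0, r)` for some projection `r` over `B̃`. This gives an isometry over `B̃` with
defect `diag(p, 0)`, and after division by its scalar part, which is a unitary matrix, it has the form
`1 + b` with `b` over `B`. Such isometries over a finite C⋆-algebra are unitary
(`IsFiniteCStar.eq_zero_of_isometry`): cut down to a large projection `e`, the unitary part of
`1 + e b e` is a partial isometry from `e` to a subprojection of `e`, hence onto `e`. So `p` is zero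
in `B` (`IsStablyFiniteCStar.val_eq_zero`), and zero in `A`, because `A` embeds in `B` by the regular
representation (`CrossedProduct.ι_injective`).
-/

open scoped ComplexOrder InnerProductSpace ComplexStarModule
open Filter Topology

/-! ### Faithful representations -/

/-- Every nonzero element of a C⋆-algebra is detected by a positive functional: the cone of
positive elements is closed and convex, so a real functional separates `-(star c * c)` from it. -/
theorem exists_positiveLinearMap_star_mul_self_ne_zero {D : Type*} [NonUnitalCStarAlgebra D]
    [PartialOrder D] [StarOrderedRing D] {c : D} (hc : c ≠ 0) :
    ∃ f : D →ₚ[ℂ] ℂ, f (star c * c) ≠ 0 := by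
  have hconv : Convex ℝ {a : D | 0 ≤ a} := fun x hx y hy s t hs ht _ =>
    add_nonneg (smul_nonneg hs hx) (smul_nonneg ht hy)
  have hnot : -(star c * c) ∉ {a : D | 0 ≤ a} := fun h =>
    hc ((CStarRing.star_mul_self_eq_zero_iff c).1
      (le_antisymm (neg_nonneg.1 h) (star_mul_self_nonneg c)))
  obtain ⟨f, u, hfu, hu⟩ :=
    geometric_hahn_banach_point_closed hconv CStarAlgebra.isClosed_nonneg hnot
  have hu0 : u < 0 := by simpa using hu 0 (le_refl (0 : D))
  have hpos : ∀ a : D, 0 ≤ a → 0 ≤ f a := by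
    intro a ha
    by_contra! h
    have h1 := hu ((u / f a) • a) (smul_nonneg (div_nonneg_of_nonpos hu0.le h.le) ha)
    rw [map_smul, smul_eq_mul, div_mul_cancel₀ _ h.ne] at h1
    exact lt_irrefl _ h1
  let F : D →ₗ[ℂ] ℂ := Module.Dual.extendRCLike
    ((f : D →ₗ[ℝ] ℝ) ∘ₗ ((selfAdjoint.submodule ℝ D).subtype ∘ₗ (realPart : D →ₗ[ℝ] selfAdjoint D)))
  have hF : ∀ a : D, IsSelfAdjoint a → F a = (f a : ℂ) := by
    intro a ha
    have h1 : ((ℜ (Complex.I • a) : selfAdjoint D) : D) = 0 := by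
      rw [realPart_I_smul, ha.imaginaryPart]; simp
    simp only [F, Module.Dual.extendRCLike_apply, LinearMap.comp_apply]
    change ((f ((ℜ a : selfAdjoint D) : D) : ℝ) : ℂ) -
      Complex.I * ((f ((ℜ (Complex.I • a) : selfAdjoint D) : D) : ℝ) : ℂ) = _
    rw [h1, ha.coe_realPart]; simp
  refine ⟨PositiveLinearMap.mk₀ F fun a ha => ?_, ?_⟩
  · rw [hF a ha.isSelfAdjoint]
    exact_mod_cast hpos a ha
  · change F (star c * c) ≠ 0
    rw [hF _ (.star_mul_self c)]
    have : 0 < f (star c * c) := by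
      rw [map_neg] at hfu; linarith
    exact_mod_cast this.ne'

section HilbertSum

variable {ι : Type*} {H : ι → Type*} [∀ i, NormedAddCommGroup (H i)]
  [∀ i, InnerProductSpace ℂ (H i)] [∀ i, CompleteSpace (H i)]

/-- The Hilbert sum of a family of representations of a C⋆-algebra. -/
noncomputable def hilbertSumRep {D : Type*} [NonUnitalCStarAlgebra D]
    (π : ∀ i, D →⋆ₙₐ[ℂ] (H i →L[ℂ] H i)) : D →⋆ₙₐ[ℂ] (lp H 2 →L[ℂ] lp H 2) where
  toFun a := lp.mapCLM 2 (fun i => π i a) (norm_nonneg a)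
    fun i => NonUnitalStarAlgHom.norm_apply_le (π i) a
  map_smul' c a := by ext ξ i; simp
  map_zero' := by ext ξ i; simp
  map_add' a b := by ext ξ i; simp
  map_mul' a b := by ext ξ i; simp
  map_star' a := by
    refine (ContinuousLinearMap.eq_adjoint_iff _ _).2 fun ξ η => ?_
    rw [lp.inner_eq_tsum, lp.inner_eq_tsum]
    refine tsum_congr fun i => ?_
    simp [map_star, ContinuousLinearMap.star_eq_adjoint, ContinuousLinearMap.adjoint_inner_left]

theorem hilbertSumRep_apply {D : Type*} [NonUnitalCStarAlgebra D]
    (π : ∀ i, D →⋆ₙₐ[ℂ] (H i →L[ℂ] H i)) (a : D) (ξ : lp H 2) (i : ι) :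
    hilbertSumRep π a ξ i = π i a (ξ i) := rfl

end HilbertSum

/-- The Gelfand--Naimark theorem: every C⋆-algebra has a faithful representation. -/
theorem exists_faithful_rep.{u} (D : Type u) [NonUnitalCStarAlgebra D] :
    ∃ (H : Type u) (_ : NormedAddCommGroup H) (_ : InnerProductSpace ℂ H) (_ : CompleteSpace H)
      (π : D →⋆ₙₐ[ℂ] (H →L[ℂ] H)), Function.Injective π := by
  classical
  let := CStarAlgebra.spectralOrder D
  have := CStarAlgebra.spectralOrderedRing D
  choose f hf using fun c : {c : D // c ≠ 0} =>
    exists_positiveLinearMap_star_mul_self_ne_zero c.2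
  refine ⟨lp (fun c => (f c).GNS) 2, inferInstance, inferInstance, inferInstance,
    hilbertSumRep fun c => (f c).gnsNonUnitalStarAlgHom, ?_⟩
  refine (injective_iff_map_eq_zero _).2 fun a ha => ?_
  by_contra hne
  -- the vector `star a` of the GNS space that detects `a * star a` is not killed by `a`
  have hc : a * star a ≠ 0 := fun h => hne ((CStarRing.mul_star_self_eq_zero_iff a).1 h)
  let c : {c : D // c ≠ 0} := ⟨a * star a, hc⟩
  have h1 : (f c).gnsNonUnitalStarAlgHom a ((f c).toPreGNS (star a) : (f c).PreGNS) = 0 := by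
    have := congr($ha (lp.single 2 c ((f c).toPreGNS (star a) : (f c).GNS)) c)
    simpa [hilbertSumRep_apply] using this
  rw [PositiveLinearMap.gnsNonUnitalStarAlgHom_apply_coe] at h1
  have h2 : ‖(f c).leftMulMapPreGNS a ((f c).toPreGNS (star a))‖ = 0 := by
    rw [← UniformSpace.Completion.norm_coe, h1, norm_zero]
  have h3 := (f c).preGNS_norm_sq ((f c).leftMulMapPreGNS a ((f c).toPreGNS (star a)))
  rw [h2] at h3
  refine hf c (Eq.trans ?_ (h3.symm.trans (by simp)))
  simp [c]

/-! ### Quasidiagonality of AF algebras -/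

section AF

variable {H : Type*} [NormedAddCommGroup H] [InnerProductSpace ℂ H]

/-- The orthogonal projection onto a finite-dimensional subspace that is invariant under `T` and
under its adjoint commutes with `T`. -/
theorem starProjection_commute_of_invariant [CompleteSpace H] (V : Submodule ℂ H)
    [V.HasOrthogonalProjection] (T : H →L[ℂ] H) (h1 : ∀ x ∈ V, T x ∈ V)
    (h2 : ∀ x ∈ V, star T x ∈ V) : T * V.starProjection = V.starProjection * T := by
  ext x
  have hx : T (V.starProjection x) ∈ V := h1 _ (V.starProjection_apply_mem x)
  have hy : T (x - V.starProjection x) ∈ Vᗮ := by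
    rw [Submodule.mem_orthogonal]
    intro u hu
    rw [← ContinuousLinearMap.adjoint_inner_left]
    exact (Submodule.mem_orthogonal _ _).1 (V.sub_starProjection_mem_orthogonal x) _ (h2 u hu)
  change T (V.starProjection x) = V.starProjection (T x)
  conv_rhs => rw [← add_sub_cancel (V.starProjection x) x, map_add, map_add]
  rw [Submodule.starProjection_eq_self_iff.2 hx,
    (Submodule.starProjection_apply_eq_zero_iff V).2 hy, add_zero]

/-- Every representation of an AF algebra has quasidiagonal range. For a finite-dimensional
subalgebra `S` and a finite set `χ` of vectors, the space `span (χ ∪ S χ)` is finite-dimensional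
and reduces `S`, so its orthogonal projection commutes with `S` and fixes `χ`. -/
theorem IsAF.isQuasidiagonalSet_range [CompleteSpace H] {D : Type*} [NonUnitalCStarAlgebra D]
    (hD : IsAF D) (π : D →⋆ₙₐ[ℂ] (H →L[ℂ] H)) : IsQuasidiagonalSet (Set.range π) := by
  obtain ⟨F, hFne, hFdir, hFfin, hFdense⟩ := hD
  intro ω hω χ ε hε
  -- a single finite-dimensional subalgebra approximates all the operators in `ω`
  have key : ∀ ω : Finset (H →L[ℂ] H), (ω : Set (H →L[ℂ] H)) ⊆ Set.range π →
      ∃ S ∈ F, ∀ T ∈ ω, ∃ b ∈ S, ‖T - π b‖ < ε / 2 := by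
    classical
    intro ω
    induction ω using Finset.induction_on with
    | empty => exact fun _ => ⟨hFne.some, hFne.some_mem, by simp⟩
    | insert T ω _ ih =>
      intro h
      rw [Finset.coe_insert, Set.insert_subset_iff] at h
      obtain ⟨S, hS, hSω⟩ := ih h.2
      obtain ⟨a, rfl⟩ := h.1
      obtain ⟨b, hb, hab⟩ := hFdense.exists_dist_lt a (half_pos hε)
      simp only [Set.mem_iUnion] at hb
      obtain ⟨S', hS', hbS'⟩ := hb
      obtain ⟨R, hR, hSR, hSR'⟩ := hFdir S hS S' hS'
      refine ⟨R, hR, fun T hT => ?_⟩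
      rcases Finset.mem_insert.1 hT with rfl | hT
      · refine ⟨b, hSR' hbS', ?_⟩
        rw [← map_sub]
        exact (NonUnitalStarAlgHom.norm_apply_le π _).trans_lt (by rwa [← dist_eq_norm])
      · obtain ⟨c, hc, hTc⟩ := hSω T hT
        exact ⟨c, hSR hc, hTc⟩
  obtain ⟨S, hS, hSω⟩ := key ω hω
  have := hFfin S hS
  let orb : H → Submodule ℂ H := fun x =>
    LinearMap.range ((LinearMap.applyₗ x).comp ((ContinuousLinearMap.coeLM ℂ).comp
      ((π : D →ₗ[ℂ] (H →L[ℂ] H)).comp S.toNonUnitalSubalgebra.toSubmodule.subtype)))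
  have hfin : ∀ x, FiniteDimensional ℂ (orb x) := fun x => by
    have : FiniteDimensional ℂ S.toNonUnitalSubalgebra.toSubmodule := hFfin S hS
    exact inferInstance
  have horb : ∀ x y, y ∈ orb x ↔ ∃ b ∈ S, π b x = y := fun x y =>
    ⟨fun ⟨b, hb⟩ => ⟨b, b.2, hb⟩, fun ⟨b, hb, h⟩ => ⟨⟨b, hb⟩, h⟩⟩
  let V : Submodule ℂ H := Submodule.span ℂ (χ : Set H) ⊔ ⨆ x : χ, orb x
  have hV : FiniteDimensional ℂ V := inferInstance
  have hinv : ∀ b ∈ S, ∀ x ∈ V, π b x ∈ V := by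
    intro b hb
    change V ≤ V.comap (π b : H →ₗ[ℂ] H)
    refine sup_le (Submodule.span_le.2 fun x hx => ?_) (iSup_le fun x y hy => ?_)
    · exact Submodule.mem_sup_right (Submodule.mem_iSup_of_mem ⟨x, hx⟩ ((horb _ _).2 ⟨b, hb, rfl⟩))
    · obtain ⟨c, hc, rfl⟩ := (horb _ _).1 hy
      refine Submodule.mem_sup_right (Submodule.mem_iSup_of_mem x ((horb _ _).2
        ⟨b * c, mul_mem hb hc, ?_⟩))
      simp
  refine ⟨V.starProjection, isStarProjection_starProjection, ?_, fun T hT => ?_, fun x hx => ?_⟩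
  · rw [Submodule.range_starProjection]; exact hV
  · obtain ⟨b, hb, hTb⟩ := hSω T hT
    have hcomm : π b * V.starProjection = V.starProjection * π b :=
      starProjection_commute_of_invariant V (π b) (hinv b hb)
        fun x hx => by rw [← map_star]; exact hinv _ (star_mem hb) x hx
    have hnorm : ‖V.starProjection‖ ≤ 1 := V.starProjection_norm_le
    have heq : T * V.starProjection - V.starProjection * T =
        (T - π b) * V.starProjection - V.starProjection * (T - π b) := by
      rw [sub_mul, mul_sub, hcomm]; abel
    rw [heq]
    calc _ ≤ ‖T - π b‖ * ‖V.starProjection‖ + ‖V.starProjection‖ * ‖T - π b‖ :=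
          (norm_sub_le _ _).trans (add_le_add (norm_mul_le _ _) (norm_mul_le _ _))
      _ ≤ ‖T - π b‖ * 1 + 1 * ‖T - π b‖ := by gcongr
      _ < ε := by linarith
  · have : x ∈ V := Submodule.mem_sup_left (Submodule.subset_span hx)
    rw [Submodule.starProjection_eq_self_iff.2 this]
    simpa using hε

theorem IsAFEmbeddable.isQuasidiagonal {B : Type*} [NonUnitalCStarAlgebra B]
    (h : IsAFEmbeddable B) : IsQuasidiagonal B := by
  obtain ⟨D, _, hD, φ, hφ⟩ := h
  obtain ⟨H, _, _, _, π, hπ⟩ := exists_faithful_rep D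
  refine ⟨H, inferInstance, inferInstance, inferInstance, π.comp φ, hπ.comp hφ, ?_⟩
  intro ω hω
  exact hD.isQuasidiagonalSet_range π ω
    (hω.trans (by rintro _ ⟨b, rfl⟩; exact ⟨φ b, rfl⟩))

end AF

/-! ### Enveloping C⋆-algebras and finite matrices -/

namespace CStarEnvelope

variable {E D : Type*} [NonUnitalRing E] [StarRing E] [Module ℂ E] [IsScalarTower ℂ E E]
  [SMulCommClass ℂ E E] [StarModule ℂ E] [HasCStarEnvelope E] [NonUnitalCStarAlgebra D]

variable (E) in
/-- The canonical ⋆-homomorphism from a ⋆-algebra to its enveloping C⋆-algebra. -/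
noncomputable abbrev incl : E →⋆ₙₐ[ℂ] CStarEnvelope E := (universalCStarSeminorm E).ofHom

variable (E) in
theorem denseRange_incl : DenseRange (incl E) := (universalCStarSeminorm E).denseRange_of

/-- The norm of a C⋆-algebra, as a C⋆-seminorm. -/
noncomputable def normCStarSeminorm (D : Type*) [NonUnitalCStarAlgebra D] : CStarSeminorm D where
  __ := normSeminorm ℂ D
  mul_le' := norm_mul_le
  star_mul_self' _ := CStarRing.norm_star_mul_self

theorem norm_apply_le_norm_incl (φ : E →⋆ₙₐ[ℂ] D) (x : E) : ‖φ x‖ ≤ ‖incl E x‖ :=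
  (le_ciSup (HasCStarEnvelope.bddAbove x) ((normCStarSeminorm D).comap φ)).trans_eq
    ((universalCStarSeminorm E).norm_of x).symm

theorem lift_uniformContinuous (φ : E →⋆ₙₐ[ℂ] D) :
    UniformContinuous (fun x : (universalCStarSeminorm E).Pre => φ (show E from x)) := by
  refine (LipschitzWith.of_dist_le_mul (K := 1) fun x y => ?_).uniformContinuous
  rw [dist_eq_norm, dist_eq_norm, NNReal.coe_one, one_mul]
  have h := norm_apply_le_norm_incl φ ((show E from x) - (show E from y))
  rw [map_sub] at h
  exact h.trans_eq ((universalCStarSeminorm E).norm_of _)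

/-- The universal property of the enveloping C⋆-algebra: a ⋆-homomorphism to a C⋆-algebra extends
to the envelope. -/
noncomputable def lift (φ : E →⋆ₙₐ[ℂ] D) : CStarEnvelope E →⋆ₙₐ[ℂ] D :=
  let F : CStarEnvelope E → D := UniformSpace.Completion.extension
    (fun x : (universalCStarSeminorm E).Pre => φ (show E from x))
  have hF : Continuous F := UniformSpace.Completion.continuous_extension
  have hx : ∀ x : E, F (incl E x) = φ x := fun x =>
    UniformSpace.Completion.extension_coe (lift_uniformContinuous φ) x
  { toFun := F
    map_smul' := fun c a => by
      induction a using CStarSeminorm.induction_on with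
      | hp => exact isClosed_eq (hF.comp (continuous_const_smul c)) (hF.const_smul _)
      | h x =>
        change F (c • incl E x) = c • F (incl E x)
        rw [← map_smul, hx, hx, map_smul]
    map_zero' := by rw [← map_zero (incl E), hx, map_zero]
    map_add' := fun a b => by
      induction a, b using CStarSeminorm.induction_on₂ with
      | hp => exact isClosed_eq (by fun_prop) (by fun_prop)
      | h x y =>
        change F (incl E x + incl E y) = F (incl E x) + F (incl E y)
        rw [← map_add, hx, hx, hx, map_add]
    map_mul' := fun a b => by
      induction a, b using CStarSeminorm.induction_on₂ with
      | hp => exact isClosed_eq (by fun_prop) (by fun_prop)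
      | h x y =>
        change F (incl E x * incl E y) = F (incl E x) * F (incl E y)
        rw [← map_mul, hx, hx, hx, map_mul]
    map_star' := fun a => by
      induction a using CStarSeminorm.induction_on with
      | hp => exact isClosed_eq (by fun_prop) (by fun_prop)
      | h x =>
        change F (star (incl E x)) = star (F (incl E x))
        rw [← map_star, hx, hx, map_star] }

@[simp]
theorem lift_incl (φ : E →⋆ₙₐ[ℂ] D) (x : E) : lift φ (incl E x) = φ x :=
  UniformSpace.Completion.extension_coe (lift_uniformContinuous φ) x

end CStarEnvelope

namespace FinMatrix

variable {A B : Type*} [NonUnitalCStarAlgebra A] [NonUnitalCStarAlgebra B]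

/-- A family of linear maps that satisfies the relations of matrix units induces a
⋆-homomorphism on `M_∞(A)`. -/
noncomputable def lift {D : Type*} [NonUnitalRing D] [StarRing D] [Module ℂ D]
    (e : ℕ → ℕ → A →ₗ[ℂ] D)
    (hmul : ∀ i j k l a b, e i j a * e k l b = if j = k then e i l (a * b) else 0)
    (hstar : ∀ i j a, star (e i j a) = e j i (star a)) : FinMatrix A →⋆ₙₐ[ℂ] D :=
  let F : FinMatrix A →+ D := Finsupp.liftAddHom fun s => (e s.1 s.2).toAddMonoidHom
  have hF : ∀ i j a, F (single i j a) = e i j a := fun i j a =>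
    Finsupp.liftAddHom_apply_single _ (i, j) a
  { toFun := F
    map_smul' := fun c x => by
      change F (c • x) = c • F x
      induction x using induction_linear with
      | h0 => simp
      | hadd x y hx hy => rw [smul_add, map_add, map_add, hx, hy, smul_add]
      | hs i j a => rw [smul_single, hF, hF, map_smul]
    map_zero' := map_zero F
    map_add' := map_add F
    map_mul' := fun x y => by
      change F (x * y) = F x * F y
      induction x using induction_linear with
      | h0 => simp
      | hadd x x' hx hx' => rw [add_mul, map_add, map_add, hx, hx', add_mul]
      | hs i j a =>
        induction y using induction_linear with
        | h0 => simp
        | hadd y y' hy hy' => rw [mul_add, map_add, map_add, hy, hy', mul_add]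
        | hs k l b =>
          rw [single_mul_single, hF, hF, hmul]
          split_ifs
          · rw [hF]
          · exact map_zero F
    map_star' := fun x => by
      induction x using induction_linear with
      | h0 => simp
      | hadd x y hx hy => rw [star_add, map_add, map_add, hx, hy, star_add]
      | hs i j a => rw [star_single, hF, hF, hstar] }

@[simp]
theorem lift_single {D : Type*} [NonUnitalRing D] [StarRing D] [Module ℂ D]
    (e : ℕ → ℕ → A →ₗ[ℂ] D) (hmul hstar) (i j : ℕ) (a : A) :
    lift e hmul hstar (single i j a) = e i j a :=
  Finsupp.liftAddHom_apply_single _ (i, j) a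

variable (A) in
/-- `single i j`, as a linear map. -/
noncomputable def lsingle (i j : ℕ) : A →ₗ[ℂ] FinMatrix A where
  __ := single i j
  map_smul' c a := (smul_single c i j a).symm

@[simp]
theorem lsingle_apply (i j : ℕ) (a : A) : lsingle A i j a = single i j a := rfl

/-- The entrywise image of a finite matrix under a ⋆-homomorphism. -/
noncomputable def map (φ : A →⋆ₙₐ[ℂ] B) : FinMatrix A →⋆ₙₐ[ℂ] FinMatrix B :=
  lift (fun i j => (lsingle B i j).comp (φ : A →ₗ[ℂ] B))
    (fun i j k l a b => by simp [single_mul_single])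
    (fun i j a => by simp [star_single, map_star])

@[simp]
theorem map_single (φ : A →⋆ₙₐ[ℂ] B) (i j : ℕ) (a : A) :
    map φ (single i j a) = single i j (φ a) :=
  lift_single _ _ _ i j a

/-- The entry of a finite matrix. -/
noncomputable def entry (i j : ℕ) : FinMatrix A →+ A := Finsupp.applyAddHom (i, j)

theorem entry_single (i j k l : ℕ) (a : A) :
    entry i j (single k l a) = if k = i ∧ l = j then a else 0 := by
  classical
  refine (Finsupp.single_apply (M := A)).trans ?_
  simp [Prod.ext_iff]

theorem ext_entry {x y : FinMatrix A} (h : ∀ i j, entry i j x = entry i j y) : x = y :=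
  Finsupp.ext fun s => h s.1 s.2

/-- The inclusion of `M_n(A)` in `M_∞(A)` as the upper left corner. -/
noncomputable def corner (n : ℕ) :
    CStarMatrix (Fin n) (Fin n) A →⋆ₙₐ[ℂ] FinMatrix A where
  toFun M := ∑ i : Fin n, ∑ j : Fin n, single (i : ℕ) (j : ℕ) (M i j)
  map_smul' c M := by simp [Finset.smul_sum, smul_single]
  map_zero' := by simp
  map_add' M N := by simp [Finset.sum_add_distrib]
  map_mul' M N := by
    simp only [Finset.sum_mul, Finset.mul_sum, single_mul_single, Fin.val_inj,
      CStarMatrix.mul_apply, map_sum]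
    rw [Finset.sum_comm_cycle]
    refine Finset.sum_congr rfl fun k _ => ?_
    rw [Finset.sum_comm]
    simp
  map_star' M := by
    simp only [star_sum, star_single]
    rw [Finset.sum_comm]
    rfl

theorem corner_apply (n : ℕ) (M : CStarMatrix (Fin n) (Fin n) A) :
    corner n M = ∑ i : Fin n, ∑ j : Fin n, single (i : ℕ) (j : ℕ) (M i j) := rfl

theorem entry_corner {n : ℕ} (M : CStarMatrix (Fin n) (Fin n) A) (i j : Fin n) :
    entry (i : ℕ) (j : ℕ) (corner n M) = M i j := by
  simp only [corner_apply, map_sum, entry_single, Fin.val_inj]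
  rw [Finset.sum_eq_single i, Finset.sum_eq_single j] <;> simp +contextual

theorem corner_injective (n : ℕ) : Function.Injective (corner (A := A) n) := fun M N h => by
  ext i j
  rw [← entry_corner M, ← entry_corner N, h]

theorem exists_corner_eq (x : FinMatrix A) : ∃ n, ∃ M, corner (A := A) n M = x := by
  let S : Finset (ℕ × ℕ) := Finsupp.support (show ℕ × ℕ →₀ A from x)
  have hS : ∀ i j, (i, j) ∉ S → entry i j x = 0 := fun i j h => Finsupp.notMem_support_iff.1 h
  obtain ⟨n, hn⟩ : ∃ n, ∀ s ∈ S, s.1 < n ∧ s.2 < n := by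
    refine ⟨S.sup (fun s => max s.1 s.2 + 1), fun s hs => ?_⟩
    have := Finset.le_sup (f := fun s : ℕ × ℕ => max s.1 s.2 + 1) hs
    grind
  refine ⟨n, CStarMatrix.ofMatrix fun i j => entry i j x, ext_entry fun i j => ?_⟩
  by_cases h : i < n ∧ j < n
  · exact entry_corner _ (⟨i, h.1⟩ : Fin n) (⟨j, h.2⟩ : Fin n)
  · rw [hS i j fun hs => h (hn _ hs)]
    simp only [corner_apply, map_sum, entry_single]
    refine Finset.sum_eq_zero fun k _ => Finset.sum_eq_zero fun l _ => if_neg fun hkl => h ?_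
    exact ⟨hkl.1 ▸ k.2, hkl.2 ▸ l.2⟩

end FinMatrix

/-! ### Quasidiagonal sets of operators -/

theorem continuous_starHom {A B : Type*} [NonUnitalCStarAlgebra A] [NonUnitalCStarAlgebra B]
    (φ : A →⋆ₙₐ[ℂ] B) : Continuous φ :=
  AddMonoidHomClass.continuous_of_bound φ 1 fun a => by
    simpa using NonUnitalStarAlgHom.norm_apply_le φ a

/-- Additive families of operators that are eventually uniformly bounded and tend to zero on a
dense set tend to zero everywhere. -/
theorem tendsto_zero_of_dense {ι X Y : Type*} [SeminormedAddCommGroup X]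
    [SeminormedAddCommGroup Y] {l : Filter ι} {f : ι → X → Y} {C : ℝ}
    (hf : ∀ᶠ i in l, ∀ x y, ‖f i x - f i y‖ ≤ C * ‖x - y‖) {s : Set X} (hs : Dense s)
    (h : ∀ x ∈ s, Tendsto (fun i => f i x) l (𝓝 0)) (x : X) :
    Tendsto (fun i => f i x) l (𝓝 0) := by
  rw [Metric.tendsto_nhds]
  intro ε hε
  have hC : 0 < |C| + 1 := by positivity
  obtain ⟨y, hy, hxy⟩ := hs.exists_dist_lt x (div_pos (half_pos hε) hC)
  rw [dist_eq_norm, lt_div_iff₀ hC] at hxy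
  filter_upwards [hf, Metric.tendsto_nhds.1 (h y hy) _ (half_pos hε)] with i h1 h2
  rw [dist_zero_right] at h2 ⊢
  have h3 : C * ‖x - y‖ ≤ ‖x - y‖ * (|C| + 1) := by
    nlinarith [le_abs_self C, norm_nonneg (x - y)]
  calc ‖f i x‖ = ‖(f i x - f i y) + f i y‖ := by rw [sub_add_cancel]
    _ ≤ ‖f i x - f i y‖ + ‖f i y‖ := norm_add_le _ _
    _ < ε := by linarith [h1 x y]

section Quasidiagonal

variable {H : Type*} [NormedAddCommGroup H] [InnerProductSpace ℂ H] [CompleteSpace H]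

/-- A quasidiagonal set of operators admits a net of finite-rank projections that converges
strongly to the identity and asymptotically commutes with every element of the set. -/
theorem IsQuasidiagonalSet.exists_filter {Ω : Set (H →L[ℂ] H)} (h : IsQuasidiagonalSet Ω) :
    ∃ l : Filter (H →L[ℂ] H), l.NeBot ∧
      (∀ᶠ P : H →L[ℂ] H in l, IsStarProjection P ∧ FiniteDimensional ℂ (LinearMap.range (P : H →ₗ[ℂ] H))) ∧
      (∀ T ∈ Ω, Tendsto (fun P => T * P - P * T) l (𝓝 0)) ∧
      ∀ x, Tendsto (fun P => P x - x) l (𝓝 0) := by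
  classical
  choose P hP hfin hcomm hid using fun i : Finset Ω × Finset H × ℕ =>
    h (i.1.map (Function.Embedding.subtype _)) (by simp) i.2.1 (1 / ((i.2.2 : ℝ) + 1))
      (by positivity)
  have small : ∀ ε : ℝ, 0 < ε → ∃ N : ℕ, ∀ n ≥ N, 1 / ((n : ℝ) + 1) < ε := fun ε hε => by
    obtain ⟨N, hN⟩ := exists_nat_one_div_lt hε
    exact ⟨N, fun n hn => (one_div_le_one_div_of_le (by positivity) (by gcongr)).trans_lt hN⟩
  refine ⟨map P atTop, inferInstance, by simp [hP, hfin], fun T hT => ?_, fun x => ?_⟩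
  · rw [tendsto_map'_iff, Metric.tendsto_nhds]
    intro ε hε
    obtain ⟨N, hN⟩ := small ε hε
    filter_upwards [eventually_ge_atTop (({⟨T, hT⟩}, ∅, N) : Finset Ω × Finset H × ℕ)]
      with i hi
    simp only [Function.comp_apply, dist_zero_right]
    exact (hcomm i T (by simpa using ⟨hT, hi.1 (Finset.mem_singleton_self _)⟩)).trans
      (hN _ hi.2.2)
  · rw [tendsto_map'_iff, Metric.tendsto_nhds]
    intro ε hε
    obtain ⟨N, hN⟩ := small ε hε
    filter_upwards [eventually_ge_atTop ((∅, {x}, N) : Finset Ω × Finset H × ℕ)] with i hi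
    simp only [Function.comp_apply, dist_zero_right]
    exact (hid i x (hi.2.1 (Finset.mem_singleton_self _))).trans (hN _ hi.2.2)

/-- An isometry that asymptotically commutes with a net of finite-rank projections converging
strongly to the identity is onto: its compressions to finite-dimensional spaces are almost
isometric, hence invertible, so a vector orthogonal to the range would be almost orthogonal to
itself. -/
theorem eq_zero_of_isometry_of_tendsto {l : Filter (H →L[ℂ] H)} [l.NeBot]
    (hl : ∀ᶠ P : H →L[ℂ] H in l, IsStarProjection P ∧
      FiniteDimensional ℂ (LinearMap.range (P : H →ₗ[ℂ] H)))
    (hid : ∀ x, Tendsto (fun P => P x - x) l (𝓝 0)) {s : H →L[ℂ] H} (hs : star s * s = 1)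
    (hcomm : Tendsto (fun P => s * P - P * s) l (𝓝 0)) {ξ : H} (hξ : star s ξ = 0) : ξ = 0 := by
  by_contra hne
  have hpos : 0 < ‖ξ‖ := norm_pos_iff.2 hne
  obtain ⟨P, ⟨hP, hfin⟩, h1, h2⟩ := (hl.and
    (((Metric.tendsto_nhds.1 hcomm) (1 / 2) (by norm_num)).and
      ((Metric.tendsto_nhds.1 (hid ξ)) (‖ξ‖ / 8) (by positivity)))).exists
  rw [dist_zero_right] at h1 h2
  have hPP : ∀ x, P (P x) = P x := fun x => congr($(hP.isIdempotentElem) x)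
  have hPadj : ∀ x y, ⟪P x, y⟫_ℂ = ⟪x, P y⟫_ℂ := fun x y => by
    conv_lhs => rw [← hP.isSelfAdjoint.star_eq]
    exact ContinuousLinearMap.adjoint_inner_left _ _ _
  have hsnorm : ∀ x, ‖s x‖ = ‖x‖ := fun x => by
    have h3 : ⟪s x, s x⟫_ℂ = ⟪x, x⟫_ℂ := by
      rw [← ContinuousLinearMap.adjoint_inner_left]
      exact congr(⟪$hs x, x⟫_ℂ)
    rw [← sq_eq_sq₀ (norm_nonneg _) (norm_nonneg _)]
    rw [inner_self_eq_norm_sq_to_K, inner_self_eq_norm_sq_to_K] at h3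
    exact_mod_cast h3
  let V := LinearMap.range (P : H →ₗ[ℂ] H)
  have hV : ∀ x ∈ V, P x = x := by rintro _ ⟨x, rfl⟩; exact hPP x
  have hlow : ∀ x ∈ V, ‖x‖ ≤ 2 * ‖P (s x)‖ := fun x hx => by
    have h3 : ‖s x - P (s x)‖ ≤ 1 / 2 * ‖x‖ := by
      have h4 := (s * P - P * s).le_of_opNorm_le h1.le x
      simpa [hV x hx] using h4
    have h4 := norm_sub_norm_le (s x) (P (s x))
    rw [hsnorm] at h4
    linarith
  let T : V →ₗ[ℂ] V := ((P * s : H →L[ℂ] H) : H →ₗ[ℂ] H).restrict (p := V) (q := V)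
    fun x _ => ⟨s x, rfl⟩
  have hTinj : Function.Injective T := by
    refine (injective_iff_map_eq_zero T).2 fun x hx => ?_
    have h3 : P (s x) = 0 := congr(($hx : H))
    have h4 := hlow x x.2
    rw [h3, norm_zero, mul_zero, norm_le_zero_iff] at h4
    exact Subtype.ext h4
  obtain ⟨⟨η, hη⟩, hTη⟩ := LinearMap.injective_iff_surjective.1 hTinj ⟨P ξ, ξ, rfl⟩
  replace hTη : P (s η) = P ξ := congr(($hTη : H))
  have h3 : ⟪P ξ, P ξ⟫_ℂ = ⟪P ξ - ξ, s η⟫_ℂ := by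
    have h4 : ⟪ξ, s η⟫_ℂ = 0 := by
      rw [← ContinuousLinearMap.adjoint_inner_left]
      change ⟪star s ξ, η⟫_ℂ = 0
      rw [hξ, inner_zero_left]
    rw [inner_sub_left, h4, sub_zero, hPadj, hPP, hPadj, hTη]
  have h4 : ‖P ξ‖ * ‖P ξ‖ ≤ ‖P ξ - ξ‖ * ‖s η‖ := by
    have h5 : ‖P ξ‖ * ‖P ξ‖ = ‖⟪P ξ, P ξ⟫_ℂ‖ := by rw [inner_self_eq_norm_sq_to_K]; simp [sq]
    rw [h5, h3]
    exact norm_inner_le_norm _ _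
  have h5 := hlow η hη
  rw [hTη] at h5
  rw [hsnorm] at h4
  have h6 : ‖ξ‖ - ‖P ξ‖ ≤ ‖P ξ - ξ‖ := by
    rw [norm_sub_rev]; exact norm_sub_norm_le _ _
  have h7 : ‖P ξ‖ * ‖P ξ‖ ≤ ‖ξ‖ / 8 * (2 * ‖P ξ‖) :=
    h4.trans (mul_le_mul h2.le h5 (norm_nonneg _) (by positivity))
  nlinarith [norm_nonneg (P ξ)]

end Quasidiagonal

/-! ### Representations of the stabilisation -/

section Stabilization

variable {H : Type*} [NormedAddCommGroup H] [InnerProductSpace ℂ H] [CompleteSpace H]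

/-- The operator on `ℓ²(ℕ, H)` whose block matrix has the entry `T` at `(i, j)` and zeros
elsewhere. -/
noncomputable def matrixUnitOp (i j : ℕ) :
    (H →L[ℂ] H) →ₗ[ℂ] (lp (fun _ : ℕ => H) 2 →L[ℂ] lp (fun _ : ℕ => H) 2) where
  toFun T := lp.singleContinuousLinearMap ℂ (fun _ : ℕ => H) 2 i ∘L T ∘L
    lp.evalCLM ℂ (fun _ : ℕ => H) 2 j
  map_add' S T := by ext; simp
  map_smul' c T := by ext; simp

theorem matrixUnitOp_apply (i j : ℕ) (T : H →L[ℂ] H) (ξ : lp (fun _ : ℕ => H) 2) :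
    matrixUnitOp i j T ξ = lp.single 2 i (T (ξ j)) := rfl

theorem matrixUnitOp_mul (i j k l : ℕ) (S T : H →L[ℂ] H) :
    matrixUnitOp i j S * matrixUnitOp k l T = if j = k then matrixUnitOp i l (S * T) else 0 := by
  ext1 ξ
  simp only [mul_apply_eq_comp, matrixUnitOp_apply]
  split_ifs with h
  · subst h; simp [matrixUnitOp_apply]
  · rw [lp.single_apply_ne _ _ _ h]; simp

theorem star_matrixUnitOp (i j : ℕ) (T : H →L[ℂ] H) :
    star (matrixUnitOp i j T) = matrixUnitOp j i (star T) := by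
  refine ((ContinuousLinearMap.eq_adjoint_iff _ _).2 fun ξ η => ?_).symm
  rw [matrixUnitOp_apply, matrixUnitOp_apply, lp.inner_single_left, lp.inner_single_right]
  exact ContinuousLinearMap.adjoint_inner_left _ _ _

theorem norm_matrixUnitOp_le (i j : ℕ) (T : H →L[ℂ] H) : ‖matrixUnitOp i j T‖ ≤ ‖T‖ := by
  refine ContinuousLinearMap.opNorm_le_bound _ (norm_nonneg _) fun ξ => ?_
  rw [matrixUnitOp_apply, lp.norm_single (by norm_num)]
  exact (T.le_opNorm _).trans (mul_le_mul_of_nonneg_left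
    (lp.norm_apply_le_norm (by norm_num) ξ j) (norm_nonneg _))

/-- The representation `π ⊗ id` of `B ⊗ 𝒦` on `ℓ²(ℕ, H)`, restricted to `M_∞(B)`. -/
noncomputable def finMatrixRep {B : Type*} [NonUnitalCStarAlgebra B]
    (π : B →⋆ₙₐ[ℂ] (H →L[ℂ] H)) :
    FinMatrix B →⋆ₙₐ[ℂ] (lp (fun _ : ℕ => H) 2 →L[ℂ] lp (fun _ : ℕ => H) 2) :=
  FinMatrix.lift (fun i j => (matrixUnitOp i j).comp (π : B →ₗ[ℂ] (H →L[ℂ] H)))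
    (fun i j k l a b => by simp [matrixUnitOp_mul])
    (fun i j a => by simp [star_matrixUnitOp, map_star])

@[simp]
theorem finMatrixRep_single {B : Type*} [NonUnitalCStarAlgebra B]
    (π : B →⋆ₙₐ[ℂ] (H →L[ℂ] H)) (i j : ℕ) (b : B) :
    finMatrixRep π (FinMatrix.single i j b) = matrixUnitOp i j (π b) :=
  FinMatrix.lift_single _ _ _ i j b

theorem finMatrixRep_single_apply {B : Type*} [NonUnitalCStarAlgebra B]
    (π : B →⋆ₙₐ[ℂ] (H →L[ℂ] H)) (x : FinMatrix B) (i j : ℕ) (ξ : H) :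
    finMatrixRep π x (lp.single 2 j ξ) i = π (FinMatrix.entry i j x) ξ := by
  induction x using FinMatrix.induction_linear with
  | h0 => simp
  | hadd x y hx hy => simp [hx, hy]
  | hs k l b =>
    rw [finMatrixRep_single, matrixUnitOp_apply, FinMatrix.entry_single]
    by_cases hl : l = j
    · subst hl
      by_cases hk : k = i
      · subst hk; simp
      · rw [lp.single_apply_ne _ _ _ (Ne.symm hk)]; simp [hk]
    · rw [lp.single_apply_ne _ _ _ hl]; simp [hl]

theorem finMatrixRep_injective {B : Type*} [NonUnitalCStarAlgebra B]
    {π : B →⋆ₙₐ[ℂ] (H →L[ℂ] H)} (hπ : Function.Injective π) :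
    Function.Injective (finMatrixRep π) := by
  refine (injective_iff_map_eq_zero _).2 fun x hx => FinMatrix.ext_entry fun i j => ?_
  rw [map_zero]
  refine (map_eq_zero_iff π hπ).1 ?_
  ext ξ
  rw [← finMatrixRep_single_apply, hx]
  simp

open CStarEnvelope in
/-- The representation `π ⊗ id` of `B ⊗ 𝒦` is faithful if `π` is: each `M_n(B)` is a C⋆-algebra,
so that the largest C⋆-norm of `M_∞(B)` is the norm of this representation. -/
theorem lift_finMatrixRep_injective {B : Type*} [NonUnitalCStarAlgebra B]
    {π : B →⋆ₙₐ[ℂ] (H →L[ℂ] H)} (hπ : Function.Injective π) :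
    Function.Injective (CStarEnvelope.lift (finMatrixRep π)) := by
  let := CStarAlgebra.spectralOrder B
  have := CStarAlgebra.spectralOrderedRing B
  have key : ∀ y : Stabilization B, ‖y‖ ≤ ‖CStarEnvelope.lift (finMatrixRep π) y‖ := fun y => by
    induction y using CStarSeminorm.induction_on with
    | hp =>
      exact isClosed_le continuous_norm
        (continuous_starHom (CStarEnvelope.lift (finMatrixRep π))).norm
    | h x =>
      change ‖incl _ x‖ ≤ ‖CStarEnvelope.lift (finMatrixRep π) (incl _ x)‖
      obtain ⟨n, M, rfl⟩ := FinMatrix.exists_corner_eq x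
      rw [lift_incl]
      calc ‖(incl (FinMatrix B)).comp (FinMatrix.corner n) M‖ ≤ ‖M‖ :=
            NonUnitalStarAlgHom.norm_apply_le _ M
        _ = ‖(finMatrixRep π).comp (FinMatrix.corner n) M‖ :=
            (NonUnitalStarAlgHom.norm_map ((finMatrixRep π).comp (FinMatrix.corner n))
              ((finMatrixRep_injective hπ).comp (FinMatrix.corner_injective n)) M).symm
  refine (injective_iff_map_eq_zero _).2 fun y hy => ?_
  have := key y
  rwa [hy, norm_zero, norm_le_zero_iff] at this

end Stabilization

/-! ### Quasidiagonality and finite projections in the stabilisation -/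

section Inflation

variable {H : Type*} [NormedAddCommGroup H] [InnerProductSpace ℂ H] [CompleteSpace H]

/-- The block diagonal operator `diag(P, …, P, 0, 0, …)` on `ℓ²(ℕ, H)`, with `n` copies of `P`. -/
noncomputable def inflation (n : ℕ) (P : H →L[ℂ] H) :
    lp (fun _ : ℕ => H) 2 →L[ℂ] lp (fun _ : ℕ => H) 2 :=
  ∑ i ∈ Finset.range n, matrixUnitOp i i P

theorem matrixUnitOp_mul_inflation {n i j : ℕ} (hj : j < n) (T P : H →L[ℂ] H) :
    matrixUnitOp i j T * inflation n P = matrixUnitOp i j (T * P) := by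
  simp [inflation, Finset.mul_sum, matrixUnitOp_mul, hj]

theorem inflation_mul_matrixUnitOp {n i j : ℕ} (hi : i < n) (T P : H →L[ℂ] H) :
    inflation n P * matrixUnitOp i j T = matrixUnitOp i j (P * T) := by
  simp [inflation, Finset.sum_mul, matrixUnitOp_mul, hi]

theorem isStarProjection_inflation (n : ℕ) {P : H →L[ℂ] H} (hP : IsStarProjection P) :
    IsStarProjection (inflation n P) where
  isIdempotentElem := by
    have h : P * P = P := hP.isIdempotentElem
    change (∑ i ∈ Finset.range n, matrixUnitOp i i P) * inflation n P =
      ∑ i ∈ Finset.range n, matrixUnitOp i i P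
    rw [Finset.sum_mul]
    refine Finset.sum_congr rfl fun i hi => ?_
    rw [matrixUnitOp_mul_inflation (Finset.mem_range.1 hi), h]
  isSelfAdjoint := by
    have h : star P = P := hP.isSelfAdjoint
    simp [IsSelfAdjoint, inflation, star_matrixUnitOp, h]

theorem finiteDimensional_range_inflation (n : ℕ) {P : H →L[ℂ] H}
    (hP : FiniteDimensional ℂ (LinearMap.range (P : H →ₗ[ℂ] H))) :
    FiniteDimensional ℂ (LinearMap.range
      (inflation n P : lp (fun _ : ℕ => H) 2 →ₗ[ℂ] lp (fun _ : ℕ => H) 2)) := by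
  let W : Submodule ℂ (lp (fun _ : ℕ => H) 2) := ⨆ i : Fin n,
    (LinearMap.range (P : H →ₗ[ℂ] H)).map
      (lp.singleContinuousLinearMap ℂ (fun _ : ℕ => H) 2 i : H →ₗ[ℂ] lp (fun _ : ℕ => H) 2)
  have hW : FiniteDimensional ℂ W := inferInstance
  refine Submodule.finiteDimensional_of_le (S₂ := W) ?_
  rintro _ ⟨ξ, rfl⟩
  change inflation n P ξ ∈ W
  rw [inflation, sum_apply]
  refine Submodule.sum_mem _ fun i hi => ?_
  refine Submodule.mem_iSup_of_mem (⟨i, Finset.mem_range.1 hi⟩ : Fin n) ?_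
  exact ⟨P (ξ i), ⟨ξ i, rfl⟩, rfl⟩

variable {l : Filter (H →L[ℂ] H)}

/-- If projections `P` converge strongly to the identity, so do their inflations. -/
theorem tendsto_inflation_sub (hl : ∀ᶠ P : H →L[ℂ] H in l, IsStarProjection P)
    (hid : ∀ x, Tendsto (fun P : H →L[ℂ] H => P x - x) l (𝓝 0)) (ξ : lp (fun _ : ℕ => H) 2) :
    Tendsto (fun z : (H →L[ℂ] H) × ℕ => inflation z.2 z.1 ξ - ξ) (l ×ˢ atTop) (𝓝 0) := by
  have hdense : Dense {ξ : lp (fun _ : ℕ => H) 2 |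
      ∃ s : Finset ℕ, ∃ η : ℕ → H, ξ = ∑ i ∈ s, lp.single 2 i (η i)} := fun ξ =>
    mem_closure_of_tendsto (lp.hasSum_single (by norm_num) ξ)
      (Eventually.of_forall fun s => ⟨s, ξ, rfl⟩)
  refine tendsto_zero_of_dense (C := 2)
    (f := fun (z : (H →L[ℂ] H) × ℕ) ξ => inflation z.2 z.1 ξ - ξ) ?_ hdense ?_ ξ
  · filter_upwards [tendsto_fst.eventually hl] with z hz x y
    have h1 : inflation z.2 z.1 x - x - (inflation z.2 z.1 y - y) =
        inflation z.2 z.1 (x - y) - (x - y) := by rw [map_sub]; abel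
    rw [h1]
    refine (norm_sub_le _ _).trans ?_
    have h2 := (inflation z.2 z.1).le_of_opNorm_le
      (isStarProjection_inflation z.2 hz).norm_le (x - y)
    linarith
  · rintro _ ⟨s, η, rfl⟩
    have h1 : ∀ z : (H →L[ℂ] H) × ℕ, inflation z.2 z.1 (∑ i ∈ s, lp.single 2 i (η i)) -
        (∑ i ∈ s, lp.single 2 i (η i)) =
        ∑ i ∈ s, (inflation z.2 z.1 (lp.single 2 i (η i)) - lp.single 2 i (η i)) := fun z => by
      rw [map_sum, Finset.sum_sub_distrib]
    simp only [h1]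
    suffices h : ∀ i ∈ s, Tendsto (fun z : (H →L[ℂ] H) × ℕ =>
        inflation z.2 z.1 (lp.single 2 i (η i)) - lp.single 2 i (η i)) (l ×ˢ atTop) (𝓝 0) by
      simpa only [Finset.sum_const_zero] using tendsto_finsetSum s h
    intro i _
    have h2 : Tendsto (fun z : (H →L[ℂ] H) × ℕ => lp.singleContinuousLinearMap ℂ
        (fun _ : ℕ => H) 2 i (z.1 (η i) - η i)) (l ×ˢ atTop) (𝓝 0) := by
      rw [← map_zero (lp.singleContinuousLinearMap ℂ (fun _ : ℕ => H) 2 i)]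
      exact ((map_continuous _).tendsto 0).comp ((hid (η i)).comp tendsto_fst)
    refine h2.congr' ?_
    filter_upwards [tendsto_snd.eventually (eventually_gt_atTop i)] with z hz
    rw [inflation, sum_apply, Finset.sum_eq_single i]
    · simp [matrixUnitOp_apply]
    · intro j _ hj
      rw [matrixUnitOp_apply, lp.single_apply_ne _ _ _ hj]; simp
    · simp [hz]

/-- If projections `P` asymptotically commute with the range of `π`, then their inflations
asymptotically commute with the range of `π ⊗ id`. -/
theorem tendsto_commutator_inflation {B : Type*} [NonUnitalCStarAlgebra B]
    (π : B →⋆ₙₐ[ℂ] (H →L[ℂ] H)) (hl : ∀ᶠ P : H →L[ℂ] H in l, IsStarProjection P)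
    (hcomm : ∀ b, Tendsto (fun P : H →L[ℂ] H => π b * P - P * π b) l (𝓝 0))
    (y : Stabilization B) :
    Tendsto (fun z : (H →L[ℂ] H) × ℕ =>
      CStarEnvelope.lift (finMatrixRep π) y * inflation z.2 z.1 -
        inflation z.2 z.1 * CStarEnvelope.lift (finMatrixRep π) y) (l ×ˢ atTop) (𝓝 0) := by
  refine tendsto_zero_of_dense (C := 2) (f := fun (z : (H →L[ℂ] H) × ℕ) y =>
      CStarEnvelope.lift (finMatrixRep π) y * inflation z.2 z.1 -
        inflation z.2 z.1 * CStarEnvelope.lift (finMatrixRep π) y) ?_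
    (CStarEnvelope.denseRange_incl (FinMatrix B)) ?_ y
  · filter_upwards [tendsto_fst.eventually hl] with z hz x y
    have hQ : ‖inflation z.2 z.1‖ ≤ 1 :=
      (isStarProjection_inflation z.2 hz).norm_le
    have hxy := NonUnitalStarAlgHom.norm_apply_le (CStarEnvelope.lift (finMatrixRep π)) (x - y)
    have h1 : ∀ S T Q : lp (fun _ : ℕ => H) 2 →L[ℂ] lp (fun _ : ℕ => H) 2,
        S * Q - Q * S - (T * Q - Q * T) = (S - T) * Q - Q * (S - T) := fun S T Q => by
      rw [sub_mul, mul_sub]; abel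
    rw [h1, ← map_sub]
    generalize CStarEnvelope.lift (finMatrixRep π) (x - y) = S at hxy
    calc _ ≤ ‖S‖ * ‖inflation z.2 z.1‖ + ‖inflation z.2 z.1‖ * ‖S‖ :=
          (norm_sub_le _ _).trans (add_le_add (norm_mul_le _ _) (norm_mul_le _ _))
      _ ≤ ‖S‖ * 1 + 1 * ‖S‖ := by gcongr
      _ ≤ 2 * ‖x - y‖ := by linarith
  · rintro _ ⟨x, rfl⟩
    simp only [CStarEnvelope.lift_incl]
    induction x using FinMatrix.induction_linear with
    | h0 => simpa using tendsto_const_nhds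
    | hadd x y hx hy =>
      have := hx.add hy
      rw [add_zero] at this
      refine this.congr fun z => ?_
      rw [map_add, add_mul, mul_add]; abel
    | hs i j b =>
      rw [finMatrixRep_single]
      refine squeeze_zero_norm' ?_ (tendsto_zero_iff_norm_tendsto_zero.1
        ((hcomm b).comp (tendsto_fst (g := (atTop : Filter ℕ)))))
      filter_upwards [tendsto_snd.eventually (eventually_gt_atTop i),
        tendsto_snd.eventually (eventually_gt_atTop j)] with z hi hj
      rw [matrixUnitOp_mul_inflation hj, inflation_mul_matrixUnitOp hi, ← map_sub]
      exact norm_matrixUnitOp_le _ _ _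

end Inflation

/-- The relations between a projection `p`, a subprojection `q` and a partial isometry from `p` to
`q`. -/
theorem partialIsometry_relations {B : Type*} [NonUnitalCStarAlgebra B] {p q v : B}
    (hp : IsStarProjection p) (hpq : p * q = q) (hv : star v * v = p) (hv' : v * star v = q) :
    v * p = v ∧ p * v = v ∧ q * v = v := by
  have hpp : p * p = p := hp.isIdempotentElem
  have hps : star p = p := hp.isSelfAdjoint
  have h1 : v * p = v := by
    refine sub_eq_zero.1 ((CStarRing.star_mul_self_eq_zero_iff _).1 ?_)
    have h0 : star v * (v * p) = p := by rw [← mul_assoc, hv, hpp]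
    simp only [star_sub, star_mul, hps, sub_mul, mul_sub, mul_assoc, h0, hv, hpp, sub_self]
  have h2 : q * v = v := by rw [← hv', mul_assoc, hv, h1]
  exact ⟨h1, by rw [← h2, ← mul_assoc, hpq], h2⟩

theorem IsQuasidiagonal.allProjectionsFinite_stabilization {B : Type*} [NonUnitalCStarAlgebra B]
    (h : IsQuasidiagonal B) : AllProjectionsFinite (Stabilization B) := by
  obtain ⟨H, _, _, _, π, hπ, hqd⟩ := h
  obtain ⟨l, hne, hl, hcomm, hid⟩ := hqd.exists_filter
  rintro p - ⟨hp, q, hq, hpq, hqp, v, hv, hv'⟩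
  obtain ⟨hvp, hpv, hqv⟩ := partialIsometry_relations hp hpq hv hv'
  have hpp : p * p = p := hp.isIdempotentElem
  have hps : star p = p := hp.isSelfAdjoint
  have hqs : star q = q := hq.isSelfAdjoint
  let ρ := CStarEnvelope.lift (finMatrixRep π)
  have hρ : Function.Injective ρ := lift_finMatrixRep_injective hπ
  -- the isometry `v + (1 - p)`, whose range is the complement of that of `p - q`
  let s := ρ v + (1 - ρ p)
  have hs : star s * s = 1 := by
    have h1 : star (ρ v) * ρ v = ρ p := by rw [← map_star, ← map_mul, hv]
    have h2 : ρ p * ρ v = ρ v := by rw [← map_mul, hpv]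
    have h3 : star (ρ v) * ρ p = star (ρ v) := by
      rw [← map_star, ← map_mul, ← hps, ← star_mul, hpv]
    have h4 : ρ p * ρ p = ρ p := by rw [← map_mul, hpp]
    have h5 : star (ρ p) = ρ p := by rw [← map_star, hps]
    simp only [s, star_add, star_sub, star_one, h5, add_mul, mul_add, sub_mul, mul_sub, h1, h2, h3,
      h4, one_mul, mul_one]
    abel
  have hs0 : star s * ρ (p - q) = 0 := by
    have h1 : star v * (p - q) + ((p - q) - p * (p - q)) = 0 := by
      have h3 : star v * p = star v := by rw [← hps, ← star_mul, hpv]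
      have h4 : star v * q = star v := by rw [← hqs, ← star_mul, hqv]
      rw [mul_sub, mul_sub, h3, h4, hpp, hpq]; abel
    have h2 := congr(ρ $h1)
    rw [map_add, map_sub, map_mul, map_mul, map_star, map_zero] at h2
    rw [← h2]
    simp only [s, star_add, star_sub, star_one, ← map_star ρ p, hps, add_mul, sub_mul, one_mul]
  have hcomm' : Tendsto (fun Q => s * Q - Q * s)
      (map (fun z : (H →L[ℂ] H) × ℕ => inflation z.2 z.1) (l ×ˢ atTop)) (𝓝 0) := by
    rw [tendsto_map'_iff]
    have h1 := fun y => tendsto_commutator_inflation π (hl.mono fun _ h => h.1)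
      (fun b => hcomm _ ⟨b, rfl⟩) y
    have h2 := (h1 v).sub (h1 p)
    rw [sub_zero] at h2
    refine h2.congr fun z => ?_
    change _ = (ρ v + (1 - ρ p)) * _ - _ * (ρ v + (1 - ρ p))
    rw [add_mul, mul_add, sub_mul, mul_sub, one_mul, mul_one]
    abel
  refine hqp (Eq.symm (sub_eq_zero.1 ((map_eq_zero_iff ρ hρ).1 ?_)))
  ext1 ξ
  refine eq_zero_of_isometry_of_tendsto (l := map _ (l ×ˢ atTop)) ?_ ?_ hs hcomm' congr($hs0 ξ)
  · rw [eventually_map]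
    filter_upwards [tendsto_fst.eventually hl] with z hz
    exact ⟨isStarProjection_inflation _ hz.1, finiteDimensional_range_inflation _ hz.2⟩
  · intro ξ
    rw [tendsto_map'_iff]
    exact tendsto_inflation_sub (hl.mono fun _ h => h.1) hid ξ

/-! ### Approximate units of projections in the stabilised crossed product -/

namespace CrossedProduct

open CStarEnvelope

variable {A G : Type*} [NonUnitalCStarAlgebra A] [Group G] (α : G →* (A ≃⋆ₐ[ℂ] A))

/-- The canonical ⋆-homomorphism from `A` to the full crossed product. -/
noncomputable def ι : A →⋆ₙₐ[ℂ] CrossedProduct α :=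
  (incl (AlgCrossedProduct α)).comp (AlgCrossedProduct.inclHom α)

/-- The element `a u_s` of the full crossed product. -/
noncomputable def single (s : G) : A →+ CrossedProduct α :=
  ((incl (AlgCrossedProduct α)) : AlgCrossedProduct α →+ CrossedProduct α).comp
    (AlgCrossedProduct.single α s)

theorem single_one (a : A) : single α 1 a = ι α a := rfl

theorem single_mul_single (s t : G) (a b : A) :
    single α s a * single α t b = single α (s * t) (a * α s b) := by
  simp only [single, AddMonoidHom.comp_apply]
  change incl _ _ * incl _ _ = incl _ _
  rw [← map_mul, AlgCrossedProduct.single_mul_single]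

theorem star_single (s : G) (a : A) : star (single α s a) = single α s⁻¹ (α s⁻¹ (star a)) := by
  change star (incl _ _) = incl _ _
  rw [← map_star, AlgCrossedProduct.star_single]

theorem ι_mul_single (s : G) (a b : A) : ι α a * single α s b = single α s (a * b) := by
  rw [← single_one, single_mul_single]; simp

theorem single_mul_ι (s : G) (a b : A) : single α s a * ι α b = single α s (a * α s b) := by
  rw [← single_one, single_mul_single]; simp

theorem norm_single_le (s : G) (a : A) : ‖single α s a‖ ≤ ‖a‖ := by
  have h : single α s a * star (single α s a) = ι α (a * star a) := by
    rw [star_single, single_mul_single, ← single_one, mul_inv_cancel, ← StarAlgEquiv.mul_apply,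
      ← map_mul]
    simp
  have h1 := CStarRing.norm_self_mul_star (x := single α s a)
  have h2 := NonUnitalStarAlgHom.norm_apply_le (ι α) (a * star a)
  rw [CStarRing.norm_self_mul_star] at h2
  rw [h] at h1
  rw [h1] at h2
  exact abs_le_of_sq_le_sq' (by simpa only [sq] using h2) (norm_nonneg _) |>.2

end CrossedProduct

namespace Stabilization

open CStarEnvelope

variable {A B : Type*} [NonUnitalCStarAlgebra A] [NonUnitalCStarAlgebra B]

/-- The elementary matrix `a ⊗ e_{ij}` in `A ⊗ 𝒦`. -/
noncomputable def single (i j : ℕ) : A →+ Stabilization A :=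
  ((incl (FinMatrix A)) : FinMatrix A →+ Stabilization A).comp (FinMatrix.single i j)

theorem single_mul_single (i j k : ℕ) (a b : A) :
    single i j a * single j k b = single i k (a * b) := by
  change incl _ _ * incl _ _ = incl _ _
  rw [← map_mul, FinMatrix.single_mul_single, if_pos rfl]

theorem star_single (i j : ℕ) (a : A) : star (single i j a) = single j i (star a) := by
  change star (incl _ _) = incl _ _
  rw [← map_star, FinMatrix.star_single]

theorem norm_single_le (i j : ℕ) (a : A) : ‖single i j a‖ ≤ ‖a‖ := by
  have h : star (single i j a) * single i j a = single j j (star a * a) := by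
    rw [star_single, single_mul_single]
  have h1 := CStarRing.norm_star_mul_self (x := single i j a)
  have h2 := NonUnitalStarAlgHom.norm_apply_le
    ((incl (FinMatrix A)).comp (FinMatrix.diagHom j)) (star a * a)
  change ‖single j j (star a * a)‖ ≤ _ at h2
  rw [CStarRing.norm_star_mul_self] at h2
  rw [h] at h1
  rw [h1] at h2
  exact abs_le_of_sq_le_sq' (by simpa only [sq] using h2) (norm_nonneg _) |>.2

/-- The ⋆-homomorphism `φ ⊗ id` between stabilisations. -/
noncomputable def map (φ : A →⋆ₙₐ[ℂ] B) : Stabilization A →⋆ₙₐ[ℂ] Stabilization B :=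
  CStarEnvelope.lift ((incl (FinMatrix B)).comp (FinMatrix.map φ))

@[simp]
theorem map_single (φ : A →⋆ₙₐ[ℂ] B) (i j : ℕ) (a : A) :
    map φ (single i j a) = single i j (φ a) := by
  change CStarEnvelope.lift _ (incl _ _) = incl _ _
  rw [lift_incl, NonUnitalStarAlgHom.comp_apply, FinMatrix.map_single]

end Stabilization

section ApproximateUnit

open CStarEnvelope

variable {A G : Type*} [NonUnitalCStarAlgebra A] [Group G] (α : G →* (A ≃⋆ₐ[ℂ] A))

/-- Left multiplication by the images of an approximate unit of projections of `A ⊗ 𝒦` tends to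
the identity on the elementary matrices with entries `a u_s`, because `a u_s` is a limit of
elements `(e a) u_s = e (a u_s)` with `e` in `A`. -/
theorem tendsto_map_ι_mul_single {l : Filter (Stabilization A)} (hl : l.IsApproximateUnit)
    (hp : ∀ᶠ p in l, IsStarProjection p) (i j : ℕ) (s : G) (a : A) :
    Tendsto (fun p => Stabilization.map (CrossedProduct.ι α) p *
      Stabilization.single i j (CrossedProduct.single α s a) -
      Stabilization.single i j (CrossedProduct.single α s a)) l (𝓝 0) := by
  let := CStarAlgebra.spectralOrder A
  have := CStarAlgebra.spectralOrderedRing A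
  refine tendsto_zero_of_dense (C := 2) (f := fun (p : Stabilization A) (a : A) =>
    Stabilization.map (CrossedProduct.ι α) p *
      Stabilization.single i j (CrossedProduct.single α s a) -
      Stabilization.single i j (CrossedProduct.single α s a))
    (s := {c | ∃ e b : A, c = e * b}) ?_ ?_ ?_ a
  · filter_upwards [hp] with p hp x y
    have h1 : ‖Stabilization.single i j (CrossedProduct.single α s (x - y))‖ ≤ ‖x - y‖ :=
      (Stabilization.norm_single_le _ _ _).trans (CrossedProduct.norm_single_le _ _ _)
    have h2 : ‖Stabilization.map (CrossedProduct.ι α) p‖ ≤ 1 :=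
      (NonUnitalStarAlgHom.norm_apply_le _ _).trans hp.norm_le
    rw [map_sub, map_sub] at h1
    generalize Stabilization.single i j (CrossedProduct.single α s x) = X at *
    generalize Stabilization.single i j (CrossedProduct.single α s y) = Y at *
    generalize Stabilization.map (CrossedProduct.ι α) p = Q at *
    have h3 : Q * X - X - (Q * Y - Y) = Q * (X - Y) - (X - Y) := by rw [mul_sub]; abel
    rw [h3]
    have h4 := norm_sub_le (Q * (X - Y)) (X - Y)
    have h5 := norm_mul_le Q (X - Y)
    nlinarith [norm_nonneg (X - Y), norm_nonneg (x - y)]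
  · intro c
    have hu := CStarAlgebra.increasingApproximateUnit A
    have := hu.neBot
    exact mem_closure_of_tendsto (hu.tendsto_mul_right c) (Eventually.of_forall fun e => ⟨e, c, rfl⟩)
  · rintro _ ⟨e, b, rfl⟩
    let x := Stabilization.single i j (CrossedProduct.single α s b)
    have h1 : Stabilization.single i j (CrossedProduct.single α s (e * b)) =
        Stabilization.map (CrossedProduct.ι α) (Stabilization.single i i e) * x := by
      rw [Stabilization.map_single, Stabilization.single_mul_single, CrossedProduct.ι_mul_single]
    rw [h1]
    have h2 : Tendsto (fun p => Stabilization.map (CrossedProduct.ι α)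
        (p * Stabilization.single i i e - Stabilization.single i i e) * x) l (𝓝 0) := by
      have h3 : Tendsto (fun p => p * Stabilization.single i i e - Stabilization.single i i e) l
          (𝓝 0) := by
        simpa using (hl.tendsto_mul_right (Stabilization.single i i e)).sub_const
          (Stabilization.single i i e)
      have h4 : Continuous fun y => Stabilization.map (CrossedProduct.ι α) y * x :=
        (continuous_starHom _).mul continuous_const
      have h5 := (h4.tendsto 0).comp h3
      rwa [map_zero, zero_mul] at h5
    refine h2.congr fun p => ?_
    rw [map_sub, map_mul, sub_mul, mul_assoc]

/-- If `A ⊗ 𝒦` has an approximate unit of projections, so does `(A ⋊ G) ⊗ 𝒦`. -/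
theorem HasProjectionApproxUnit.crossedProduct
    (h : HasProjectionApproxUnit (Stabilization A)) :
    HasProjectionApproxUnit (Stabilization (CrossedProduct α)) := by
  obtain ⟨l, hl, hp⟩ := h
  have := hl.neBot
  let j := Stabilization.map (CrossedProduct.ι α)
  have hj : ∀ᶠ p in l, IsStarProjection (j p) := hp.mono fun p hp => hp.map j
  have lip : ∀ᶠ p in l, ∀ x y : Stabilization (CrossedProduct α),
      ‖j p * x - x - (j p * y - y)‖ ≤ 2 * ‖x - y‖ := by
    filter_upwards [hj] with p hp x y
    have h1 : j p * x - x - (j p * y - y) = j p * (x - y) - (x - y) := by rw [mul_sub]; abel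
    rw [h1]
    have h2 := norm_sub_le (j p * (x - y)) (x - y)
    have h3 := norm_mul_le (j p) (x - y)
    have h4 := hp.norm_le
    nlinarith [norm_nonneg (x - y)]
  have left : ∀ x, Tendsto (fun p => j p * x - x) l (𝓝 0) := by
    refine tendsto_zero_of_dense (C := 2) (f := fun p x => j p * x - x) lip
      (denseRange_incl (FinMatrix (CrossedProduct α))) ?_
    rintro _ ⟨x, rfl⟩
    induction x using FinMatrix.induction_linear with
    | h0 => simp
    | hadd x y hx hy =>
      have := hx.add hy
      rw [add_zero] at this
      refine this.congr fun p => ?_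
      rw [map_add, mul_add]; abel
    | hs i k b =>
      change Tendsto (fun p => j p * Stabilization.single i k b - Stabilization.single i k b) l (𝓝 0)
      refine tendsto_zero_of_dense (C := 2)
        (f := fun p b => j p * Stabilization.single i k b - Stabilization.single i k b) ?_
        (denseRange_incl (AlgCrossedProduct α)) ?_ b
      · filter_upwards [lip] with p hp x y
        refine (hp _ _).trans (mul_le_mul_of_nonneg_left ?_ zero_le_two)
        rw [← map_sub]
        exact Stabilization.norm_single_le _ _ _
      · rintro _ ⟨f, rfl⟩
        induction f using AlgCrossedProduct.induction_linear with
        | h0 => simp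
        | hadd x y hx hy =>
          have := hx.add hy
          rw [add_zero] at this
          refine this.congr fun p => ?_
          rw [map_add, map_add, mul_add]; abel
        | hs s a => exact tendsto_map_ι_mul_single α hl hp i k s a
  have left' : ∀ x, Tendsto (fun p => j p * x) l (𝓝 x) := fun x => by
    simpa using (left x).add_const x
  refine ⟨l.map j, ⟨fun x => ?_, fun x => ?_⟩, by rwa [eventually_map]⟩
  · rw [tendsto_map'_iff]
    have h1 := (left' (star x)).star
    rw [star_star] at h1
    refine h1.congr' ?_
    filter_upwards [hj] with p hp
    rw [star_mul, star_star, hp.isSelfAdjoint.star_eq]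
    rfl
  · rw [tendsto_map'_iff]
    exact left' x

end ApproximateUnit

/-! ### The regular representation -/

namespace AlgCrossedProduct

variable {A G : Type*} [NonUnitalCStarAlgebra A] [Group G] (α : G →* (A ≃⋆ₐ[ℂ] A))

/-- A family of linear maps that satisfies the relations of the elements `a u_s` induces a
⋆-homomorphism on the algebraic crossed product. -/
noncomputable def lift {D : Type*} [NonUnitalRing D] [StarRing D] [Module ℂ D]
    (e : G → A →ₗ[ℂ] D)
    (hmul : ∀ s t a b, e s a * e t b = e (s * t) (a * α s b))
    (hstar : ∀ s a, star (e s a) = e s⁻¹ (α s⁻¹ (star a))) : AlgCrossedProduct α →⋆ₙₐ[ℂ] D :=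
  let F : AlgCrossedProduct α →+ D := Finsupp.liftAddHom fun s => (e s).toAddMonoidHom
  have hF : ∀ s a, F (single α s a) = e s a := fun s a =>
    Finsupp.liftAddHom_apply_single _ s a
  { toFun := F
    map_smul' := fun c x => by
      change F (c • x) = c • F x
      induction x using induction_linear with
      | h0 => simp
      | hadd x y hx hy => rw [smul_add, map_add, map_add, hx, hy, smul_add]
      | hs s a => rw [smul_single, hF, hF, map_smul]
    map_zero' := map_zero F
    map_add' := map_add F
    map_mul' := fun x y => by
      change F (x * y) = F x * F y
      induction x using induction_linear with
      | h0 => simp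
      | hadd x x' hx hx' => rw [add_mul, map_add, map_add, hx, hx', add_mul]
      | hs s a =>
        induction y using induction_linear with
        | h0 => simp
        | hadd y y' hy hy' => rw [mul_add, map_add, map_add, hy, hy', mul_add]
        | hs t b => rw [single_mul_single, hF, hF, hF, hmul]
    map_star' := fun x => by
      induction x using induction_linear with
      | h0 => simp
      | hadd x y hx hy => rw [star_add, map_add, map_add, hx, hy, star_add]
      | hs s a => rw [star_single, hF, hF, hstar] }

@[simp]
theorem lift_single {D : Type*} [NonUnitalRing D] [StarRing D] [Module ℂ D]
    (e : G → A →ₗ[ℂ] D) (hmul hstar) (s : G) (a : A) :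
    lift α e hmul hstar (single α s a) = e s a :=
  Finsupp.liftAddHom_apply_single _ s a

end AlgCrossedProduct

section RegularRepresentation

variable {G H : Type*} [Group G] [NormedAddCommGroup H] [InnerProductSpace ℂ H]

/-- Left translation by `s` on `ℓ²(G, H)`. -/
noncomputable def translation (s : G) :
    lp (fun _ : G => H) 2 →L[ℂ] lp (fun _ : G => H) 2 :=
  LinearMap.mkContinuous
    { toFun := fun ξ => ⟨fun t => ξ (s⁻¹ * t), memℓp_gen
        (((lp.memℓp ξ).summable (by norm_num)).comp_injective (mul_right_injective s⁻¹))⟩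
      map_add' := fun _ _ => rfl
      map_smul' := fun _ _ => rfl } 1 fun ξ => by
    refine lp.norm_le_of_tsum_le (by norm_num) (by positivity) ?_
    rw [one_mul, lp.norm_rpow_eq_tsum (by norm_num)]
    exact ((Equiv.mulLeft s⁻¹).tsum_eq fun t => ‖ξ t‖ ^ (2 : ENNReal).toReal).le

variable [CompleteSpace H] {A : Type*} [NonUnitalCStarAlgebra A] (α : G →* (A ≃⋆ₐ[ℂ] A))
  (π : A →⋆ₙₐ[ℂ] (H →L[ℂ] H))

/-- The operator on `ℓ²(G, H)` by which `a u_s` acts in the regular representation induced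
by `π`: `(a u_s ξ)(t) = π(α_{t⁻¹}(a)) ξ(s⁻¹ t)`. -/
noncomputable def regularOp (s : G) :
    A →ₗ[ℂ] (lp (fun _ : G => H) 2 →L[ℂ] lp (fun _ : G => H) 2) where
  toFun a := hilbertSumRep (fun t : G => π.comp (α t⁻¹ : A →⋆ₙₐ[ℂ] A)) a ∘L translation s
  map_add' a b := by ext; simp
  map_smul' c a := by ext; simp

theorem regularOp_apply (s : G) (a : A) (ξ : lp (fun _ : G => H) 2) (t : G) :
    regularOp α π s a ξ t = π (α t⁻¹ a) (ξ (s⁻¹ * t)) := rfl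

/-- The regular representation of the algebraic crossed product induced by `π`. -/
noncomputable def regularRep :
    AlgCrossedProduct α →⋆ₙₐ[ℂ] (lp (fun _ : G => H) 2 →L[ℂ] lp (fun _ : G => H) 2) :=
  AlgCrossedProduct.lift α (regularOp α π)
    (fun s t a b => by
      ext ξ r
      simp only [mul_apply_eq_comp, regularOp_apply, map_mul, mul_inv_rev, inv_inv, mul_assoc]
      rfl)
    (fun s a => by
      refine ((ContinuousLinearMap.eq_adjoint_iff _ _).2 fun ξ η => ?_).symm
      rw [lp.inner_eq_tsum, lp.inner_eq_tsum, ← (Equiv.mulLeft s⁻¹).tsum_eq]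
      refine tsum_congr fun t => ?_
      simp only [regularOp_apply, Equiv.coe_mulLeft, inv_inv, mul_inv_cancel_left, mul_inv_rev]
      rw [← ContinuousLinearMap.adjoint_inner_left, ← ContinuousLinearMap.star_eq_adjoint,
        ← map_star, ← map_star, ← StarAlgEquiv.mul_apply, ← map_mul,
        mul_inv_cancel_right])

/-- The algebra embeds in its full crossed product, since the regular representation induced by a
faithful representation is faithful on it. -/
theorem CrossedProduct.ι_injective : Function.Injective (CrossedProduct.ι α) := by
  refine (injective_iff_map_eq_zero _).2 fun a ha => ?_
  obtain ⟨H, _, _, _, π, hπ⟩ := exists_faithful_rep A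
  have h1 : regularRep α π (AlgCrossedProduct.single α 1 a) = 0 := by
    rw [← CStarEnvelope.lift_incl (regularRep α π)]
    exact (congrArg _ ha).trans (map_zero _)
  classical
  refine (map_eq_zero_iff π hπ).1 ?_
  ext η
  have h2 := congr($h1 (lp.single 2 (1 : G) η) 1)
  rw [regularRep, AlgCrossedProduct.lift_single, regularOp_apply] at h2
  simpa using h2

end RegularRepresentation

theorem Stabilization.incl_injective (B : Type*) [NonUnitalCStarAlgebra B] :
    Function.Injective (CStarEnvelope.incl (FinMatrix B)) := by
  obtain ⟨H, _, _, _, π, hπ⟩ := exists_faithful_rep B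
  refine Function.Injective.of_comp (f := CStarEnvelope.lift (finMatrixRep π)) fun x y h => ?_
  simp only [Function.comp_apply, CStarEnvelope.lift_incl] at h
  exact finMatrixRep_injective hπ h

/-! ### Polar decomposition and isometries over finite C⋆-algebras -/

section Polar

/-- If `star y * y` is close to `1`, it has an inverse square root, which is what the polar
decomposition of `y` needs. -/
theorem exists_inv_sqrt {C : Type*} [CStarAlgebra C] {y : C} (h : ‖star y * y - 1‖ < 1) :
    ∃ k : C, IsSelfAdjoint k ∧ k * (star y * y) * k = 1 ∧
      ∀ z, Commute (star y * y) z → Commute k z := by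
  let := CStarAlgebra.spectralOrder C
  have := CStarAlgebra.spectralOrderedRing C
  have hu : IsUnit (star y * y) := by
    have := isUnit_one_sub_of_norm_lt_one (x := 1 - star y * y) (by rwa [norm_sub_rev])
    simpa using this
  have hpos : IsStrictlyPositive (star y * y) :=
    IsStrictlyPositive.iff_of_unital.2 ⟨star_mul_self_nonneg y, hu⟩
  exact ⟨(star y * y) ^ (-(1 / 2) : ℝ), CFC.rpow_nonneg.isSelfAdjoint,
    CFC.conjugate_rpow_neg_one_half _, fun z hz => hz.cfc_nnreal _⟩

/-- Projections at distance less than `1` are Murray--von Neumann equivalent. -/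
theorem IsStarProjection.exists_partialIsometry_of_norm_sub_lt_one {C : Type*} [CStarAlgebra C]
    {p q : C} (hp : IsStarProjection p) (hq : IsStarProjection q) (h : ‖p - q‖ < 1) :
    ∃ v : C, star v * v = p ∧ v * star v = q := by
  have hpp : p * p = p := hp.isIdempotentElem
  have hps : star p = p := hp.isSelfAdjoint
  have hqq : q * q = q := hq.isIdempotentElem
  have hqs : star q = q := hq.isSelfAdjoint
  -- `y` intertwines `p` and `q`, and its unitary part conjugates `p` to `q`
  let y := q * p + (1 - q) * (1 - p)
  have hpq : ∀ z, p * (p * z) = p * z := fun z => by rw [← mul_assoc, hpp]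
  have hqp : ∀ z, q * (q * z) = q * z := fun z => by rw [← mul_assoc, hqq]
  have e1 : star y * y = 1 - (p - q) * (p - q) := by
    simp only [y, star_add, star_mul, star_sub, star_one, hps, hqs, mul_add, add_mul, mul_sub,
      sub_mul, mul_one, one_mul, mul_assoc, hpp, hqq, hqp]
    abel
  have e2 : y * star y = 1 - (p - q) * (p - q) := by
    simp only [y, star_add, star_mul, star_sub, star_one, hps, hqs, mul_add, add_mul, mul_sub,
      sub_mul, mul_one, one_mul, mul_assoc, hpp, hqq, hpq]
    abel
  have hyp : y * p = q * y := by
    simp only [y, mul_add, add_mul, mul_sub, sub_mul, mul_one, one_mul, mul_assoc, hpp, hqq, hqp]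
    abel
  have hcp : Commute (star y * y) p := by
    rw [e1]
    simp only [Commute, SemiconjBy, mul_sub, sub_mul, mul_one, one_mul, mul_assoc, hpp, hqq, hpq]
    abel
  have hcy : Commute (star y * y) y := by
    change star y * y * y = y * (star y * y)
    rw [← mul_assoc, e1, e2]
  obtain ⟨k, hk, hk1, hkc⟩ := exists_inv_sqrt (y := y) (by
    rw [e1, sub_sub_cancel_left, norm_neg]
    calc _ ≤ ‖p - q‖ * ‖p - q‖ := norm_mul_le _ _
      _ < 1 := by nlinarith [norm_nonneg (p - q)])
  have hkp := (hkc p hcp).eq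
  have hky := (hkc y hcy).eq
  have hks : star k = k := hk
  refine ⟨y * k * p, ?_, ?_⟩
  · calc star (y * k * p) * (y * k * p) = p * (k * (star y * y) * k) * p := by
          simp only [star_mul, hps, hks, mul_assoc]
      _ = p := by rw [hk1, mul_one, hpp]
  · have hkk : k * y * star y * k = 1 := by
      rw [mul_assoc k, e2, ← e1, hk1]
    calc y * k * p * star (y * k * p) = y * (k * p * p) * k * star y := by
          simp only [star_mul, hps, hks, mul_assoc]
      _ = q * (k * y * star y * k) := by
          rw [mul_assoc k, hpp, hkp, ← mul_assoc y, hyp, mul_assoc q, ← hky]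
          have h3 : k * star y = star y * k := by
            have := congr(star $hky)
            rwa [star_mul, star_mul, hks, eq_comm] at this
          simp only [mul_assoc, h3]
      _ = q := by rw [hkk, mul_one]

/-- An isometry of the form `1 + b` over a finite C⋆-algebra `C` is unitary. If `e` is a projection
of `C` that is almost a unit for `b`, the unitary part of `1 + e b e` restricts to a partial isometry
on `e`, so finiteness of `e` shows that the range of `1 + e b e` contains `e`. -/
theorem IsFiniteCStar.eq_zero_of_isometry {C : Type*} [NonUnitalCStarAlgebra C]
    (hC : IsFiniteCStar C) {b p : C} (h1 : star b + b + star b * b = 0)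
    (h2 : b + star b + b * star b = -p) : p = 0 := by
  obtain ⟨⟨l, hl, hproj⟩, hfin⟩ := hC
  have := hl.neBot
  let b' : Unitization ℂ C := b
  let p' : Unitization ℂ C := p
  let y : C → Unitization ℂ C := fun e => 1 + ((e * b * e : C) : Unitization ℂ C)
  have hw1 : star (1 + b') * (1 + b') = 1 := by
    have : star b' + b' + star b' * b' = 0 := by
      have := congr((($h1 : C) : Unitization ℂ C))
      simpa [b'] using this
    calc star (1 + b') * (1 + b') = 1 + (star b' + b' + star b' * b') := by
          simp only [star_add, star_one, add_mul, mul_add, one_mul, mul_one]; abel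
      _ = 1 := by rw [this, add_zero]
  have hw2 : (1 + b') * star (1 + b') = 1 - p' := by
    have : b' + star b' + b' * star b' = -p' := by
      have := congr((($h2 : C) : Unitization ℂ C))
      simpa [b', p'] using this
    calc (1 + b') * star (1 + b') = 1 + (b' + star b' + b' * star b') := by
          simp only [star_add, star_one, add_mul, mul_add, one_mul, mul_one]; abel
      _ = 1 - p' := by rw [this, sub_eq_add_neg]
  have hwp : star (1 + b') * p' = 0 := by
    have h3 : p' = 1 - (1 + b') * star (1 + b') := by rw [hw2, sub_sub_cancel]
    rw [h3, mul_sub, mul_one, ← mul_assoc, hw1, one_mul, sub_self]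
  have hy : Tendsto y l (𝓝 (1 + b')) := by
    have h3 : Tendsto (fun e => e * b * e) l (𝓝 b) := by
      have h4 : Tendsto (fun e => e * b * e - b * e) l (𝓝 0) := by
        have h5 : Tendsto (fun e => e * b - b) l (𝓝 0) := by
          simpa using (hl.tendsto_mul_right b).sub_const b
        refine squeeze_zero_norm' ?_ (tendsto_zero_iff_norm_tendsto_zero.1 h5)
        filter_upwards [hproj] with e he
        rw [← sub_mul]
        exact (norm_mul_le _ _).trans (mul_le_of_le_one_right (norm_nonneg _) he.norm_le)
      simpa using h4.add (hl.tendsto_mul_left b)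
    exact (((Unitization.isometry_inr (𝕜 := ℂ)).continuous.tendsto b).comp h3).const_add 1
  have hyy : Tendsto (fun e => ‖star (y e) * y e - 1‖) l (𝓝 0) := by
    have h3 := ((hy.star.mul hy).sub_const 1).norm
    rwa [hw1, sub_self, norm_zero] at h3
  have hyp : Tendsto (fun e => ‖star (y e) * p'‖) l (𝓝 0) := by
    have h3 := (hy.star.mul_const p').norm
    rwa [hwp, norm_zero] at h3
  have hep : Tendsto (fun e => ‖p - e * p‖) l (𝓝 0) := by
    simpa using ((hl.tendsto_mul_right p).const_sub p).norm
  have key : ∀ᶠ e in l, ‖p‖ ≤ ‖p - e * p‖ + 2 * ‖star (y e) * p'‖ := by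
    filter_upwards [hproj, hyy.eventually (gt_mem_nhds (show (0 : ℝ) < 1 / 2 by norm_num))]
      with e he hye
    have hee : e * e = e := he.isIdempotentElem
    have hes : star e = e := he.isSelfAdjoint
    obtain ⟨k, hk, hk1, hkc⟩ := exists_inv_sqrt (hye.trans (by norm_num))
    have hks : star k = k := hk
    let e' : Unitization ℂ C := e
    have hee' : e' * e' = e' := by simp only [e', ← Unitization.inr_mul, hee]
    have hes' : star e' = e' := by simp only [e', ← Unitization.inr_star, hes]
    have hye' : y e * e' = e' * y e := by
      simp only [y, e', mul_add, add_mul, mul_one, one_mul, ← Unitization.inr_mul]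
      rw [mul_assoc (e * b), hee, ← mul_assoc e (e * b), ← mul_assoc e e, hee]
    have hsye : star (y e) * e' = e' * star (y e) := by
      have := congr(star $hye')
      rwa [star_mul, star_mul, hes', eq_comm] at this
    have hke : k * e' = e' * k := (hkc e' (by
      change star (y e) * y e * e' = e' * (star (y e) * y e)
      rw [mul_assoc, hye', ← mul_assoc, hsye, mul_assoc])).eq
    -- the unitary part of `y e`, cut down by `e`, lies in the ideal `C` of the unitisation
    let v' : Unitization ℂ C := y e * k * e'
    have hv : ∃ v : C, (v : Unitization ℂ C) = v' := ⟨v'.snd, by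
      refine Unitization.ext ?_ rfl
      simp [v', e']⟩
    obtain ⟨v, hv⟩ := hv
    have hvv' : star v' * v' = e' := by
      calc star v' * v' = e' * (k * (star (y e) * y e) * k) * e' := by
            simp only [v', star_mul, hes', hks, mul_assoc]
        _ = e' := by rw [hk1, mul_one, hee']
    have hvv : star v * v = e := by
      refine Unitization.inr_injective (R := ℂ) ?_
      rw [Unitization.inr_mul, Unitization.inr_star, hv, hvv']
    have hev' : e' * v' = v' := by
      simp only [v']
      rw [mul_assoc, hke, ← mul_assoc, ← mul_assoc, ← hye', mul_assoc (y e), mul_assoc (y e),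
        hee']
    have hev : e * v = v := by
      refine Unitization.inr_injective (R := ℂ) ?_
      rw [Unitization.inr_mul, hv, hev']
    have hve : v * e = v := by
      refine Unitization.inr_injective (R := ℂ) ?_
      rw [Unitization.inr_mul, hv]
      simp only [v', mul_assoc]
      rw [hee']
    have hq : v * star v = e := by
      by_contra hne
      refine hfin e he ⟨he, v * star v, ⟨?_, IsSelfAdjoint.mul_star_self v⟩, ?_, hne, v, hvv, rfl⟩
      · change v * star v * (v * star v) = v * star v
        rw [mul_assoc, ← mul_assoc (star v), hvv, ← mul_assoc, hve]
      · rw [← mul_assoc, hev]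
    have hq' : v' * star v' = e' := by
      rw [← hv, ← Unitization.inr_star, ← Unitization.inr_mul, hq]
    have hkk : ‖k‖ * ‖k‖ ≤ 2 := by
      rw [← CStarRing.norm_star_mul_self, hks]
      have h3 : k * k = 1 - (star (y e) * y e - 1) * (k * k) := by
        have h4 : k * (star (y e) * y e) = star (y e) * y e * k :=
          (hkc _ (Commute.refl _)).eq
        have h5 : star (y e) * y e * (k * k) = 1 := by rw [← mul_assoc, ← h4, hk1]
        rw [sub_mul, h5, one_mul, sub_sub_cancel]
      have h4 : ‖k * k‖ ≤ 1 + 1 / 2 * ‖k * k‖ := by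
        conv_lhs => rw [h3]
        refine (norm_sub_le _ _).trans (add_le_add (by simp) ((norm_mul_le _ _).trans ?_))
        gcongr
      linarith
    have hyk : ‖y e * k‖ ≤ 1 := by
      have h3 := CStarRing.norm_star_mul_self (x := y e * k)
      rw [star_mul, hks, mul_assoc, ← mul_assoc (star (y e)), ← mul_assoc, hk1, norm_one] at h3
      nlinarith [norm_nonneg (y e * k)]
    have hk2 : ‖k‖ ≤ 2 := by nlinarith [norm_nonneg k]
    have hep' : ((e * p : C) : Unitization ℂ C) = e' * (y e * k) * (k * (star (y e) * p')) := by
      rw [Unitization.inr_mul]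
      change e' * p' = _
      calc e' * p' = v' * star v' * p' := by rw [hq']
        _ = y e * k * (e' * e') * k * star (y e) * p' := by
            simp only [v', star_mul, hes', hks, mul_assoc]
        _ = e' * (y e * k) * (k * (star (y e) * p')) := by
            rw [hee', mul_assoc (y e), hke, ← mul_assoc (y e), hye']
            simp only [mul_assoc]
    have he1 : ‖e'‖ ≤ 1 := by rw [Unitization.norm_inr]; exact he.norm_le
    calc ‖p‖ = ‖(p - e * p) + e * p‖ := by rw [sub_add_cancel]
      _ ≤ ‖p - e * p‖ + ‖e * p‖ := norm_add_le _ _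
      _ ≤ ‖p - e * p‖ + 2 * ‖star (y e) * p'‖ := by
          gcongr
          rw [← Unitization.norm_inr (𝕜 := ℂ) (e * p), hep']
          calc _ ≤ ‖e'‖ * ‖y e * k‖ * (‖k‖ * ‖star (y e) * p'‖) :=
                (norm_mul_le _ _).trans (mul_le_mul (norm_mul_le _ _) (norm_mul_le _ _)
                  (norm_nonneg _) (by positivity))
            _ ≤ 1 * 1 * (2 * ‖star (y e) * p'‖) := by gcongr
            _ = _ := by ring
  have hlim := hep.add (hyp.const_mul 2)
  rw [mul_zero, add_zero] at hlim
  exact norm_le_zero_iff.1 (ge_of_tendsto hlim key)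

end Polar

open Matrix

/-! ### Rotation matrices -/

section RotationUnitary

variable {A G : Type*} [NonUnitalCStarAlgebra A] [Group G] (α : G →* (A ≃⋆ₐ[ℂ] A))

/-- For a positive contraction `e`, the element `(1 - e²)^{1/2}` of the unitisation. -/
theorem exists_sqrt_one_sub [PartialOrder A] [StarOrderedRing A] {e : A} (he0 : 0 ≤ e)
    (he1 : ‖e‖ ≤ 1) :
    ∃ s : Unitization ℂ A, star s = s ∧ s * s = 1 - (e : Unitization ℂ A) * e ∧
      s * e = e * s := by
  have hes : star e = e := he0.isSelfAdjoint
  have h0 : 0 ≤ 1 - (e : Unitization ℂ A) * e := by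
    rw [sub_nonneg]
    have h1 : 0 ≤ (e : Unitization ℂ A) * e := by
      have := star_mul_self_nonneg (e : Unitization ℂ A)
      rwa [← Unitization.inr_star, hes] at this
    refine (CStarAlgebra.norm_le_one_iff_of_nonneg _ h1).1 ?_
    refine (norm_mul_le _ _).trans ?_
    rw [Unitization.norm_inr]
    nlinarith [norm_nonneg e]
  refine ⟨CFC.sqrt (1 - (e : Unitization ℂ A) * e), (CFC.sqrt_nonneg _).isSelfAdjoint,
    CFC.sqrt_mul_sqrt_self _ h0, ?_⟩
  have hc : Commute (1 - (e : Unitization ℂ A) * e) e :=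
    (Commute.one_left _).sub_left ((Commute.refl _).mul_left (Commute.refl _))
  exact (hc.cfcₙ_nnreal _).eq

/-- The unital extension `Ã → (A ⋊ G)~` of the canonical map. -/
noncomputable abbrev ιt : Unitization ℂ A →⋆ₐ[ℂ] Unitization ℂ (CrossedProduct α) :=
  Unitization.starMap (CrossedProduct.ι α)

/-- The unital extension of the automorphism `α g` to `Ã`. -/
noncomputable abbrev actt (g : G) : Unitization ℂ A →⋆ₐ[ℂ] Unitization ℂ A :=
  Unitization.starMap (α g : A →⋆ₙₐ[ℂ] A)

/-- The element `α_g(e) u_g = u_g e`, in the unitisation of the crossed product. -/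
noncomputable def twist (g : G) (e : A) : Unitization ℂ (CrossedProduct α) :=
  (CrossedProduct.single α g (α g e) : CrossedProduct α)

variable {α} (g : G) {e : A}

theorem ιt_inr (a : A) : ιt α a = (CrossedProduct.ι α a : Unitization ℂ (CrossedProduct α)) := by
  simp [ιt]

theorem actt_inr (a : A) : actt α g a = (α g a : A) := by
  simp [actt]

theorem norm_twist_le (he1 : ‖e‖ ≤ 1) : ‖twist α g e‖ ≤ 1 := by
  rw [twist, Unitization.norm_inr]
  exact (CrossedProduct.norm_single_le _ _ _).trans
    ((NonUnitalStarAlgHom.norm_apply_le (α g) e).trans he1)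

theorem star_twist (he : star e = e) :
    star (twist α g e) = (CrossedProduct.single α g⁻¹ e : CrossedProduct α) := by
  rw [twist, ← Unitization.inr_star, CrossedProduct.star_single, ← map_star, he,
    ← StarAlgEquiv.mul_apply, ← map_mul]
  simp

theorem star_twist_mul_twist (he : star e = e) :
    star (twist α g e) * twist α g e = ιt α (e * e) := by
  rw [star_twist g he, twist, ← Unitization.inr_mul, CrossedProduct.single_mul_single,
    ← StarAlgEquiv.mul_apply, ← map_mul, ← Unitization.inr_mul, ιt_inr, inv_mul_cancel,
    CrossedProduct.single_one]
  simp

theorem twist_mul_ιt_inr_mul_star_twist (he : star e = e) (b : A) :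
    twist α g e * ιt α b * star (twist α g e) = ιt α (actt α g ((e * b * e : A))) := by
  rw [star_twist g he, twist, ιt_inr, ← Unitization.inr_mul, ← Unitization.inr_mul,
    CrossedProduct.single_mul_ι, CrossedProduct.single_mul_single, mul_inv_cancel,
    CrossedProduct.single_one, actt_inr, ιt_inr]
  simp only [map_mul]

theorem twist_mul_star_twist (he : star e = e) :
    twist α g e * star (twist α g e) = ιt α (actt α g (e * e)) := by
  rw [star_twist g he, twist, ← Unitization.inr_mul,
    CrossedProduct.single_mul_single, mul_inv_cancel,
    CrossedProduct.single_one, ← Unitization.inr_mul, actt_inr, ιt_inr]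
  simp only [map_mul]

theorem twist_mul_ιt {c : Unitization ℂ A} (hc : c * e = e * c) :
    twist α g e * ιt α c = ιt α (actt α g c) * twist α g e := by
  induction c using Unitization.ind with
  | inl_add_inr z a =>
    have h1 : a * e = e * a := by
      refine Unitization.inr_injective (R := ℂ) ?_
      simpa [add_mul, mul_add, Unitization.inl_mul_inr, Unitization.inr_mul_inl] using hc
    have h2 : ∀ f : Unitization ℂ A →⋆ₐ[ℂ] Unitization ℂ A,
        f (Unitization.inl z) = Unitization.inl z := fun f => f.commutes z
    have h3 : ∀ f : Unitization ℂ A →⋆ₐ[ℂ] Unitization ℂ (CrossedProduct α),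
        f (Unitization.inl z) = Unitization.inl z := fun f => f.commutes z
    rw [map_add, map_add, map_add, h2, h3, mul_add, add_mul, actt_inr, ιt_inr, ιt_inr, twist,
      Unitization.inl_mul_inr, Unitization.inr_mul_inl, ← Unitization.inr_mul,
      ← Unitization.inr_mul, CrossedProduct.single_mul_ι, CrossedProduct.ι_mul_single, ← map_mul,
      ← map_mul, h1]

end RotationUnitary

section RotationMatrix

/-- The matrix `[[x, -t], [s, x⋆]]`, with `n × n` scalar blocks. -/
def rotationMatrix {R : Type*} [Ring R] [StarRing R] (n : ℕ) (x s t : R) :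
    Matrix (Fin n ⊕ Fin n) (Fin n ⊕ Fin n) R :=
  fromBlocks (diagonal fun _ => x) (-diagonal fun _ => t) (diagonal fun _ => s)
    (diagonal fun _ => star x)

variable {R : Type*} [Ring R] [StarRing R] {n : ℕ} {x s t : R}

theorem conjTranspose_rotationMatrix (hs : star s = s) (ht : star t = t) :
    (rotationMatrix n x s t)ᴴ =
      fromBlocks (diagonal fun _ => star x) (diagonal fun _ => s) (-diagonal fun _ => t)
        (diagonal fun _ => x) := by
  have h : ∀ r : R, (diagonal fun _ : Fin n => r)ᴴ = diagonal fun _ => star r := fun r => by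
    rw [diagonal_conjTranspose]; rfl
  rw [rotationMatrix, fromBlocks_conjTranspose, conjTranspose_neg, h, h, h, h, hs, ht, star_star]

theorem rotationMatrix_mul_conjTranspose (hs : star s = s) (ht : star t = t)
    (h1 : x * star x + t * t = 1) (h2 : star x * x + s * s = 1) (h3 : x * s = t * x) :
    rotationMatrix n x s t * (rotationMatrix n x s t)ᴴ = 1 := by
  have h4 : s * star x = star x * t := by
    have := congr(star $h3)
    rwa [star_mul, star_mul, hs, ht] at this
  rw [conjTranspose_rotationMatrix hs ht, rotationMatrix, fromBlocks_multiply]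
  simp only [neg_mul, mul_neg, diagonal_mul_diagonal, neg_neg, h3, h4, diagonal_add, h1,
    add_neg_cancel, add_comm (s * s), h2, ← fromBlocks_one]
  rfl

theorem conjTranspose_rotationMatrix_mul (hs : star s = s) (ht : star t = t)
    (h1 : x * star x + t * t = 1) (h2 : star x * x + s * s = 1) (h3 : x * s = t * x) :
    (rotationMatrix n x s t)ᴴ * rotationMatrix n x s t = 1 := by
  have h4 : s * star x = star x * t := by
    have := congr(star $h3)
    rwa [star_mul, star_mul, hs, ht] at this
  rw [conjTranspose_rotationMatrix hs ht, rotationMatrix, fromBlocks_multiply]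
  simp only [neg_mul, mul_neg, diagonal_mul_diagonal, neg_neg, h3, h4, diagonal_add, h2,
    neg_add_cancel, add_comm (t * t), h1, ← fromBlocks_one]
  rfl

/-- Conjugation by the rotation matrix fixes `diag(q, q)` for a central scalar matrix `q`, and on
the remainder `b` it is given by the first column. -/
theorem rotationMatrix_conj (hs : star s = s) (ht : star t = t)
    (h1 : x * star x + t * t = 1) (h2 : star x * x + s * s = 1) (h3 : x * s = t * x)
    {q b : Matrix (Fin n) (Fin n) R} (hq : ∀ i j r, q i j * r = r * q i j) :
    rotationMatrix n x s t * fromBlocks (q + b) 0 0 q * (rotationMatrix n x s t)ᴴ =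
      fromBlocks q 0 0 q + fromBlocks (of fun i j => x * b i j * star x)
        (of fun i j => x * b i j * s) (of fun i j => s * b i j * star x)
        (of fun i j => s * b i j * s) := by
  have hcomm : ∀ r, (diagonal fun _ => r) * q = q * diagonal fun _ => r := fun r => by
    ext i j
    rw [diagonal_mul, mul_diagonal, hq]
  have hZ : rotationMatrix n x s t * fromBlocks q 0 0 q =
      fromBlocks q 0 0 q * rotationMatrix n x s t := by
    rw [rotationMatrix, fromBlocks_multiply, fromBlocks_multiply]
    simp [hcomm]
  have hsplit : fromBlocks (q + b) 0 0 q = fromBlocks q 0 0 q + fromBlocks b 0 0 0 := by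
    rw [fromBlocks_add]; simp
  rw [hsplit, mul_add, add_mul, hZ, mul_assoc, rotationMatrix_mul_conjTranspose hs ht h1 h2 h3,
    mul_one]
  congr 1
  rw [conjTranspose_rotationMatrix hs ht, rotationMatrix, fromBlocks_multiply, fromBlocks_multiply]
  congr 1 <;> ext i j <;> simp [mul_diagonal, diagonal_mul]

end RotationMatrix

/-- If projections converge entrywise, they are eventually equivalent to their limit. -/
theorem eventually_mvnEquiv_of_tendsto {R X m : Type*} [CStarAlgebra R] [Fintype m]
    [DecidableEq m] {l : Filter X} {P : X → Matrix m m R} {Q : Matrix m m R}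
    (hP : ∀ᶠ x in l, IsStarProjection (P x)) (hQ : IsStarProjection Q)
    (h : ∀ i j, Tendsto (fun x => P x i j) l (𝓝 (Q i j))) :
    ∀ᶠ x in l, MvNEquiv (P x) Q := by
  let := CStarAlgebra.spectralOrder R
  have := CStarAlgebra.spectralOrderedRing R
  have h1 : Tendsto (fun x => CStarMatrix.ofMatrix (P x)) l (𝓝 (CStarMatrix.ofMatrix Q)) :=
    tendsto_pi_nhds.2 fun i => tendsto_pi_nhds.2 fun j => h i j
  filter_upwards [hP, Metric.tendsto_nhds.1 h1 1 one_pos] with x hx hdist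
  rw [dist_eq_norm] at hdist
  have hx' : IsStarProjection (CStarMatrix.ofMatrix (P x)) := ⟨hx.isIdempotentElem, hx.isSelfAdjoint⟩
  have hQ' : IsStarProjection (CStarMatrix.ofMatrix Q) := ⟨hQ.isIdempotentElem, hQ.isSelfAdjoint⟩
  obtain ⟨v, hv, hv'⟩ := hx'.exists_partialIsometry_of_norm_sub_lt_one hQ' hdist
  exact ⟨v, hv, hv'⟩

/-! ### The action becomes trivial on the K-theory of the crossed product -/

/-- As `e` runs through an approximate unit, `(1 - e²)^{1/2}` tends strictly to `0`. -/
theorem tendsto_norm_sqrt_mul {A : Type*} [NonUnitalCStarAlgebra A] [PartialOrder A]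
    {l : Filter A} (hl : l.IsIncreasingApproximateUnit) {s : A → Unitization ℂ A}
    (hs : ∀ᶠ e in l, star (s e) = s e ∧ s e * s e = 1 - (e : Unitization ℂ A) * e) (b : A) :
    Tendsto (fun e => ‖s e * b‖) l (𝓝 0) := by
  have h1 : Tendsto (fun e => ‖b‖ * (2 * ‖e * b - b‖)) l (𝓝 0) := by
    have := ((((hl.tendsto_mul_right b).sub_const b).norm).const_mul 2).const_mul ‖b‖
    simpa using this
  have h2 : Tendsto (fun e => ‖s e * b‖ ^ 2) l (𝓝 0) := by
    refine squeeze_zero' (Eventually.of_forall fun e => by positivity) ?_ h1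
    filter_upwards [hs, hl.eventually_norm] with e he he1
    have h3 : star (s e * b) * (s e * b) = ((star b * (b - e * (e * b)) : A) : Unitization ℂ A) := by
      rw [star_mul, he.1, mul_assoc, ← mul_assoc (s e), he.2, sub_mul, one_mul, mul_assoc,
        ← Unitization.inr_star]
      simp only [← Unitization.inr_mul, ← Unitization.inr_sub]
    rw [sq, ← CStarRing.norm_star_mul_self, h3, Unitization.norm_inr]
    refine (norm_mul_le _ _).trans ?_
    rw [norm_star]
    gcongr
    have h4 : b - e * (e * b) = -(e * b - b) - e * (e * b - b) := by rw [mul_sub]; abel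
    rw [h4]
    refine (norm_sub_le _ _).trans ?_
    rw [norm_neg]
    have h5 := norm_mul_le e (e * b - b)
    nlinarith [norm_nonneg (e * b - b)]
  have h3 := h2.sqrt
  simpa using h3

/-- Let `Z` be the rotation matrices of a net of triples `(x, s, t)`. If `s b` and `b s` tend to zero
and `x b x⋆` tends to `b'`, then `Z diag(q + b, q) Z⋆` tends to `diag(q + b', q)`, so that these
projections are equivalent. -/
theorem mvnEquiv_of_tendsto_rotation {R X : Type*} [CStarAlgebra R] {n : ℕ} {l : Filter X}
    [l.NeBot] {x s t : X → R} {q b b' : Matrix (Fin n) (Fin n) R}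
    (hq : ∀ i j r, q i j * r = r * q i j) (hqp : IsStarProjection q)
    (hb : IsStarProjection (q + b)) (hb' : IsStarProjection (q + b'))
    (hrel : ∀ᶠ e in l, star (s e) = s e ∧ star (t e) = t e ∧
      x e * star (x e) + t e * t e = 1 ∧ star (x e) * x e + s e * s e = 1 ∧
      x e * s e = t e * x e)
    (h1 : ∀ i j, Tendsto (fun e => x e * b i j * star (x e)) l (𝓝 (b' i j)))
    (h2 : ∀ i j, Tendsto (fun e => x e * b i j * s e) l (𝓝 0))
    (h3 : ∀ i j, Tendsto (fun e => s e * b i j * star (x e)) l (𝓝 0))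
    (h4 : ∀ i j, Tendsto (fun e => s e * b i j * s e) l (𝓝 0)) :
    MvNEquiv (fromBlocks (q + b) 0 0 q) (fromBlocks (q + b') 0 0 q) := by
  have hD : IsStarProjection (fromBlocks (q + b) 0 0 q) := hb.fromBlocks hqp
  have hD' : IsStarProjection (fromBlocks (q + b') 0 0 q) := hb'.fromBlocks hqp
  let Z : X → Matrix (Fin n ⊕ Fin n) (Fin n ⊕ Fin n) R := fun e =>
    rotationMatrix n (x e) (s e) (t e)
  have hunit : ∀ᶠ e in l, (Z e)ᴴ * Z e = 1 := by
    filter_upwards [hrel] with e ⟨h1, h2, h3, h4, h5⟩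
    exact conjTranspose_rotationMatrix_mul h1 h2 h3 h4 h5
  have hlim : ∀ i j, Tendsto (fun e => (Z e * fromBlocks (q + b) 0 0 q * (Z e)ᴴ) i j) l
      (𝓝 (fromBlocks (q + b') 0 0 q i j)) := by
    intro i j
    have hform : ∀ᶠ e in l, fromBlocks q 0 0 q i j + fromBlocks
        (of fun i j => x e * b i j * star (x e)) (of fun i j => x e * b i j * s e)
        (of fun i j => s e * b i j * star (x e)) (of fun i j => s e * b i j * s e) i j =
        (Z e * fromBlocks (q + b) 0 0 q * (Z e)ᴴ) i j := by
      filter_upwards [hrel] with e ⟨h1, h2, h3, h4, h5⟩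
      rw [rotationMatrix_conj h1 h2 h3 h4 h5 hq]
      rfl
    refine Tendsto.congr' hform ?_
    have htarget : fromBlocks (q + b') 0 0 q i j =
        fromBlocks q 0 0 q i j + fromBlocks b' 0 0 (0 : Matrix (Fin n) (Fin n) R) i j := by
      rw [← Matrix.add_apply, fromBlocks_add]; simp
    rw [htarget]
    refine Tendsto.const_add _ ?_
    rcases i with i | i <;> rcases j with j | j
    · exact h1 i j
    · exact h2 i j
    · exact h3 i j
    · exact h4 i j
  generalize fromBlocks (q + b) 0 0 q = D at hD hlim ⊢
  have hDD : D * D = D := hD.isIdempotentElem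
  have hDs : Dᴴ = D := hD.isSelfAdjoint
  have hproj : ∀ᶠ e in l, IsStarProjection (Z e * D * (Z e)ᴴ) := by
    filter_upwards [hunit] with e he
    refine ⟨?_, ?_⟩
    · change Z e * D * (Z e)ᴴ * (Z e * D * (Z e)ᴴ) = Z e * D * (Z e)ᴴ
      calc _ = Z e * D * ((Z e)ᴴ * Z e) * D * (Z e)ᴴ := by simp only [mul_assoc]
        _ = Z e * D * (Z e)ᴴ := by rw [he, mul_one, mul_assoc (Z e), hDD]
    · change (Z e * D * (Z e)ᴴ)ᴴ = Z e * D * (Z e)ᴴ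
      simp only [conjTranspose_mul, conjTranspose_conjTranspose, hDs, mul_assoc]
  have hconj : ∀ᶠ e in l, MvNEquiv D (Z e * D * (Z e)ᴴ) := by
    filter_upwards [hunit] with e he
    refine ⟨Z e * D, ?_, ?_⟩
    · rw [conjTranspose_mul, hDs, mul_assoc, ← mul_assoc (Z e)ᴴ, he, one_mul, hDD]
    · rw [conjTranspose_mul, hDs, ← mul_assoc, mul_assoc (Z e), hDD]
  obtain ⟨e, h1, h2⟩ :=
    (hconj.and (eventually_mvnEquiv_of_tendsto hproj hD' hlim)).exists
  exact h1.trans hD hD' h2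

section TrivialAction

variable {A G : Type*} [NonUnitalCStarAlgebra A] [Group G] (α : G →* (A ≃⋆ₐ[ℂ] A))

/-- The scalar part of a matrix over a unitisation, as a matrix over the unitisation of the
crossed product. -/
noncomputable def scalarPart {n : ℕ} (P : Matrix (Fin n) (Fin n) (Unitization ℂ A)) :
    Matrix (Fin n) (Fin n) (Unitization ℂ (CrossedProduct α)) :=
  P.map fun a => Unitization.inl a.fst

theorem isStarProjection_scalarPart {n : ℕ} {P : Matrix (Fin n) (Fin n) (Unitization ℂ A)}
    (hP : IsStarProjection P) : IsStarProjection (scalarPart α P) := by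
  let φ : Unitization ℂ A →⋆ₙₐ[ℂ] Unitization ℂ (CrossedProduct α) :=
    ((StarAlgHom.ofId ℂ (Unitization ℂ (CrossedProduct α)) :
      ℂ →⋆ₐ[ℂ] Unitization ℂ (CrossedProduct α)) :
      ℂ →⋆ₙₐ[ℂ] Unitization ℂ (CrossedProduct α)).comp (unitizationFst A)
  exact (MatrixProjection.map φ ⟨n, P, hP⟩).isStarProjection

theorem isStarProjection_map {R S : Type*} [NonUnitalRing R] [StarRing R] [NonUnitalRing S]
    [StarRing S] [Module ℂ R] [Module ℂ S] (φ : R →⋆ₙₐ[ℂ] S) {n : ℕ}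
    {P : Matrix (Fin n) (Fin n) R} (hP : IsStarProjection P) : IsStarProjection (P.map φ) :=
  (MatrixProjection.map φ ⟨n, P, hP⟩).isStarProjection

/-- The automorphism `α g` does not change the class of a projection `P` over `Ã` in the crossed
product, up to adding the scalar part `q` of `P`. The unitary matrices `Z` built from
`u_g e` and `(1 - e²)^{1/2}`, for `e` in an approximate unit of `A`, have entries in the
unitisation, and they conjugate `diag(P, q)` to matrices that converge to `diag(α_g(P), q)`. -/
theorem mvnEquiv_fromBlocks_scalarPart (g : G) {n : ℕ}
    {P : Matrix (Fin n) (Fin n) (Unitization ℂ A)} (hP : IsStarProjection P) :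
    MvNEquiv (fromBlocks (P.map (ιt α)) 0 0 (scalarPart α P))
      (fromBlocks ((P.map (actt α g)).map (ιt α)) 0 0 (scalarPart α P)) := by
  let := CStarAlgebra.spectralOrder A
  have := CStarAlgebra.spectralOrderedRing A
  have hl := CStarAlgebra.increasingApproximateUnit A
  have := hl.neBot
  set l := CStarAlgebra.approximateUnit A
  choose s hs using fun e : A => show ∃ s : Unitization ℂ A, (0 ≤ e ∧ ‖e‖ ≤ 1) →
      star s = s ∧ s * s = 1 - (e : Unitization ℂ A) * e ∧ s * e = e * s by
    by_cases h : 0 ≤ e ∧ ‖e‖ ≤ 1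
    · obtain ⟨s, hs⟩ := exists_sqrt_one_sub h.1 h.2
      exact ⟨s, fun _ => hs⟩
    · exact ⟨0, fun h' => absurd h' h⟩
  have hgood : ∀ᶠ e in l, 0 ≤ e ∧ ‖e‖ ≤ 1 := hl.eventually_nonneg.and hl.eventually_norm
  let q := scalarPart α P
  let b : Matrix (Fin n) (Fin n) A := P.map fun a => a.snd
  have hP1 : IsStarProjection (P.map (ιt α)) := isStarProjection_map
      (ιt α : Unitization ℂ A →⋆ₙₐ[ℂ] Unitization ℂ (CrossedProduct α)) hP
  have hP2 : IsStarProjection ((P.map (actt α g)).map (ιt α)) :=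
    isStarProjection_map
      (ιt α : Unitization ℂ A →⋆ₙₐ[ℂ] Unitization ℂ (CrossedProduct α))
      (isStarProjection_map (actt α g : Unitization ℂ A →⋆ₙₐ[ℂ] Unitization ℂ A) hP)
  have hsplit : P.map (ιt α) = q + b.map fun a => ιt α a := by
    ext1 i j
    rw [Matrix.add_apply, Matrix.map_apply, Matrix.map_apply]
    conv_lhs => rw [← Unitization.inl_fst_add_inr_snd_eq (P i j), map_add]
    congr 1
    exact (ιt α).commutes _
  have hsplit' : (P.map (actt α g)).map (ιt α) = q + b.map fun a => ιt α (actt α g a) := by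
    ext1 i j
    rw [Matrix.add_apply, Matrix.map_apply, Matrix.map_apply, Matrix.map_apply]
    conv_lhs => rw [← Unitization.inl_fst_add_inr_snd_eq (P i j), map_add, map_add]
    congr 1
    exact ((ιt α).comp (actt α g)).commutes _
  have hrel : ∀ᶠ e in l, star e = e ∧ star (ιt α (s e)) = ιt α (s e) ∧
      star (ιt α (actt α g (s e))) = ιt α (actt α g (s e)) ∧
      twist α g e * star (twist α g e) + ιt α (actt α g (s e)) * ιt α (actt α g (s e)) = 1 ∧
      star (twist α g e) * twist α g e + ιt α (s e) * ιt α (s e) = 1 ∧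
      twist α g e * ιt α (s e) = ιt α (actt α g (s e)) * twist α g e := by
    filter_upwards [hgood] with e he
    obtain ⟨h1, h2, h3⟩ := hs e he
    have hes : star e = e := he.1.isSelfAdjoint
    refine ⟨hes, by rw [← map_star, h1], by rw [← map_star, ← map_star, h1], ?_, ?_,
      twist_mul_ιt g h3⟩
    · rw [twist_mul_star_twist g hes, ← map_mul, ← map_mul, ← map_add, ← map_add, h2,
        add_sub_cancel, map_one, map_one]
    · rw [star_twist_mul_twist g hes, ← map_mul, ← map_add, h2, add_sub_cancel, map_one]
  -- norm estimates for the four blocks of the remainder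
  have hsmall := tendsto_norm_sqrt_mul hl (s := s)
    (hgood.mono fun e he => ⟨(hs e he).1, (hs e he).2.1⟩)
  have hι : ∀ c : Unitization ℂ A, ‖ιt α c‖ ≤ ‖c‖ := fun c =>
    NonUnitalStarAlgHom.norm_apply_le (ιt α) c
  have hsb : ∀ a : A, Tendsto (fun e => ‖ιt α (s e) * ιt α a‖) l (𝓝 0) := fun a => by
    refine squeeze_zero (fun e => norm_nonneg _) (fun e => ?_) (hsmall a)
    rw [← map_mul]; exact hι _
  have hbs : ∀ a : A, Tendsto (fun e => ‖ιt α a * ιt α (s e)‖) l (𝓝 0) := fun a => by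
    refine (hsb (star a)).congr' ?_
    filter_upwards [hrel] with e ⟨_, h1, _⟩
    rw [← norm_star, star_mul, h1, ← map_star, ← Unitization.inr_star, star_star]
  have hblock1 : ∀ a : A, Tendsto (fun e => twist α g e * ιt α a * star (twist α g e)) l
      (𝓝 (ιt α (actt α g a))) := fun a => by
    have h1 : Tendsto (fun e => e * a * e) l (𝓝 a) := by
      have h2 : Tendsto (fun e => (e * a - a) * e) l (𝓝 0) := by
        have h3 : Tendsto (fun e => ‖e * a - a‖) l (𝓝 0) := by
          simpa using ((hl.tendsto_mul_right a).sub_const a).norm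
        refine squeeze_zero_norm' ?_ h3
        filter_upwards [hl.eventually_norm] with e he
        exact (norm_mul_le _ _).trans (mul_le_of_le_one_right (norm_nonneg _) he)
      simpa [sub_mul] using h2.add (hl.tendsto_mul_left a)
    have hcont : Continuous fun a : A => ιt α (actt α g a) := by
      simp only [actt_inr, ιt_inr]
      exact (Unitization.isometry_inr (𝕜 := ℂ)).continuous.comp
        ((continuous_starHom (CrossedProduct.ι α)).comp
          (continuous_starHom (α g : A →⋆ₙₐ[ℂ] A)))
    refine ((hcont.tendsto a).comp h1).congr' ?_
    filter_upwards [hrel] with e ⟨h1, _⟩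
    rw [twist_mul_ιt_inr_mul_star_twist g h1]; rfl
  have hblock2 : ∀ a : A, Tendsto (fun e => twist α g e * ιt α a * ιt α (s e)) l (𝓝 0) := by
    refine fun a => squeeze_zero_norm' ?_ (hbs a)
    filter_upwards [hl.eventually_norm] with e he
    rw [mul_assoc]
    exact (norm_mul_le _ _).trans (mul_le_of_le_one_left (norm_nonneg _) (norm_twist_le g he))
  have hblock3 : ∀ a : A, Tendsto (fun e => ιt α (s e) * ιt α a * star (twist α g e)) l
      (𝓝 0) := by
    refine fun a => squeeze_zero_norm' ?_ (hsb a)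
    filter_upwards [hl.eventually_norm] with e he
    refine (norm_mul_le _ _).trans (mul_le_of_le_one_right (norm_nonneg _) ?_)
    rw [norm_star]; exact norm_twist_le g he
  have hblock4 : ∀ a : A, Tendsto (fun e => ιt α (s e) * ιt α a * ιt α (s e)) l (𝓝 0) := by
    intro a
    have h0 : Tendsto (fun e => ‖ιt α (s e) * ιt α a‖ * 2) l (𝓝 0) := by
      simpa using (hsb a).mul_const 2
    refine squeeze_zero_norm' ?_ h0
    filter_upwards [hgood] with e he
    refine (norm_mul_le _ _).trans (mul_le_mul_of_nonneg_left ?_ (norm_nonneg _))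
    refine (hι _).trans ?_
    have h1 : ‖s e‖ * ‖s e‖ ≤ 2 := by
      have he1 := he.2
      rw [← CStarRing.norm_star_mul_self, (hs e he).1, (hs e he).2.1]
      refine (norm_sub_le _ _).trans ?_
      have h2 := norm_mul_le (e : Unitization ℂ A) e
      rw [Unitization.norm_inr] at h2
      rw [norm_one]
      nlinarith [norm_nonneg e]
    nlinarith [norm_nonneg (s e)]
  rw [hsplit] at hP1 ⊢
  rw [hsplit'] at hP2 ⊢
  exact mvnEquiv_of_tendsto_rotation (fun i j r => Algebra.commutes (P i j).fst r)
    (isStarProjection_scalarPart α hP) hP1 hP2 (hrel.mono fun e he => he.2)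
    (fun i j => hblock1 (b i j)) (fun i j => hblock2 (b i j)) (fun i j => hblock3 (b i j))
    (fun i j => hblock4 (b i j))

/-- The crossed product makes the action on `K₀₀(Ã)` trivial. -/
theorem K00_map_comp_action (g : G) :
    (K00.map (ιt α : Unitization ℂ A →⋆ₙₐ[ℂ] Unitization ℂ (CrossedProduct α))).comp
      (K00.map (actt α g : Unitization ℂ A →⋆ₙₐ[ℂ] Unitization ℂ A)) =
    K00.map (ιt α : Unitization ℂ A →⋆ₙₐ[ℂ] Unitization ℂ (CrossedProduct α)) := by
  apply Algebra.GrothendieckAddGroup.lift.symm.injective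
  ext x
  change K00.map _ (K00.map _ (Algebra.GrothendieckAddGroup.of x)) =
    K00.map _ (Algebra.GrothendieckAddGroup.of x)
  rw [K00.map_of, K00.map_of, K00.map_of]
  induction x using VMonoid.ind with | h p => ?_
  rw [VMonoid.map_mk, VMonoid.map_mk, VMonoid.map_mk]
  let q : MatrixProjection (Unitization ℂ (CrossedProduct α)) :=
    ⟨p.size, scalarPart α p.val, isStarProjection_scalarPart α p.isStarProjection⟩
  refine add_right_cancel (b := Algebra.GrothendieckAddGroup.of (VMonoid.mk q)) ?_
  rw [← map_add, ← map_add, VMonoid.mk_add_mk, VMonoid.mk_add_mk]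
  congr 1
  have h := mvnEquiv_fromBlocks_scalarPart α g p.isStarProjection
  refine VMonoid.mk_eq_mk_of_equiv (MatrixProjection.add_equiv _ _) ?_
  exact (MatrixProjection.add_equiv _ _).trans (MatrixProjection.isStarProjection _)
    ((MatrixProjection.isStarProjection _).fromBlocks q.isStarProjection) h

end TrivialAction

/-! ### The kernel of `V(B) → K₀(B)` for stably finite `B` -/

theorem VMonoid.mk_eq_zero {R : Type*} [NonUnitalRing R] [StarRing R] {p : MatrixProjection R}
    (h : p.val = 0) : VMonoid.mk p = 0 := by
  refine VMonoid.mk_eq_mk.2 ⟨0, ?_, by ext i; exact Fin.elim0 i⟩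
  rw [h]
  exact Matrix.mul_zero _

/-- If the class of `p` vanishes in the Grothendieck group, then `p` can be removed from
`diag(p, r)` for some projection `r`. -/
theorem MatrixProjection.exists_mvnEquiv_of_K00_eq_zero {R : Type*} [NonUnitalRing R] [StarRing R]
    {p : MatrixProjection R} (h : Algebra.GrothendieckAddGroup.of (VMonoid.mk p) = 0) :
    ∃ r : MatrixProjection R, MvNEquiv (fromBlocks p.val 0 0 r.val)
      (fromBlocks (0 : Matrix (Fin p.size) (Fin p.size) R) 0 0 r.val) := by
  obtain ⟨c, h1⟩ := ((AddLocalization.addMonoidOf ⊤).eq_iff_exists).1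
    (h.trans (map_zero _).symm)
  obtain ⟨r, hrc⟩ : ∃ r : MatrixProjection R, VMonoid.mk r = c.1 :=
    Quotient.exists_rep _
  let z : MatrixProjection R := ⟨p.size, 0, .zero _⟩
  have h2 : VMonoid.mk (p.add r) = VMonoid.mk (z.add r) := by
    rw [← VMonoid.mk_add_mk, ← VMonoid.mk_add_mk, VMonoid.mk_eq_zero (p := z) rfl, add_comm,
      add_comm 0, hrc]
    exact h1
  have hpr := p.isStarProjection.fromBlocks r.isStarProjection
  have hzr := z.isStarProjection.fromBlocks r.isStarProjection
  exact ⟨r, ((MatrixProjection.add_equiv p r).symm.trans hpr (z.add r).isStarProjection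
    (VMonoid.mk_eq_mk.1 h2)).trans hpr hzr (MatrixProjection.add_equiv z r)⟩

/-- If the projection `d` is equivalent to a subprojection `f`, there is an isometry with
defect projection `d - f`. -/
theorem MvNEquiv.exists_isometry {R m : Type*} [Ring R] [StarRing R] [Fintype m] [DecidableEq m]
    {d f : Matrix m m R} (h : MvNEquiv d f) (hd : IsStarProjection d) (hf : IsStarProjection f)
    (hdf : d * f = f) : ∃ w : Matrix m m R, wᴴ * w = 1 ∧ w * wᴴ = 1 - (d - f) := by
  obtain ⟨v, hv, hv'⟩ := h
  have hds : dᴴ = d := hd.isSelfAdjoint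
  have hdd : d * d = d := hd.isIdempotentElem
  have hfs : fᴴ = f := hf.isSelfAdjoint
  have hff : f * f = f := hf.isIdempotentElem
  -- the compression `f v d` is a partial isometry with the same initial and final projections
  let u := f * v * d
  have hud : u * d = u := by simp only [u, mul_assoc, hdd]
  have hdu : d * u = u := by simp only [u, ← mul_assoc, hdf]
  have hus : uᴴ = d * vᴴ * f := by
    simp only [u, conjTranspose_mul, hds, hfs, mul_assoc]
  have hu : uᴴ * u = d := by
    calc uᴴ * u = d * vᴴ * (f * f) * v * d := by rw [hus]; simp only [u, mul_assoc]
      _ = d * (vᴴ * v) * (vᴴ * v) * d := by rw [hff, ← hv']; simp only [mul_assoc]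
      _ = d := by rw [hv, hdd, hdd, hdd]
  have hu' : u * uᴴ = f := by
    calc u * uᴴ = f * v * (d * d) * vᴴ * f := by rw [hus]; simp only [u, mul_assoc]
      _ = f * (v * vᴴ) * (v * vᴴ) * f := by rw [hdd, ← hv]; simp only [mul_assoc]
      _ = f := by rw [hv', hff, hff, hff]
  have hud' : d * uᴴ = uᴴ := by rw [← hds, ← conjTranspose_mul, hud]
  have hdu' : uᴴ * d = uᴴ := by
    conv_rhs => rw [← hdu, conjTranspose_mul, hds]
  refine ⟨u + (1 - d), ?_, ?_⟩
  · rw [conjTranspose_add, conjTranspose_sub, conjTranspose_one, hds]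
    simp only [add_mul, mul_add, sub_mul, mul_sub, one_mul, mul_one, hu, hdu, hdu', hdd]
    abel
  · rw [conjTranspose_add, conjTranspose_sub, conjTranspose_one, hds]
    simp only [add_mul, mul_add, sub_mul, mul_sub, one_mul, mul_one, hu', hud, hud', hdd]
    abel

/-- An isometry over `B̃` whose defect lies over `B` can be corrected by its scalar part, which is
unitary, to an isometry of the form `1 + b` with `b` over `B` and with the same defect. -/
theorem exists_isometry_one_add {B m : Type*} [NonUnitalCStarAlgebra B] [Fintype m] [DecidableEq m]
    {P : Matrix m m B} {w : Matrix m m (Unitization ℂ B)} (hw : wᴴ * w = 1)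
    (hw' : w * wᴴ = 1 - P.map (Unitization.inr : B → Unitization ℂ B)) :
    ∃ b : Matrix m m B, bᴴ + b + bᴴ * b = 0 ∧ b + bᴴ + b * bᴴ = -P := by
  let σ : Unitization ℂ B →⋆ₙₐ[ℂ] ℂ := unitizationFst B
  let τ : ℂ →⋆ₐ[ℂ] Unitization ℂ B := StarAlgHom.ofId ℂ _
  have hστ : ∀ z, σ (τ z) = z := fun z => rfl
  let u : Matrix m m ℂ := w.map σ
  have hσs : ∀ M : Matrix m m (Unitization ℂ B), Mᴴ.map σ = (M.map σ)ᴴ := fun M =>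
    conjTranspose_map σ (fun x => map_star σ x)
  have hτs : ∀ M : Matrix m m ℂ, Mᴴ.map τ = (M.map τ)ᴴ := fun M =>
    conjTranspose_map τ (fun x => map_star τ x)
  have hσ1 : (1 : Matrix m m (Unitization ℂ B)).map σ = 1 :=
    Matrix.map_one σ (map_zero σ) rfl
  have hτ1 : (1 : Matrix m m ℂ).map τ = 1 := Matrix.map_one τ (map_zero τ) (map_one τ)
  have hu : uᴴ * u = 1 := by
    rw [← hσs, ← Matrix.map_mul, hw, hσ1]
  have hu' : u * uᴴ = 1 := mul_eq_one_comm.1 hu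
  let W := w * uᴴ.map τ
  have hWs : Wᴴ = u.map τ * wᴴ := by
    rw [conjTranspose_mul, ← hτs, conjTranspose_conjTranspose]
  have hW : Wᴴ * W = 1 := by
    calc Wᴴ * W = u.map τ * (wᴴ * w) * uᴴ.map τ := by rw [hWs]; simp only [W, mul_assoc]
      _ = 1 := by rw [hw, mul_one, ← Matrix.map_mul, hu', hτ1]
  have hW' : W * Wᴴ = 1 - P.map (Unitization.inr : B → Unitization ℂ B) := by
    calc W * Wᴴ = w * (uᴴ.map τ * u.map τ) * wᴴ := by rw [hWs]; simp only [W, mul_assoc]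
      _ = _ := by rw [← Matrix.map_mul, hu, hτ1, mul_one, hw']
  have hWσ : W.map σ = 1 := by
    rw [Matrix.map_mul, Matrix.map_map, show (σ ∘ τ : ℂ → ℂ) = id from funext hστ, Matrix.map_id]
    exact hu'
  let ρ : B →⋆ₙₐ[ℂ] Unitization ℂ B := Unitization.inrNonUnitalStarAlgHom ℂ B
  have hρs : ∀ M : Matrix m m B, Mᴴ.map ρ = (M.map ρ)ᴴ := fun M =>
    conjTranspose_map ρ (fun x => map_star ρ x)
  have hρ : Function.Injective fun M : Matrix m m B => M.map ρ :=
    Matrix.map_injective Unitization.inr_injective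
  let b : Matrix m m B := W.map fun a => a.snd
  have hWb : W = 1 + b.map ρ := by
    ext1 i j
    have h1 : (W i j).fst = (1 : Matrix m m ℂ) i j := congr($hWσ i j)
    have h2 : (1 : Matrix m m (Unitization ℂ B)) i j = Unitization.inl (W i j).fst := by
      rw [h1, Matrix.one_apply, Matrix.one_apply]
      split_ifs <;> simp
    rw [Matrix.add_apply, h2]
    exact (Unitization.inl_fst_add_inr_snd_eq (W i j)).symm
  have hadd : ∀ M N : Matrix m m B, (M + N).map ρ = M.map ρ + N.map ρ := fun M N =>
    Matrix.map_add ρ (map_add ρ) M N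
  refine ⟨b, hρ ?_, hρ ?_⟩
  · change (bᴴ + b + bᴴ * b).map ρ = (0 : Matrix m m B).map ρ
    rw [hadd, hadd, Matrix.map_mul, hρs, Matrix.map_zero _ (map_zero ρ)]
    calc _ = Wᴴ * W - 1 := by
          rw [hWb, conjTranspose_add, conjTranspose_one, add_mul, mul_add, mul_add, one_mul,
            one_mul, mul_one]
          abel
      _ = 0 := by rw [hW, sub_self]
  · change (b + bᴴ + b * bᴴ).map ρ = (-P).map ρ
    have hneg : (-P).map ρ = -P.map ρ := by ext1 i j; exact map_neg ρ _
    rw [hadd, hadd, Matrix.map_mul, hρs, hneg]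
    calc _ = W * Wᴴ - 1 := by
          rw [hWb, conjTranspose_add, conjTranspose_one, add_mul, mul_add, mul_add, one_mul,
            one_mul, mul_one]
          abel
      _ = -P.map ρ := by rw [hW', sub_sub_cancel_left]; rfl

/-- Matrix algebras over a stably finite C⋆-algebra contain no isometries `1 + b` other than
unitaries. -/
theorem IsStablyFiniteCStar.eq_zero_of_isometry {B m : Type*} [NonUnitalCStarAlgebra B] [Fintype m]
    (hB : IsStablyFiniteCStar B) {b P : Matrix m m B} (h1 : bᴴ + b + bᴴ * b = 0)
    (h2 : b + bᴴ + b * bᴴ = -P) : P = 0 := by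
  let e := (Fintype.equivFin m).symm
  let Φ := (CStarEnvelope.incl (FinMatrix B)).comp (FinMatrix.corner (A := B) (Fintype.card m))
  have hΦ : Function.Injective Φ :=
    (Stabilization.incl_injective B).comp (FinMatrix.corner_injective _)
  let c : CStarMatrix (Fin (Fintype.card m)) (Fin (Fintype.card m)) B :=
    CStarMatrix.ofMatrix (b.submatrix e e)
  let Q : CStarMatrix (Fin (Fintype.card m)) (Fin (Fintype.card m)) B :=
    CStarMatrix.ofMatrix (P.submatrix e e)
  have h3 : star c + c + star c * c = 0 := by
    change (b.submatrix e e)ᴴ + b.submatrix e e + (b.submatrix e e)ᴴ * b.submatrix e e = 0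
    rw [conjTranspose_submatrix, submatrix_mul_equiv]
    exact congr(Matrix.submatrix $h1 e e)
  have h4 : c + star c + c * star c = -Q := by
    change b.submatrix e e + (b.submatrix e e)ᴴ + b.submatrix e e * (b.submatrix e e)ᴴ =
      -P.submatrix e e
    rw [conjTranspose_submatrix, submatrix_mul_equiv]
    exact congr(Matrix.submatrix $h2 e e)
  have h5 : Φ Q = 0 := by
    refine IsFiniteCStar.eq_zero_of_isometry hB (b := Φ c) ?_ ?_
    · rw [← map_star, ← map_mul, ← map_add, ← map_add, h3, map_zero]
    · rw [← map_star, ← map_mul, ← map_add, ← map_add, h4, map_neg]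
  have h6 : Q = 0 := hΦ (h5.trans (map_zero Φ).symm)
  ext i j
  have := congr($h6 (e.symm i) (e.symm j))
  simpa [Q] using this

/-- Over a stably finite C⋆-algebra, only the zero projection has the class zero. -/
theorem IsStablyFiniteCStar.val_eq_zero {B : Type*} [NonUnitalCStarAlgebra B]
    (hB : IsStablyFiniteCStar B) {p : MatrixProjection B} (hp : K0.ofV B (VMonoid.mk p) = 0) :
    p.val = 0 := by
  let ρ : B →⋆ₙₐ[ℂ] Unitization ℂ B := Unitization.inrNonUnitalStarAlgHom ℂ B
  have h0 : Algebra.GrothendieckAddGroup.of (VMonoid.mk (p.map ρ)) = 0 := congr(($hp).1)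
  obtain ⟨r, hr⟩ := MatrixProjection.exists_mvnEquiv_of_K00_eq_zero h0
  have hr : MvNEquiv (fromBlocks (p.val.map ρ) 0 0 r.val)
      (fromBlocks (0 : Matrix (Fin p.size) (Fin p.size) _) 0 0 r.val) := hr
  have hrr : r.val * r.val = r.val := r.isStarProjection.isIdempotentElem
  obtain ⟨w, hw, hw'⟩ := hr.exists_isometry
    ((p.map ρ).isStarProjection.fromBlocks r.isStarProjection)
    ((IsStarProjection.zero _).fromBlocks r.isStarProjection)
    (by rw [fromBlocks_multiply]; simp [hrr])
  have hdef : fromBlocks (p.val.map ρ) 0 0 r.val - fromBlocks 0 0 0 r.val =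
      (fromBlocks p.val 0 0 (0 : Matrix (Fin r.size) (Fin r.size) B)).map
        (Unitization.inr : B → Unitization ℂ B) := by
    rw [sub_eq_add_neg, fromBlocks_neg, fromBlocks_add, fromBlocks_map]
    simp only [neg_zero, add_zero, add_neg_cancel, Matrix.map_zero _ (Unitization.inr_zero ℂ)]
    rfl
  rw [hdef] at hw'
  obtain ⟨b, h1, h2⟩ := exists_isometry_one_add hw hw'
  have h3 := hB.eq_zero_of_isometry h1 h2
  exact (fromBlocks_inj.1 (h3.trans fromBlocks_zero.symm)).1

theorem K0.map_ofV {A B : Type*} [NonUnitalCStarAlgebra A] [NonUnitalCStarAlgebra B]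
    (φ : A →⋆ₙₐ[ℂ] B) (p : MatrixProjection A) :
    K0.map φ (K0.ofV A (VMonoid.mk p)) = K0.ofV B (VMonoid.mk (p.map φ)) := by
  refine Subtype.ext ?_
  change K00.map (Unitization.starMap φ : Unitization ℂ A →⋆ₙₐ[ℂ] Unitization ℂ B)
    (Algebra.GrothendieckAddGroup.of (VMonoid.map (Unitization.inrNonUnitalStarAlgHom ℂ A)
      (VMonoid.mk p))) = Algebra.GrothendieckAddGroup.of
        (VMonoid.map (Unitization.inrNonUnitalStarAlgHom ℂ B) (VMonoid.mk (p.map φ)))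
  have h : (Unitization.starMap φ : Unitization ℂ A →⋆ₙₐ[ℂ] Unitization ℂ B).comp
      (Unitization.inrNonUnitalStarAlgHom ℂ A) = (Unitization.inrNonUnitalStarAlgHom ℂ B).comp φ :=
    NonUnitalStarAlgHom.ext fun a => Unitization.starMap_inr φ a
  rw [K00.map_of, ← VMonoid.map_comp, ← VMonoid.map_mk, ← VMonoid.map_comp, h]

/-! ### The subgroup generated by the action and the positive cone -/

section ActionSubgroup

variable {A G : Type*} [NonUnitalCStarAlgebra A] [Group G] (α : G →* (A ≃⋆ₐ[ℂ] A))

/-- The subgroup `H_α` dies in the crossed product. -/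
theorem K0.map_ι_eq_zero {x : K0 A} (hx : x ∈ K0.actionSubgroup α) :
    K0.map (CrossedProduct.ι α) x = 0 := by
  have h : K0.actionSubgroup α ≤ (K0.map (CrossedProduct.ι α)).ker := by
    refine (AddSubgroup.closure_le _).2 ?_
    rintro _ ⟨g, y, rfl⟩
    rw [SetLike.mem_coe, AddMonoidHom.mem_ker, map_sub, sub_eq_zero]
    exact Subtype.ext (DFunLike.congr_fun (K00_map_comp_action α g) y.1).symm
  exact h hx

theorem K0.actionSubgroup_inter_positiveCone (h : IsStablyFiniteCStar (CrossedProduct α)) :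
    (K0.actionSubgroup α : Set (K0 A)) ∩ K0.positiveCone A = {0} := by
  refine Set.eq_singleton_iff_unique_mem.2
    ⟨⟨zero_mem _, 0, map_zero _⟩, ?_⟩
  rintro _ ⟨hx, c, rfl⟩
  induction c using VMonoid.ind with | h p => ?_
  have h1 := K0.map_ι_eq_zero α hx
  rw [K0.map_ofV] at h1
  have h2 : p.val.map (CrossedProduct.ι α) = 0 := h.val_eq_zero h1
  have h3 : p.val = 0 := by
    ext i j
    refine CrossedProduct.ι_injective α ?_
    rw [Matrix.zero_apply, map_zero]
    exact congr($h2 i j)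
  rw [VMonoid.mk_eq_zero h3, map_zero]

end ActionSubgroup

theorem proposition3p1 {A G : Type*} [NonUnitalCStarAlgebra A] [Group G]
    (α : G →* (A ≃⋆ₐ[ℂ] A)) :
    (IsAFEmbeddable (CrossedProduct α) → IsQuasidiagonal (CrossedProduct α)) ∧
    (IsQuasidiagonal (CrossedProduct α) →
      AllProjectionsFinite (Stabilization (CrossedProduct α)) ∧
      (HasProjectionApproxUnit (Stabilization A) → IsStablyFiniteCStar (CrossedProduct α))) ∧
    (K0.HasCancellation A → IsStablyFiniteCStar (CrossedProduct α) →
      (K0.actionSubgroup α : Set (K0 A)) ∩ K0.positiveCone A = {0}) :=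
  ⟨IsAFEmbeddable.isQuasidiagonal,
    fun h => ⟨h.allProjectionsFinite_stabilization,
      fun hA => ⟨HasProjectionApproxUnit.crossedProduct α hA,
        h.allProjectionsFinite_stabilization⟩⟩,
    fun _ h => K0.actionSubgroup_inter_positiveCone α h⟩
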